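/- **Theorem (Confident MC-LSPI with EGSS).** Consider a discounted MDP $(\mathcal S,\mathcal A,\mathbb P,r,\gamma)$ with rewards $r\in[0,1]$ and $\gamma\in[0,1)$, an initial state $\rho$, and a feature map $\phi:\mathcal S\times\mathcal A\to\mathbb R^d$, $d\ge 1$, with $\|\phi(s,a)\|_2\le 1$ for all $(s,a)$. Let $V_\pi$, $Q_\pi$ be the value functions of a stationary policy $\pi$, and $V^*=\sup_\pi V_\pi$. Let $b>0$, $\epsilon\ge0$, and assume that for each stationary policy $\pi$ there is $w_\pi\in\mathbb R^d$ with $\|w_\pi\|_2\le b$ and $|Q_\pi(s,a)-w_\pi^\top\phi(s,a)|\le\epsilon$ for all $(s,a)$. Assume access to a greedy oracle that returns, for every $w\in\mathbb R^d$ and $s\in\mathcal S$, a maximizer $a\in\mathcal A$ of $w^\top\phi(s,a)$ (ties broken arbitrarily). Let $\delta\in(0,1)$. *Algorithm.* For a finite core set $\mathcal C$ of state-action pairs let $\Phi_{\mathcal C}$ be the matrix with rows $\phi(z)$, $z\in\mathcal C$, and $V_{\mathcal C}=\Phi_{\mathcal C}^\top\Phi_{\mathcal C}+\lambda I$. The EGSS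 uncertainty check of a state $s$ computes the Cholesky factor $L$, $LL^\top=V_{\mathcal C}^{-1}$, and for each of the $2d$ directions $v\in\{\pm e_1,\dots,\pm e_d\}$ calls the oracle for $\hat a=\arg\max_a\phi(s,a)^\top Lv$; it returns the first $(s,\hat a)$ with $(\phi(s,\hat a)^\top Lv)^2>\tau$ as uncertain, and "certain" if there is none. Confident MC-LSPI starts with $\mathcal C=\{(\rho,\bar a)\}$, for a fixed default action $\bar a$, and adds uncertain pairs at $\rho$ until $\rho$ is certain. Then, from an arbitrary given policy $\pi_0$, it runs for $k=1,\dots,K$: for each $z\in\mathcal C$, average the discounted returns of $n$ rollouts which start with the pair $z$ and make $H$ further steps with $\pi_{k-1}$, applying the check to each state at which a further action is to be drawn; if a state is uncertain, add the pair found to $\mathcal C$ and restart policy iteration at $k=1$, from $\pi_0$; otherwise let $w_k=V_{\mathcal C}^{-1}\Phi_{\mathcal C}^\top q_{\mathcal C}$, with $q_{\mathcal C}$ the vector of averages, and let $\pi_k$ be the oracle's greedy policy for $w_k^\top\phi$. The output is $\pi_{K-1}$. The simulator is accessed locally: only $\rho$ and states returned by earlier queries are queried. *Parameters.* For $\kappa>0$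 set $\tau=1$, $\lambda=\frac{\kappa^2(1-\gamma)^4}{1024b^2d}$, $C_{\max}=\frac{2e}{e-1}d\big(\log2+\log(1+\frac1\lambda)\big)$, $\theta=\frac{\kappa(1-\gamma)^2}{32\sqrt{d\,C_{\max}}}$, and let $H,K,n$ be the following numbers rounded up to integers, with $H\ge0$ and $K\ge1$: $$H=\tfrac{\log(32\sqrt{d\,C_{\max}})-\log(\kappa(1-\gamma)^3)}{1-\gamma}-1,\quad K=\tfrac{\log\frac1{\kappa(1-\gamma)^2}+\log 8}{1-\gamma}+1,\quad n=\tfrac{\log(4KC_{\max}^2)-\log\delta}{2\theta^2(1-\gamma)^2}$$ (with the rounded $K$ in the formula for $n$). *Claim.* In every run the loops of the algorithm terminate, each after at most $C_{\max}$ passes. One elementary step is one real arithmetic operation or comparison, one oracle call, one simulator query, one reading of a feature coordinate, or one draw from $\pi_0$. There are absolute constants $c,p$ such that: 1. If $\epsilon=0$, then for every $\kappa>0$, with the above parameters, with probability at least $1-\delta$ $$V^*(\rho)-V_{\pi_{K-1}}(\rho)\le\kappa .$$ The number of queries is $\tilde{\mathcal O}\big(\frac{d^4}{\kappa^2(1-\gamma)^8}\big)$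 and the computation is $\mathrm{poly}(d,\frac1{1-\gamma},\frac1\kappa,\log\frac1\delta,\log(1+b))$: in every run there are at most $c\,\frac{d^4}{\bar\kappa^2(1-\gamma)^8}\Lambda(\kappa)^p$ queries and at most $c\,\Sigma(\kappa)^p$ elementary steps, where $\bar\kappa=\min\{\kappa,\frac1{1-\gamma}\}$. 2. If $\epsilon>0$, then with the above parameters for $\kappa=\frac{32\epsilon d}{(1-\gamma)^2}\big(1+\log(1+b^2\epsilon^{-2}d^{-1})\big)^{1/2}$, with probability at least $1-\delta$ $$V^*(\rho)-V_{\pi_{K-1}}(\rho)\le\frac{64\epsilon d}{(1-\gamma)^2}\big(1+\log(1+b^2\epsilon^{-2}d^{-1})\big)^{1/2}.$$ The number of queries is $\tilde{\mathcal O}\big(\frac{d^2}{\epsilon^2(1-\gamma)^4}\big)$ and the computation is $\mathrm{poly}(d,\frac1{1-\gamma},\frac1\epsilon,\log\frac1\delta,\log(1+b))$: in every run there are at most $c\,\frac{d^2}{\bar\epsilon^2(1-\gamma)^4}\Lambda(\epsilon)^p$ queries and at most $c\,\Sigma(\epsilon)^p$ elementary steps, where $\bar\epsilon=\min\{\epsilon,\frac1{1-\gamma}\}$.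 Here $\Lambda(x)=1+\log d+\log\frac1{1-\gamma}+\log(1+\frac1x)+\log\frac1\delta+\log(1+b)$ and $\Sigma(x)=1+d+\frac1{1-\gamma}+\frac1x+\log\frac1\delta+\log(1+b)$. -/

import Mathlib

open MeasureTheory ProbabilityTheory
open scoped ENNReal

universe u v w w'

namespace LSPI

noncomputable section

/-! ### Markov decision processes, policies and value functions -/

/-- A discounted Markov decision process with rewards in `[0, 1]`. -/
structure MDP (S : Type u) (A : Type v) [MeasurableSpace S] [MeasurableSpace A] where
  P : Kernel (S × A) S
  markov : IsMarkovKernel P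
  r : S × A → ℝ
  measurable_r : Measurable r
  r_mem : ∀ x, r x ∈ Set.Icc (0 : ℝ) 1
  γ : ℝ
  γ_nonneg : 0 ≤ γ
  γ_lt_one : γ < 1

/-- Stationary (possibly randomized) policies. -/
structure Policy (S : Type u) (A : Type v) [MeasurableSpace S] [MeasurableSpace A] where
  act : Kernel S A
  markov : IsMarkovKernel act

section Values

variable {S : Type u} {A : Type v} [MeasurableSpace S] [MeasurableSpace A]

/-- The law of the state `s_t`, given `s_0`, when `π` is followed. -/
def stateLaw (M : MDP S A) (π : Policy S A) : ℕ → Kernel S S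
  | 0 => Kernel.id
  | t + 1 => M.P ∘ₖ ((Kernel.id ×ₖ π.act) ∘ₖ stateLaw M π t)

/-- The law of the pair `(s_t, a_t)`, given `s_0`, when `π` is followed. -/
def pairLaw (M : MDP S A) (π : Policy S A) (t : ℕ) : Kernel S (S × A) :=
  (Kernel.id ×ₖ π.act) ∘ₖ stateLaw M π t

/-- `V_π(s)`: the expected discounted reward. The rewards lie in `[0, 1]` and `γ < 1`, so that the
series converges and may be taken inside or outside of the expectation. -/
def V (M : MDP S A) (π : Policy S A) (s : S) : ℝ :=
  ∑' t : ℕ, M.γ ^ t * ∫ x, M.r x ∂(pairLaw M π t s)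

/-- `Q_π(s, a) = r(s, a) + γ E[V_π(s')]`. -/
def Q (M : MDP S A) (π : Policy S A) (s : S) (a : A) : ℝ :=
  M.r (s, a) + M.γ * ∫ s', V M π s' ∂(M.P (s, a))

/-- The optimal value. -/
def Vstar (M : MDP S A) (s : S) : ℝ := ⨆ π : Policy S A, V M π s

/-- Linear realizability up to `ε` of the action-value functions of all policies. -/
def LinearRealizable (M : MDP S A) {d : ℕ} (φ : S × A → Fin d → ℝ) (b ε : ℝ) : Prop :=
  ∀ π : Policy S A, ∃ wt : Fin d → ℝ, ‖WithLp.toLp 2 wt‖ ≤ b ∧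
    ∀ s a, |Q M π s a - wt ⬝ᵥ φ (s, a)| ≤ ε

/-- Features of Euclidean norm at most one. -/
def BoundedFeatures {S : Type u} {A : Type v} {d : ℕ} (φ : S × A → Fin d → ℝ) : Prop :=
  ∀ x, ‖WithLp.toLp 2 (φ x)‖ ≤ 1

/-- A greedy oracle for the feature map `φ`: it returns, for a weight vector and a state, an action
that maximizes the linear score. Ties are broken arbitrarily (but measurably in the state, so that
greedy policies are policies). -/
structure GreedyOracle {d : ℕ} (φ : S × A → Fin d → ℝ) where
  act : (Fin d → ℝ) → S → A
  measurable_act : ∀ wt, Measurable (act wt)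
  isMax : ∀ wt s a, wt ⬝ᵥ φ (s, a) ≤ wt ⬝ᵥ φ (s, act wt s)

end Values

/-! ### Programs

A program runs on a real-number machine. It can query the simulator, call the greedy oracle, read
one coordinate of a feature vector, draw an action from the initial policy, and perform one
arithmetic operation or one comparison on real numbers. Each of these is one elementary step. -/

/-- The arithmetic operations (`sqrt` ignores its second argument). -/
inductive Op
  | add | sub | mul | div | sqrt

/-- The result of an arithmetic operation. -/
def Op.eval : Op → ℝ → ℝ → ℝ
  | .add, x, y => x + y
  | .sub, x, y => x - y
  | .mul, x, y => x * y
  | .div, x, y => x / y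
  | .sqrt, x, _ => Real.sqrt x

/-- Programs with results in `α`; the continuation of each instruction receives its answer. A
simulator query returns the next state and the reward. -/
inductive Prog (S : Type u) (A : Type v) (d : ℕ) (α : Type w) : Type (max u v w)
  | ret (x : α) : Prog S A d α
  | query (s : S) (a : A) (k : S → ℝ → Prog S A d α) : Prog S A d α
  | greedy (wt : Fin d → ℝ) (s : S) (k : A → Prog S A d α) : Prog S A d α
  | coord (s : S) (a : A) (i : Fin d) (k : ℝ → Prog S A d α) : Prog S A d α
  | initAct (s : S) (k : A → Prog S A d α) : Prog S A d α
  | arith (o : Op) (x y : ℝ) (k : ℝ → Prog S A d α) : Prog S A d α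
  | less (x y : ℝ) (k : Bool → Prog S A d α) : Prog S A d α

namespace Prog

variable {S : Type u} {A : Type v} {d : ℕ} {α : Type w} {β : Type w'}

/-- Sequential composition. -/
def bind : Prog S A d α → (α → Prog S A d β) → Prog S A d β
  | ret x, f => f x
  | query s a k, f => query s a fun s' r => (k s' r).bind f
  | greedy wt s k, f => greedy wt s fun a => (k a).bind f
  | coord s a i k, f => coord s a i fun x => (k x).bind f
  | initAct s k, f => initAct s fun a => (k a).bind f
  | arith o x y k, f => arith o x y fun z => (k z).bind f
  | less x y k, f => less x y fun c => (k c).bind f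

/-- One arithmetic operation. -/
def op (o : Op) (x y : ℝ) : Prog S A d ℝ := arith o x y ret

/-- Runs `f 0, f 1, …` one after the other and stores the results. -/
def tabulate : (n : ℕ) → (Fin n → Prog S A d α) → Prog S A d (Fin n → α)
  | 0, _ => ret Fin.elim0
  | n + 1, f => (f 0).bind fun x => (tabulate n fun i => f i.succ).bind fun xs =>
      ret (Fin.cons x xs)

/-- Runs `f 0, f 1, …` and adds up the results. -/
def sum : (n : ℕ) → (Fin n → Prog S A d ℝ) → Prog S A d ℝ
  | 0, _ => ret 0
  | n + 1, f => (f 0).bind fun x => (sum n fun i => f i.succ).bind fun y => op .add x y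

section Semantics

variable [MeasurableSpace S] [MeasurableSpace A]
variable (M : MDP S A) (φ : S × A → Fin d → ℝ) (G : GreedyOracle φ) (π₀ : Policy S A)

/-- The expectation of `f` of the result, over the randomness of the simulator (next states are
drawn afresh from the transition kernel in every query) and of the initial policy. -/
def expect : Prog S A d α → (α → ℝ≥0∞) → ℝ≥0∞
  | ret x, f => f x
  | query s a k, f => ∫⁻ s', (k s' (M.r (s, a))).expect f ∂(M.P (s, a))
  | greedy wt s k, f => (k (G.act wt s)).expect f
  | coord s a i k, f => (k (φ (s, a) i)).expect f
  | initAct s k, f => ∫⁻ a, (k a).expect f ∂(π₀.act s)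
  | arith o x y k, f => (k (o.eval x y)).expect f
  | less x y k, f =>
      open Classical in if x < y then (k true).expect f else (k false).expect f

/-- The probability that the result satisfies `E`. -/
def prob (p : Prog S A d α) (E : α → Prop) : ℝ≥0∞ :=
  p.expect M φ G π₀ ({x | E x}.indicator 1)

/-- In every run, whatever next states and initial-policy actions are drawn, the number `q` of
simulator queries, the total number `t` of elementary steps (the queries and the oracle calls
included) and the result `x` satisfy `E q t x`. -/
def Sure : Prog S A d α → (ℕ → ℕ → α → Prop) → Prop
  | ret x, E => E 0 0 x
  | query s a k, E => ∀ s', (k s' (M.r (s, a))).Sure fun q t x => E (q + 1) (t + 1) x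
  | greedy wt s k, E => (k (G.act wt s)).Sure fun q t x => E q (t + 1) x
  | coord s a i k, E => (k (φ (s, a) i)).Sure fun q t x => E q (t + 1) x
  | initAct _ k, E => ∀ a, (k a).Sure fun q t x => E q (t + 1) x
  | arith o x y k, E => (k (o.eval x y)).Sure fun q t x => E q (t + 1) x
  | less x y k, E =>
      (x < y → (k true).Sure fun q t x => E q (t + 1) x) ∧
      (¬ x < y → (k false).Sure fun q t x => E q (t + 1) x)

/-- Local access: in every run the simulator is queried only at states in `X` (the states known at
the start) and at states which it returned before. -/
def LocalAccess : Prog S A d α → Set S → Prop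
  | ret _, _ => True
  | query s a k, X => s ∈ X ∧ ∀ s', (k s' (M.r (s, a))).LocalAccess (insert s' X)
  | greedy wt s k, X => (k (G.act wt s)).LocalAccess X
  | coord s a i k, X => (k (φ (s, a) i)).LocalAccess X
  | initAct _ k, X => ∀ a, (k a).LocalAccess X
  | arith o x y k, X => (k (o.eval x y)).LocalAccess X
  | less x y k, X =>
      (x < y → (k true).LocalAccess X) ∧ (¬ x < y → (k false).LocalAccess X)

end Semantics

end Prog

/-! ### Linear algebra -/

section Algorithm

variable {S : Type u} {A : Type v} {d : ℕ}

open Prog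

/-- The inner product of two vectors. -/
def dot (x y : Fin d → ℝ) : Prog S A d ℝ := Prog.sum d fun i => op .mul (x i) (y i)

/-- The product of a matrix and a vector. -/
def mulVec (B : Fin d → Fin d → ℝ) (x : Fin d → ℝ) : Prog S A d (Fin d → ℝ) :=
  tabulate d fun i => dot (B i) x

/-- `(Φᵀ Φ + lam I)⁻¹`, where the rows of `Φ` are the vectors in the list: starting from
`lam⁻¹ I`, the inverse `B` is changed to `B - (B x) (B x)ᵀ / (1 + xᵀ B x)` for each row `x`
(Sherman-Morrison). -/
def invGram (lam : ℝ) : List (Fin d → ℝ) → Prog S A d (Fin d → Fin d → ℝ)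
  | [] => tabulate d fun i => tabulate d fun j => op .div (if i = j then 1 else 0) lam
  | x :: xs =>
      (invGram lam xs).bind fun B =>
      (mulVec B x).bind fun y =>
      (dot x y).bind fun z =>
      (op .add 1 z).bind fun c =>
      tabulate d fun i => tabulate d fun j =>
        (op .mul (y i) (y j)).bind fun m =>
        (op .div m c).bind fun e =>
        op .sub (B i j) e

/-- The columns of the Cholesky factor with indices in the list, computed from the residual `R`
and written into `L`. -/
def choleskyLoop : List (Fin d) → (Fin d → Fin d → ℝ) → (Fin d → Fin d → ℝ) →
    Prog S A d (Fin d → Fin d → ℝ)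
  | [], _, L => ret L
  | j :: js, R, L =>
      (op .sqrt (R j j) 0).bind fun pivot =>
      (tabulate d fun i => op .div (R i j) pivot).bind fun col =>
      (tabulate d fun i => tabulate d fun k =>
        (op .mul (col i) (col k)).bind fun m => op .sub (R i k) m).bind fun R' =>
      choleskyLoop js R' fun i k => if k = j then col i else L i k

/-- The lower triangular matrix `L` with `L Lᵀ = B`, for a positive definite `B`. -/
def cholesky (B : Fin d → Fin d → ℝ) : Prog S A d (Fin d → Fin d → ℝ) :=
  choleskyLoop (List.finRange d) B fun _ _ => 0

/-! ### The algorithm -/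

/-- An element of the core set: a state, an action, and their feature vector. (The value estimates
are kept in a separate list, in the order of the core set.) -/
structure CoreElt (S : Type u) (A : Type v) (d : ℕ) where
  state : S
  action : A
  feat : Fin d → ℝ

/-- The inputs of the algorithm: number of iterations, number of rollouts, rollout length,
threshold, and regularization coefficient. -/
structure Params where
  K : ℕ
  n : ℕ
  H : ℕ
  τ : ℝ
  lam : ℝ

/-- The feature vector of a state-action pair. -/
def readFeat (s : S) (a : A) : Prog S A d (Fin d → ℝ) :=
  tabulate d fun i => coord s a i ret

/-- The directions `v = ± e_l`, as pairs of an index and a sign. -/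
def directions (d : ℕ) : List (Fin d × ℝ) :=
  (List.finRange d).flatMap fun l => [(l, 1), (l, -1)]

/-- The loop of the uncertainty check over the directions `v`. The answer `some z` means
that `z` is uncertain, `none` means that the state is certain. -/
def egssLoop (τ : ℝ) (s : S) (L : Fin d → Fin d → ℝ) :
    List (Fin d × ℝ) → Prog S A d (Option (CoreElt S A d))
  | [] => ret none
  | (l, σ) :: vs =>
      (tabulate d fun i => op .mul σ (L i l)).bind fun Lv =>
      greedy Lv s fun a =>
      (readFeat s a).bind fun f =>
      (dot f Lv).bind fun x =>
      (op .mul x x).bind fun y =>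
      less τ y fun
        | true => ret (some ⟨s, a, f⟩)
        | false => egssLoop τ s L vs

/-- The uncertainty check by efficient good set search. -/
def uncertaintyCheck (prm : Params) (s : S) (C : List (CoreElt S A d)) :
    Prog S A d (Option (CoreElt S A d)) :=
  (invGram prm.lam (C.map CoreElt.feat)).bind fun B =>
  (cholesky B).bind fun L =>
  egssLoop prm.τ s L (directions d)

/-- The policies which occur in a run: `none` is the initial policy, `some wt` is the greedy policy
with respect to `wt`. -/
abbrev Pol (d : ℕ) := Option (Fin d → ℝ)

/-- Draws an action from a policy. -/
def sampleAct (s : S) : Pol d → Prog S A d A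
  | none => initAct s ret
  | some wt => greedy wt s ret

/-- The remaining `m` steps of one rollout, from state `s`, with current discount factor `g` and
collected discounted reward `acc`. The answer is an uncertain element, or the return. -/
def rolloutSteps (prm : Params) (γ : ℝ) (pol : Pol d) (C : List (CoreElt S A d)) :
    ℕ → S → ℝ → ℝ → Prog S A d (CoreElt S A d ⊕ ℝ)
  | 0, _, _, acc => ret (.inr acc)
  | m + 1, s, g, acc =>
      (uncertaintyCheck prm s C).bind fun
        | some z => ret (.inl z)
        | none =>
            (sampleAct s pol).bind fun a =>
            query s a fun s' r =>
            (op .mul g r).bind fun x =>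
            (op .add acc x).bind fun acc' =>
            (op .mul g γ).bind fun g' =>
            rolloutSteps prm γ pol C m s' g' acc'

/-- The remaining `m` rollouts from `z`; `tot` is the sum of the returns so far. -/
def rolloutLoop (prm : Params) (γ : ℝ) (pol : Pol d) (C : List (CoreElt S A d))
    (z : CoreElt S A d) : ℕ → ℝ → Prog S A d (CoreElt S A d ⊕ ℝ)
  | 0, tot => ret (.inr tot)
  | m + 1, tot =>
      query z.state z.action fun s r =>
      (rolloutSteps prm γ pol C prm.H s γ r).bind fun
        | .inl z' => ret (.inl z')
        | .inr x => (op .add tot x).bind fun tot' => rolloutLoop prm γ pol C z m tot'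

/-- The rollout routine: an uncertain element, or the average of `n` returns. -/
def rollout (prm : Params) (γ : ℝ) (pol : Pol d) (C : List (CoreElt S A d))
    (z : CoreElt S A d) : Prog S A d (CoreElt S A d ⊕ ℝ) :=
  (rolloutLoop prm γ pol C z prm.n 0).bind fun
    | .inl z' => ret (.inl z')
    | .inr tot => (op .div tot prm.n).bind fun x => ret (.inr x)

/-- Rollouts from all elements in the list; the answer is an uncertain element, or the list of the
value estimates. -/
def evaluate (prm : Params) (γ : ℝ) (pol : Pol d) (C : List (CoreElt S A d)) :
    List (CoreElt S A d) → Prog S A d (CoreElt S A d ⊕ List ℝ)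
  | [] => ret (.inr [])
  | z :: zs =>
      (rollout prm γ pol C z).bind fun
        | .inl z' => ret (.inl z')
        | .inr x => (evaluate prm γ pol C zs).bind fun
            | .inl z' => ret (.inl z')
            | .inr xs => ret (.inr (x :: xs))

/-- `Φᵀ q`, for a list of pairs of a row of `Φ` and an entry of `q`. -/
def combine : List ((Fin d → ℝ) × ℝ) → Prog S A d (Fin d → ℝ)
  | [] => ret fun _ => 0
  | (f, q) :: xs => (combine xs).bind fun y =>
      tabulate d fun i => (op .mul q (f i)).bind fun m => op .add (y i) m

/-- The regularized least-squares weights `(Φᵀ Φ + lam I)⁻¹ Φᵀ q`. -/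
def leastSquares (lam : ℝ) (C : List (CoreElt S A d)) (q : List ℝ) :
    Prog S A d (Fin d → ℝ) :=
  (invGram lam (C.map CoreElt.feat)).bind fun B =>
  (combine ((C.map CoreElt.feat).zip q)).bind fun y =>
  mulVec B y

/-- The remaining `m` policy iterations; `cur` is the policy to be evaluated next, `prev` the one
evaluated last. The answer is an uncertain element, or the policy evaluated last: with
`m = K ≥ 1` and `cur = π_0` this is `π_{K-1}`. -/
def iterations (prm : Params) (γ : ℝ) (C : List (CoreElt S A d)) :
    ℕ → Pol d → Pol d → Prog S A d (CoreElt S A d ⊕ Pol d)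
  | 0, prev, _ => ret (.inr prev)
  | m + 1, _, cur =>
      (evaluate prm γ cur C C).bind fun
        | .inl z => ret (.inl z)
        | .inr q => (leastSquares prm.lam C q).bind fun wt =>
            iterations prm γ C m cur (some wt)

/-- Policy iteration, restarted with a larger core set whenever an uncertain element is met. At
most `N` starts are made; `none` says that they did not suffice. -/
def mainLoop (prm : Params) (γ : ℝ) :
    ℕ → List (CoreElt S A d) → Prog S A d (Option (Pol d))
  | 0, _ => ret none
  | N + 1, C =>
      (iterations prm γ C prm.K none none).bind fun
        | .inl z => mainLoop prm γ N (C ++ [z])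
        | .inr pol => ret (some pol)

/-- The completion of the core set at the initial state `ρ`, with at most `N` checks; `none` says
that they did not suffice. -/
def initCore (prm : Params) (ρ : S) :
    ℕ → List (CoreElt S A d) → Prog S A d (Option (List (CoreElt S A d)))
  | 0, _ => ret none
  | N + 1, C =>
      (uncertaintyCheck prm ρ C).bind fun
        | some z => initCore prm ρ N (C ++ [z])
        | none => ret (some C)

/-- Confident Monte-Carlo least-squares policy iteration with the above uncertainty check, from the
initial state `ρ` with default action `a₀`. Its two unbounded loops are cut off after `N` passes,
in which case the result is `none`. -/
def confidentMCLSPI (prm : Params) (γ : ℝ) (ρ : S) (a₀ : A) (N : ℕ) :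
    Prog S A d (Option (Pol d)) :=
  (readFeat ρ a₀).bind fun f =>
  (initCore prm ρ N [⟨ρ, a₀, f⟩]).bind fun
    | none => ret none
    | some C => mainLoop prm γ N C

/-- The policy which a value of type `Pol` stands for. -/
def Pol.toPolicy [MeasurableSpace S] [MeasurableSpace A] {φ : S × A → Fin d → ℝ}
    (G : GreedyOracle φ) (π₀ : Policy S A) : Pol d → Policy S A
  | none => π₀
  | some wt => ⟨Kernel.deterministic (G.act wt) (G.measurable_act wt), inferInstance⟩

/-- The result of a run is a policy which is `g`-optimal at `ρ`. -/
def IsOptimalUpTo [MeasurableSpace S] [MeasurableSpace A] (M : MDP S A) {φ : S × A → Fin d → ℝ}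
    (G : GreedyOracle φ) (π₀ : Policy S A) (ρ : S) (g : ℝ) (out : Option (Pol d)) : Prop :=
  ∃ pol, out = some pol ∧ Vstar M ρ - V M (pol.toPolicy G π₀) ρ ≤ g

end Algorithm

/-! ### Parameter settings -/

/-- The bound `C_max` on the size of the core set. -/
def cMax (d : ℕ) (τ lam : ℝ) : ℝ :=
  Real.exp 1 / (Real.exp 1 - 1) * ((1 + τ) / τ) * d *
    (Real.log (1 + 1 / τ) + Real.log (1 + 1 / lam))

/-- The regularization coefficient. -/
def lamOf (d : ℕ) (b γ κ : ℝ) : ℝ := κ ^ 2 * (1 - γ) ^ 4 / (1024 * b ^ 2 * d)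

/-- The value of `C_max` for `τ = 1` and the above regularization coefficient. -/
def cMaxOf (d : ℕ) (b γ κ : ℝ) : ℝ := cMax d 1 (lamOf d b γ κ)

/-- The statistical accuracy of the rollouts. -/
def thetaOf (d : ℕ) (b γ κ : ℝ) : ℝ :=
  κ * (1 - γ) ^ 2 / (32 * Real.sqrt d * Real.sqrt (cMaxOf d b γ κ))

/-- The length of the rollouts. -/
def HOf (d : ℕ) (b γ κ : ℝ) : ℕ :=
  ⌈(Real.log (32 * Real.sqrt (cMaxOf d b γ κ) * Real.sqrt d)
      - Real.log (κ * (1 - γ) ^ 3)) / (1 - γ) - 1⌉₊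

/-- The number of policy iterations. -/
def KOf (γ κ : ℝ) : ℕ :=
  max 1 ⌈(Real.log (1 / (κ * (1 - γ) ^ 2)) + Real.log 8) / (1 - γ) + 1⌉₊

/-- The number of rollouts. -/
def nOf (d : ℕ) (b γ κ δ : ℝ) : ℕ :=
  ⌈(Real.log (4 * KOf γ κ * cMaxOf d b γ κ ^ 2) - Real.log δ) /
      (2 * thetaOf d b γ κ ^ 2 * (1 - γ) ^ 2)⌉₊

/-- The inputs of the algorithm, for accuracy `κ` and failure probability `δ`. -/
def paramsOf (d : ℕ) (b γ κ δ : ℝ) : Params where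
  K := KOf γ κ
  n := nOf d b γ κ δ
  H := HOf d b γ κ
  τ := 1
  lam := lamOf d b γ κ

/-- The accuracy used for features with misspecification `ε`. -/
def kappaOf (d : ℕ) (b γ ε : ℝ) : ℝ :=
  32 * ε * d / (1 - γ) ^ 2 * Real.sqrt (1 + Real.log (1 + b ^ 2 / (ε ^ 2 * d)))

/-- The logarithmic factor in the query bounds. -/
def logFactor (d : ℕ) (b γ x δ : ℝ) : ℝ :=
  1 + Real.log d + Real.log (1 / (1 - γ)) + Real.log (1 + 1 / x) + Real.log (1 / δ)
    + Real.log (1 + b)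

/-- The sum whose powers bound the computational cost. -/
def sizeFactor (d : ℕ) (b γ x δ : ℝ) : ℝ :=
  1 + d + 1 / (1 - γ) + 1 / x + Real.log (1 / δ) + Real.log (1 + b)

end

end LSPI

open LSPI

namespace LSPI

noncomputable section

section

namespace Prog

variable {S : Type u} {A : Type v} {d : ℕ} {α : Type w} {β : Type w'}
variable [MeasurableSpace S] [MeasurableSpace A]
variable (M : MDP S A) (φ : S × A → Fin d → ℝ) (G : GreedyOracle φ) (π₀ : Policy S A)

/-! ### Expectations of programs -/

/-! The core set stays small because an uncertain pair has squared norm above 1 in the inverse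
regularized Gram matrix, so adding it more than doubles the determinant (`det_gram_append`). The
trace, hence the determinant, grows only polynomially with the number of unit-bounded rows, so
comparing the two gives at most `cMax` elements (`length_le_cMax`). Every restart adds an element,
so both loops end, and multiplying the costs of the nested loops gives the query and step bounds.
These sure statements are carried by `Within`, which records budgets, known states and
postconditions at once.

If a state passes the check, all its features have squared norm at most `d`: the Gram inverse is `L
Lᵀ`, the norm is a sum of `d` squares, and the greedy oracle bounds each square over all actions
(`invNormSq_le_of_egssResult_eq_none`). At such states regularized least squares predicts well when
the core estimates are accurate (`leastSquares_error`, `abs_prediction_sub_Q_le`).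

Nothing is known about the predictions at uncertain states, so the error analysis is not made for
the computed policies but for virtual ones. A virtual policy agrees with the computed policy on a
measurable set `U` of certain states. Elsewhere it is greedy for weights that realize, up to `ε`,
the action values of the preceding virtual policy; these exist by hypothesis and are never computed.
It is thus greedy for a function uniformly `η`-close to the preceding action values, and classical
approximate policy iteration applies (`policy_improvement`, `exists_isStage_succ`). A rollout that
is never stopped meets only certain states before each further action, so its return is distributed
as if the virtual policy had been used. Instead of a coupling, `one_le_expect_rolloutSteps` states
that the expectation of a good or stopped outcome plus the expectations of two measurable failure
majorants is at least 1, and Hoeffding's lemma bounds the majorants. This form also needs no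
measurability of the program itself.

The output is the computed policy, not its virtual companion. Therefore each evaluation is shown
accurate for both policies simultaneously. In the last iteration one weight vector predicts both
action-value functions at `ρ`, and the two policies draw the same actions there, so their values at
`ρ` differ by at most `2η` (`Vstar_sub_V_le`).

A union bound over restarts, iterations, core elements, two tails and two policies gives failure
probability at most `δ`. With the unit `u = κ(1-γ)²/32`, statistical error, truncation and
regularization each contribute at most `u` after the regression, and misspecification `2u`; this
permits `η = 6u` and a total loss below `κ`. -/

theorem expect_bind (p : Prog S A d α) (f : α → Prog S A d β) (g : β → ℝ≥0∞) :
    (p.bind f).expect M φ G π₀ g = p.expect M φ G π₀ fun x => (f x).expect M φ G π₀ g := by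
  induction p with
  | ret x => rfl
  | query s a k ih => simp only [bind, expect, ih]
  | greedy wt s k ih => simp only [bind, expect, ih]
  | coord s a i k ih => simp only [bind, expect, ih]
  | initAct s k ih => simp only [bind, expect, ih]
  | arith o x y k ih => simp only [bind, expect, ih]
  | less x y k ih => simp only [bind, expect, ih]

theorem expect_const (p : Prog S A d α) (c : ℝ≥0∞) : p.expect M φ G π₀ (fun _ => c) = c := by
  have := M.markov
  have := π₀.markov
  induction p with
  | ret x => rfl
  | query s a k ih => simp [expect, ih]
  | greedy wt s k ih => simp only [expect, ih]
  | coord s a i k ih => simp only [expect, ih]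
  | initAct s k ih => simp [expect, ih]
  | arith o x y k ih => simp only [expect, ih]
  | less x y k ih => simp only [expect, ih, ite_self]

/-- Finiteness of `c` replaces measurability of the integrands, which is not available for
continuations of programs. -/
theorem expect_const_mul (p : Prog S A d α) (c : ℝ≥0∞) (hc : c ≠ ∞) (f : α → ℝ≥0∞) :
    p.expect M φ G π₀ (fun x => c * f x) = c * p.expect M φ G π₀ f := by
  induction p with
  | ret x => rfl
  | query s a k ih => simp only [expect, ih]; exact lintegral_const_mul' _ _ hc
  | greedy wt s k ih => simp only [expect, ih]
  | coord s a i k ih => simp only [expect, ih]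
  | initAct s k ih => simp only [expect, ih]; exact lintegral_const_mul' _ _ hc
  | arith o x y k ih => simp only [expect, ih]
  | less x y k ih => simp only [expect, ih]; split_ifs <;> rfl

/-! ### Runs within a budget -/

/-- `Within M φ G R p X q t`: in every run of `p`, started when the states in `X` are known, the
simulator is queried at known states only, at most `q` queries and at most `t` elementary steps are
made, and the set `X'` of states known at the end and the result `x` satisfy `R X' x`. -/
inductive Within (R : Set S → α → Prop) : Prog S A d α → Set S → ℕ → ℕ → Prop
  | ret {x X q t} : R X x → Within R (ret x) X q t
  | query {s a k X q t} : s ∈ X → (∀ s', Within R (k s' (M.r (s, a))) (insert s' X) q t) →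
      Within R (query s a k) X (q + 1) (t + 1)
  | greedy {wt s k X q t} : Within R (k (G.act wt s)) X q t → Within R (greedy wt s k) X q (t + 1)
  | coord {s a i k X q t} : Within R (k (φ (s, a) i)) X q t → Within R (coord s a i k) X q (t + 1)
  | initAct {s k X q t} : (∀ a, Within R (k a) X q t) → Within R (initAct s k) X q (t + 1)
  | arith {o x y k X q t} : Within R (k (Op.eval o x y)) X q t →
      Within R (arith o x y k) X q (t + 1)
  | less {x y k X q t} : (x < y → Within R (k true) X q t) →
      (¬ x < y → Within R (k false) X q t) → Within R (less x y k) X q (t + 1)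

variable {M φ G}

namespace Within

variable {R : Set S → α → Prop} {R' : Set S → β → Prop} {p : Prog S A d α} {X : Set S}
  {q t q' t' : ℕ}

/-- Known states only accumulate along a run, so the new postcondition may rely on `X ⊆ X'`. -/
theorem weaken (h : Within M φ G R p X q t) {R₁ : Set S → α → Prop} (hq : q ≤ q') (ht : t ≤ t')
    (hR : ∀ X' x, X ⊆ X' → R X' x → R₁ X' x) : Within M φ G R₁ p X q' t' := by
  induction h generalizing q' t' with
  | ret h => exact .ret (hR _ _ subset_rfl h)
  | query hs _ ih =>
    obtain ⟨q', rfl⟩ := Nat.exists_eq_add_of_lt (Nat.lt_of_lt_of_le (Nat.succ_pos _) hq)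
    obtain ⟨t', rfl⟩ := Nat.exists_eq_add_of_lt (Nat.lt_of_lt_of_le (Nat.succ_pos _) ht)
    exact .query hs fun s' => ih s' (by omega) (by omega)
      fun X' x hX => hR X' x ((Set.subset_insert _ _).trans hX)
  | greedy _ ih =>
    obtain ⟨t', rfl⟩ := Nat.exists_eq_add_of_lt (Nat.lt_of_lt_of_le (Nat.succ_pos _) ht)
    exact .greedy (ih hq (by omega) hR)
  | coord _ ih =>
    obtain ⟨t', rfl⟩ := Nat.exists_eq_add_of_lt (Nat.lt_of_lt_of_le (Nat.succ_pos _) ht)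
    exact .coord (ih hq (by omega) hR)
  | initAct _ ih =>
    obtain ⟨t', rfl⟩ := Nat.exists_eq_add_of_lt (Nat.lt_of_lt_of_le (Nat.succ_pos _) ht)
    exact .initAct fun a => ih a hq (by omega) hR
  | arith _ ih =>
    obtain ⟨t', rfl⟩ := Nat.exists_eq_add_of_lt (Nat.lt_of_lt_of_le (Nat.succ_pos _) ht)
    exact .arith (ih hq (by omega) hR)
  | less _ _ ih ih' =>
    obtain ⟨t', rfl⟩ := Nat.exists_eq_add_of_lt (Nat.lt_of_lt_of_le (Nat.succ_pos _) ht)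
    exact .less (fun h => ih h hq (by omega) hR) (fun h => ih' h hq (by omega) hR)

theorem le (h : Within M φ G R p X q t) (hq : q ≤ q') (ht : t ≤ t') :
    Within M φ G R p X q' t' :=
  h.weaken hq ht fun _ _ _ => id

theorem bind (h : Within M φ G R p X q t) {f : α → Prog S A d β}
    (hf : ∀ X' x, X ⊆ X' → R X' x → Within M φ G R' (f x) X' q' t') :
    Within M φ G R' (p.bind f) X (q + q') (t + t') := by
  induction h with
  | ret h => exact (hf _ _ subset_rfl h).le (by omega) (by omega)
  | @query s a k X q t hs _ ih =>
    rw [Nat.add_right_comm, Nat.add_right_comm t]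
    exact .query hs fun s' => ih s' fun X' x hX => hf X' x ((Set.subset_insert _ _).trans hX)
  | @greedy _ _ _ _ _ t _ ih =>
    rw [Nat.add_right_comm t]
    exact .greedy (ih hf)
  | @coord _ _ _ _ _ _ t _ ih =>
    rw [Nat.add_right_comm t]
    exact .coord (ih hf)
  | @initAct _ _ _ _ t _ ih =>
    rw [Nat.add_right_comm t]
    exact .initAct fun a => ih a hf
  | @arith _ _ _ _ _ _ t _ ih =>
    rw [Nat.add_right_comm t]
    exact .arith (ih hf)
  | @less _ _ _ _ _ t _ _ ih ih' =>
    rw [Nat.add_right_comm t]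
    exact .less (fun h => ih h hf) (fun h => ih' h hf)

theorem _root_.LSPI.Prog.Sure.mono {E E' : ℕ → ℕ → α → Prop} (h : p.Sure M φ G E)
    (hE : ∀ q t x, E q t x → E' q t x) : p.Sure M φ G E' := by
  induction p generalizing E E' with
  | ret x => exact hE _ _ _ h
  | query s a k ih => exact fun s' => ih _ _ (h s') fun q t x => hE _ _ x
  | greedy wt s k ih => exact ih _ h fun q t x => hE _ _ x
  | coord s a i k ih => exact ih _ h fun q t x => hE _ _ x
  | initAct s k ih => exact fun a => ih _ (h a) fun q t x => hE _ _ x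
  | arith o x y k ih => exact ih _ h fun q t x => hE _ _ x
  | less x y k ih =>
    exact ⟨fun hxy => ih _ (h.1 hxy) fun q t x => hE _ _ x,
      fun hxy => ih _ (h.2 hxy) fun q t x => hE _ _ x⟩

theorem sure (h : Within M φ G R p X q t) :
    p.Sure M φ G fun q' t' x => q' ≤ q ∧ t' ≤ t ∧ ∃ X', R X' x := by
  induction h with
  | ret h => exact ⟨Nat.zero_le _, Nat.zero_le _, _, h⟩
  | query hs _ ih => exact fun s' => (ih s').mono fun q t x h => ⟨by omega, by omega, h.2.2⟩
  | greedy _ ih => simp only [Sure]; exact ih.mono fun q t x h => ⟨by omega, by omega, h.2.2⟩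
  | coord _ ih => simp only [Sure]; exact ih.mono fun q t x h => ⟨by omega, by omega, h.2.2⟩
  | initAct _ ih => exact fun a => (ih a).mono fun q t x h => ⟨by omega, by omega, h.2.2⟩
  | arith _ ih => simp only [Sure]; exact ih.mono fun q t x h => ⟨by omega, by omega, h.2.2⟩
  | less _ _ ih ih' =>
    exact ⟨fun h => (ih h).mono fun q t x h => ⟨by omega, by omega, h.2.2⟩,
      fun h => (ih' h).mono fun q t x h => ⟨by omega, by omega, h.2.2⟩⟩

theorem localAccess (h : Within M φ G R p X q t) : p.LocalAccess M φ G X := by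
  induction h with
  | ret h => trivial
  | query hs _ ih => exact ⟨hs, ih⟩
  | greedy _ ih => exact ih
  | coord _ ih => exact ih
  | initAct _ ih => exact ih
  | arith _ ih => exact ih
  | less _ _ ih ih' => exact ⟨ih, ih'⟩

/-- This is where sure invariants enter probability bounds: the comparison is needed only at results
that a run can produce, and monotonicity of the integral asks for no measurability. -/
theorem expect_mono (h : Within M φ G R p X q t) {f g : α → ℝ≥0∞}
    (hfg : ∀ X' x, R X' x → f x ≤ g x) : p.expect M φ G π₀ f ≤ p.expect M φ G π₀ g := by
  induction h with
  | ret h => exact hfg _ _ h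
  | query hs _ ih => exact lintegral_mono fun s' => ih s'
  | greedy _ ih => exact ih
  | coord _ ih => exact ih
  | initAct _ ih => exact lintegral_mono fun a => ih a
  | arith _ ih => exact ih
  | less _ _ ih ih' =>
    simp only [expect]
    split_ifs with h
    exacts [ih h, ih' h]

end Within

/-! ### Programs whose result does not depend on chance -/

variable (M φ G)

/-- `p` makes no queries and at most `t` elementary steps, and its result is `v`. -/
def Computes (p : Prog S A d α) (t : ℕ) (v : α) : Prop :=
  ∀ X : Set S, Within M φ G (fun X' x => X' = X ∧ x = v) p X 0 t

variable {M φ G}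

theorem Within.computes_bind {p : Prog S A d α} {t t' q : ℕ} {v : α} (h : Computes M φ G p t v)
    {f : α → Prog S A d β} {R : Set S → β → Prop} {X : Set S}
    (hf : Within M φ G R (f v) X q t') : Within M φ G R (p.bind f) X q (t + t') := by
  have := (h X).bind (f := f) (R' := R) (q' := q) (t' := t') (by rintro _ _ _ ⟨rfl, rfl⟩; exact hf)
  rwa [Nat.zero_add] at this

namespace Computes

variable {p : Prog S A d α} {t t' : ℕ} {v : α}

theorem bind (h : Computes M φ G p t v) {f : α → Prog S A d β} {y : β}
    (hf : Computes M φ G (f v) t' y) : Computes M φ G (p.bind f) (t + t') y :=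
  fun X => .computes_bind h (hf X)

theorem le (h : Computes M φ G p t v) (ht : t ≤ t') : Computes M φ G p t' v :=
  fun X => (h X).le le_rfl ht

/-- The continuation is constant along all runs, and a constant has itself as expectation; the
postcondition gives both inequalities. -/
theorem expect_bind (h : Computes M φ G p t v) (f : α → Prog S A d β) (g : β → ℝ≥0∞) :
    (p.bind f).expect M φ G π₀ g = (f v).expect M φ G π₀ g := by
  rw [Prog.expect_bind, ← expect_const M φ G π₀ p ((f v).expect M φ G π₀ g)]
  apply le_antisymm <;> exact (h ∅).expect_mono π₀ (by rintro _ _ ⟨-, rfl⟩; exact le_rfl)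

theorem of_eq (h : Computes M φ G p t v) {v' : α} (hv : v = v') : Computes M φ G p t v' := hv ▸ h

theorem ret (x : α) : Computes M φ G (ret x) 0 x := fun _ => .ret ⟨rfl, rfl⟩

theorem op (o : Op) (x y : ℝ) : Computes M φ G (op o x y) 1 (o.eval x y) :=
  fun _ => .arith (.ret ⟨rfl, rfl⟩)

theorem greedy {wt : Fin d → ℝ} {s : S} {k : A → Prog S A d α}
    (h : Computes M φ G (k (G.act wt s)) t v) : Computes M φ G (greedy wt s k) (t + 1) v :=
  fun X => .greedy (h X)

theorem tabulate {n : ℕ} {f : Fin n → Prog S A d α} {v : Fin n → α}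
    (h : ∀ i, Computes M φ G (f i) t (v i)) : Computes M φ G (tabulate n f) (n * t) v := by
  induction n with
  | zero => exact fun _ => .ret ⟨rfl, Subsingleton.elim _ _⟩
  | succ n ih =>
    have hv : (Fin.cons (v 0) fun i => v i.succ : Fin (n + 1) → α) = v := Fin.cons_self_tail v
    have h' := (ih fun i => h i.succ).bind
      (f := fun xs => Prog.ret (Fin.cons (v 0) xs : Fin (n + 1) → α)) (ret _)
    rw [hv] at h'
    exact ((h 0).bind (f := fun x => (Prog.tabulate n fun i => f i.succ).bind fun xs =>
      Prog.ret (Fin.cons x xs : Fin (n + 1) → α)) h').le (le_of_eq (by ring))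

theorem sum {n : ℕ} {f : Fin n → Prog S A d ℝ} {v : Fin n → ℝ}
    (h : ∀ i, Computes M φ G (f i) t (v i)) :
    Computes M φ G (sum n f) (n * (t + 1)) (∑ i, v i) := by
  induction n with
  | zero => exact fun _ => .ret ⟨rfl, by simp⟩
  | succ n ih =>
    rw [Fin.sum_univ_succ]
    exact ((h 0).bind (f := fun x => (Prog.sum n fun i => f i.succ).bind fun y =>
      Prog.op .add x y) ((ih fun i => h i.succ).bind (op .add _ _))).le (le_of_eq (by ring))

end Computes

end Prog

end

section

/-! ### Regularized Gram matrices -/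

section Gram

open Matrix

variable {d : ℕ}

theorem norm_toLp_sq (x : Fin d → ℝ) : ‖WithLp.toLp 2 x‖ ^ 2 = x ⬝ᵥ x := by
  rw [EuclideanSpace.real_norm_sq_eq]
  simp [dotProduct, sq]

theorem dotProduct_self_nonneg' (x : Fin d → ℝ) : 0 ≤ x ⬝ᵥ x :=
  Finset.sum_nonneg fun _ _ => mul_self_nonneg _

/-- `Φᵀ Φ + lam I`, where the rows of `Φ` are the vectors in the list. -/
def gram (lam : ℝ) : List (Fin d → ℝ) → Matrix (Fin d) (Fin d) ℝ
  | [] => lam • 1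
  | x :: xs => gram lam xs + vecMulVec x x

theorem gram_append_singleton (lam : ℝ) (l : List (Fin d → ℝ)) (x : Fin d → ℝ) :
    gram lam (l ++ [x]) = gram lam l + vecMulVec x x := by
  induction l with
  | nil => rfl
  | cons y l ih => simp only [List.cons_append, gram, ih]; abel

theorem gram_mulVec (lam : ℝ) (l : List (Fin d → ℝ)) (v : Fin d → ℝ) :
    gram lam l *ᵥ v = lam • v + (l.map fun x => (x ⬝ᵥ v) • x).sum := by
  induction l with
  | nil => simp [gram, smul_mulVec]
  | cons y l ih =>
    simp [gram, add_mulVec, ih, vecMulVec_mulVec]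
    abel

theorem dotProduct_gram_mulVec (lam : ℝ) (l : List (Fin d → ℝ)) (v : Fin d → ℝ) :
    v ⬝ᵥ (gram lam l *ᵥ v) = lam * (v ⬝ᵥ v) + (l.map fun x => (x ⬝ᵥ v) ^ 2).sum := by
  induction l with
  | nil => simp [gram, smul_mulVec]
  | cons y l ih =>
    simp [gram, add_mulVec, ih, vecMulVec_mulVec, dotProduct_add, dotProduct_comm v y]
    ring

theorem gram_isHermitian (lam : ℝ) (l : List (Fin d → ℝ)) : (gram lam l).IsHermitian := by
  induction l with
  | nil => simp [gram, Matrix.IsHermitian]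
  | cons y l ih =>
    refine ih.add ?_
    simp [Matrix.IsHermitian]

theorem gram_posDef {lam : ℝ} (hlam : 0 < lam) (l : List (Fin d → ℝ)) : (gram lam l).PosDef := by
  refine Matrix.PosDef.of_dotProduct_mulVec_pos (gram_isHermitian lam l) fun x hx => ?_
  rw [star_trivial, dotProduct_gram_mulVec]
  have h1 : 0 < x ⬝ᵥ x := lt_of_le_of_ne (dotProduct_self_nonneg' x)
    fun h => hx (dotProduct_self_eq_zero.1 h.symm)
  have h2 : 0 ≤ (l.map fun y => (y ⬝ᵥ x) ^ 2).sum :=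
    List.sum_nonneg (by simp only [List.mem_map]; rintro _ ⟨y, -, rfl⟩; positivity)
  positivity

/-- The quadratic form of the inverse of the regularized Gram matrix. -/
def invNormSq (lam : ℝ) (l : List (Fin d → ℝ)) (x : Fin d → ℝ) : ℝ :=
  x ⬝ᵥ ((gram lam l)⁻¹ *ᵥ x)

theorem gram_mul_inv {lam : ℝ} (hlam : 0 < lam) (l : List (Fin d → ℝ)) :
    gram lam l * (gram lam l)⁻¹ = 1 :=
  Matrix.mul_nonsing_inv _ ((Matrix.isUnit_iff_isUnit_det _).1 (gram_posDef hlam l).isUnit)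

theorem gram_inv_mul {lam : ℝ} (hlam : 0 < lam) (l : List (Fin d → ℝ)) :
    (gram lam l)⁻¹ * gram lam l = 1 :=
  Matrix.nonsing_inv_mul _ ((Matrix.isUnit_iff_isUnit_det _).1 (gram_posDef hlam l).isUnit)

theorem gram_inv_transpose {lam : ℝ} (hlam : 0 < lam) (l : List (Fin d → ℝ)) :
    ((gram lam l)⁻¹)ᵀ = (gram lam l)⁻¹ := by
  rw [← conjTranspose_eq_transpose_of_trivial]
  exact (gram_posDef hlam l).inv.isHermitian

theorem gram_inv_symm {lam : ℝ} (hlam : 0 < lam) (l : List (Fin d → ℝ)) (x y : Fin d → ℝ) :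
    x ⬝ᵥ ((gram lam l)⁻¹ *ᵥ y) = y ⬝ᵥ ((gram lam l)⁻¹ *ᵥ x) := by
  rw [dotProduct_mulVec, ← mulVec_transpose, gram_inv_transpose hlam, dotProduct_comm]

theorem invNormSq_nonneg {lam : ℝ} (hlam : 0 < lam) (l : List (Fin d → ℝ)) (x : Fin d → ℝ) :
    0 ≤ invNormSq lam l x := by
  exact (gram_posDef hlam l).inv.posSemidef.dotProduct_mulVec_nonneg x

/-- The Sherman-Morrison formula. -/
theorem inv_add_vecMulVec {lam : ℝ} (hlam : 0 < lam) (l : List (Fin d → ℝ)) (x : Fin d → ℝ) :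
    (gram lam l + vecMulVec x x)⁻¹ = (gram lam l)⁻¹ - (1 + invNormSq lam l x)⁻¹ •
      vecMulVec ((gram lam l)⁻¹ *ᵥ x) ((gram lam l)⁻¹ *ᵥ x) := by
  have h1 : 1 + invNormSq lam l x ≠ 0 := by
    have := invNormSq_nonneg hlam l x
    positivity
  have hs : x ᵥ* (gram lam l)⁻¹ = (gram lam l)⁻¹ *ᵥ x := by
    rw [← mulVec_transpose, gram_inv_transpose hlam]
  refine Matrix.inv_eq_right_inv ?_
  rw [add_mul, mul_sub, mul_sub, gram_mul_inv hlam, Matrix.mul_smul, Matrix.mul_smul,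
    mul_vecMulVec,
    mulVec_mulVec, gram_mul_inv hlam, one_mulVec, vecMulVec_mul, hs, vecMulVec_mul_vecMulVec]
  change _ + (_ - _ • vecMulVec x (invNormSq lam l x • _)) = _
  rw [vecMulVec_smul, smul_smul]
  have : (1 + invNormSq lam l x)⁻¹ * invNormSq lam l x = 1 - (1 + invNormSq lam l x)⁻¹ := by
    field_simp
    ring
  rw [this, sub_smul, one_smul]
  abel

/-- By Sherman-Morrison a nonnegative square is subtracted. Hence a norm bound established for one
core set survives its enlargement. -/
theorem invNormSq_append_le {lam : ℝ} (hlam : 0 < lam) (l : List (Fin d → ℝ)) (x y : Fin d → ℝ) :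
    invNormSq lam (l ++ [x]) y ≤ invNormSq lam l y := by
  have h1 := invNormSq_nonneg hlam l x
  have : 0 ≤ (1 + invNormSq lam l x)⁻¹ * (y ⬝ᵥ ((gram lam l)⁻¹ *ᵥ x)) ^ 2 := by positivity
  rw [invNormSq, invNormSq, gram_append_singleton, inv_add_vecMulVec hlam, sub_mulVec,
    dotProduct_sub, smul_mulVec, vecMulVec_mulVec, dotProduct_smul]
  simp only [op_smul_eq_smul, dotProduct_smul, smul_eq_mul, dotProduct_comm _ y]
  nlinarith

/-- The matrix determinant lemma. A row of squared norm above 1 more than doubles the determinant.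
-/
theorem det_gram_append {lam : ℝ} (hlam : 0 < lam) (l : List (Fin d → ℝ)) (x : Fin d → ℝ) :
    (gram lam (l ++ [x])).det = (gram lam l).det * (1 + invNormSq lam l x) := by
  rw [gram_append_singleton, vecMulVec_eq Unit,
    Matrix.det_add_replicateCol_mul_replicateRow
      ((Matrix.isUnit_iff_isUnit_det _).1 (gram_posDef hlam l).isUnit)]
  congr 2
  rw [invNormSq, dotProduct_mulVec]
  simp [det_unique, mul_apply, replicateRow, replicateCol, dotProduct, vecMul]

theorem trace_gram_le {lam : ℝ} (l : List (Fin d → ℝ)) (hl : ∀ x ∈ l, x ⬝ᵥ x ≤ 1) :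
    (gram lam l).trace ≤ d * lam + l.length := by
  induction l with
  | nil => simp [gram, mul_comm]
  | cons y l ih =>
    have h1 := ih fun x hx => hl x (List.mem_cons_of_mem _ hx)
    have h2 := hl y List.mem_cons_self
    rw [gram, trace_add, trace_vecMulVec, List.length_cons]
    push_cast
    linarith

/-- The arithmetic-geometric mean inequality for the determinant. -/
theorem log_det_le {B : Matrix (Fin d) (Fin d) ℝ} (hB : B.PosDef) (a : ℝ) (ha : 0 < a)
    (h : B.trace ≤ d * a) : Real.log B.det ≤ d * Real.log a := by
  have hdet := hB.isHermitian.det_eq_prod_eigenvalues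
  have htr := hB.isHermitian.trace_eq_sum_eigenvalues
  simp only [RCLike.ofReal_real_eq_id, id] at hdet htr
  have hpos := hB.eigenvalues_pos
  rw [hdet, Real.log_prod fun i _ => (hpos i).ne']
  calc ∑ i, Real.log (hB.isHermitian.eigenvalues i)
      ≤ ∑ i, (Real.log a + (hB.isHermitian.eigenvalues i / a - 1)) := by
        refine Finset.sum_le_sum fun i _ => ?_
        have := Real.log_le_sub_one_of_pos (div_pos (hpos i) ha)
        rw [Real.log_div (hpos i).ne' ha.ne'] at this
        linarith
    _ = d * Real.log a + (B.trace / a - d) := by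
        rw [Finset.sum_add_distrib, Finset.sum_sub_distrib, htr, Finset.sum_div]
        simp
    _ ≤ _ := by
        have : B.trace / a ≤ d := (div_le_iff₀ ha).2 h
        linarith

/-- With `x = n / d` the hypothesis becomes `x log 2 ≤ log x + B`, because `1 + x/lam ≤ x(1 +
1/lam)` for `x > 1`, and `d ≥ 1` absorbs the lost `log 2`. Replacing `log x` by `x/e` makes it
linear: `x (0.693 - 0.368) ≤ B`. -/
theorem le_cMax_of_mul_log_le {lam : ℝ} (hlam : 0 < lam) (hd : 0 < d) {n : ℝ} (hn : 0 ≤ n)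
    (h : (n - 1) * Real.log 2 ≤ d * Real.log (1 + n / (d * lam))) : n ≤ cMax d 1 lam := by
  have hd' : (1 : ℝ) ≤ d := by exact_mod_cast hd
  have hd0 : (0 : ℝ) < d := by linarith
  have l2 := Real.log_two_gt_d9
  have l2' := Real.log_two_lt_d9
  have he := Real.exp_one_gt_d9
  set x := n / d with hx
  set B := Real.log 2 + Real.log (1 + 1 / lam) with hB
  have hlog : 0 ≤ Real.log (1 + 1 / lam) := Real.log_nonneg (by simp [hlam.le])
  have hx0 : 0 ≤ x := by positivity
  have hnx : n = d * x := by rw [hx]; field_simp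
  have key : x ≤ 3.16 * B := by
    rcases le_or_gt x 1 with hx1 | hx1
    · nlinarith
    have e1 : Real.log (1 + n / (d * lam)) ≤ Real.log x + Real.log (1 + 1 / lam) := by
      rw [← Real.log_mul (by positivity) (by positivity)]
      refine Real.log_le_log (by positivity) ?_
      rw [hnx, mul_div_mul_left _ _ hd0.ne', mul_add, mul_one, mul_one_div]
      linarith
    -- The inequality `log y ≤ y - 1` at `y = x/e` gives `log x ≤ x/e`.
    have e2 : Real.log x ≤ 0.368 * x := by
      have := Real.log_le_sub_one_of_pos (div_pos (by linarith : 0 < x) (Real.exp_pos 1))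
      rw [Real.log_div (by linarith) (Real.exp_pos 1).ne', Real.log_exp] at this
      have h3 : x / Real.exp 1 ≤ 0.368 * x := by
        rw [div_le_iff₀ (Real.exp_pos 1)]
        nlinarith
      linarith
    have e3 : x * Real.log 2 ≤ Real.log x + B := by
      have : d * (x * Real.log 2) ≤ d * (Real.log x + B) := by
        have : (d : ℝ) * Real.log (1 + n / (d * lam)) ≤ d * (Real.log x + Real.log (1 + 1 / lam)) :=
          mul_le_mul_of_nonneg_left e1 hd0.le
        rw [hnx] at h
        rw [hnx] at this
        rw [hB]
        nlinarith
      exact le_of_mul_le_mul_left this hd0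
    nlinarith
  -- The constant `2e/(e-1)` is about 3.1639, which leaves just enough room for the factor 3.16 of
  -- `key`.
  have hc : 3.16 ≤ Real.exp 1 / (Real.exp 1 - 1) * 2 := by
    have := Real.exp_one_lt_d9
    rw [div_mul_eq_mul_div, le_div_iff₀ (by linarith)]
    linarith
  have hB0 : 0 ≤ B := by positivity
  rw [cMax, hnx]
  have : d * x ≤ d * (Real.exp 1 / (Real.exp 1 - 1) * 2 * B) := by
    refine mul_le_mul_of_nonneg_left (key.trans ?_) hd0.le
    exact mul_le_mul_of_nonneg_right hc hB0
  calc d * x ≤ _ := this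
    _ = _ := by rw [hB]; norm_num; ring

/-- The elliptical potential argument: each vector which at least doubles the determinant counts,
and the number of vectors is bounded. -/
theorem length_le_cMax {lam : ℝ} (hlam : 0 < lam) (hd : 0 < d) (l : List (Fin d → ℝ))
    (hl : ∀ x ∈ l, x ⬝ᵥ x ≤ 1) (h : lam ^ d * 2 ^ (l.length - 1) ≤ (gram lam l).det) :
    (l.length : ℝ) ≤ cMax d 1 lam := by
  have hd0 : (0 : ℝ) < d := by exact_mod_cast hd
  refine le_cMax_of_mul_log_le hlam hd (Nat.cast_nonneg _) ?_
  -- The tangent point is the bound on the mean eigenvalue that the trace provides.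
  have h1 := log_det_le (gram_posDef hlam l) (lam + l.length / d) (by positivity)
    ((trace_gram_le l hl).trans (le_of_eq (by field_simp)))
  have h2 := Real.log_le_log (by positivity) h
  rw [Real.log_mul (by positivity) (by positivity), Real.log_pow, Real.log_pow] at h2
  have h3 : Real.log (lam + l.length / d) = Real.log lam + Real.log (1 + l.length / (d * lam)) := by
    rw [← Real.log_mul (by positivity) (by positivity)]
    congr 1
    field_simp
  rw [h3] at h1
  have h4 : (l.length : ℝ) - 1 ≤ (l.length - 1 : ℕ) := by
    have : l.length ≤ (l.length - 1) + 1 := by omega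
    have : (l.length : ℝ) ≤ (l.length - 1 : ℕ) + 1 := by exact_mod_cast this
    linarith
  nlinarith [Real.log_pos (one_lt_two)]

/-! ### Regularized least squares -/

/-- Cauchy-Schwarz for the inverse Gram form: the quadratic polynomial `t ↦ ‖x + t u‖²` is
nonnegative, so its discriminant is not positive. -/
theorem dotProduct_sq_le {lam : ℝ} (hlam : 0 < lam) (l : List (Fin d → ℝ)) (x u : Fin d → ℝ) :
    (x ⬝ᵥ ((gram lam l)⁻¹ *ᵥ u)) ^ 2 ≤ invNormSq lam l x * invNormSq lam l u := by
  have h : ∀ t : ℝ, 0 ≤ invNormSq lam l u * (t * t) +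
      (2 * (x ⬝ᵥ ((gram lam l)⁻¹ *ᵥ u))) * t + invNormSq lam l x := fun t => by
    have := invNormSq_nonneg hlam l (x + t • u)
    simp only [invNormSq, mulVec_add, mulVec_smul, add_dotProduct, dotProduct_add,
      smul_dotProduct, dotProduct_smul, smul_eq_mul, gram_inv_symm hlam l u x] at this ⊢
    nlinarith
  have := discrim_le_zero h
  rw [discrim] at this
  nlinarith

/-- `Φᵀ q`, for a list of pairs of a row of `Φ` and an entry of `q`. -/
def weightedSum : List ((Fin d → ℝ) × ℝ) → Fin d → ℝ
  | [] => 0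
  | (f, q) :: xs => weightedSum xs + q • f

/-- The error of regularized least squares: if the entries of `q` are `e`-close to those of
`Φ wt`, the prediction at `x` of the regularized solution is close to `wt ⬝ᵥ x`. -/
theorem leastSquares_error {lam : ℝ} (hlam : 0 < lam) (l : List ((Fin d → ℝ) × ℝ))
    (wt x : Fin d → ℝ) (e : ℝ) (he : ∀ y ∈ l, |y.2 - wt ⬝ᵥ y.1| ≤ e) :
    ((((gram lam (l.map Prod.fst))⁻¹ *ᵥ weightedSum l) ⬝ᵥ x) - wt ⬝ᵥ x) ^ 2 ≤
      invNormSq lam (l.map Prod.fst) x * (l.length * e ^ 2 + lam * (wt ⬝ᵥ wt)) := by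
  set V := gram lam (l.map Prod.fst) with hV
  set u := weightedSum l - V *ᵥ wt with hu
  set z := V⁻¹ *ᵥ u with hz
  have hVz : V *ᵥ z = u := by rw [hz, mulVec_mulVec, gram_mul_inv hlam, one_mulVec]
  have e1 : (V⁻¹ *ᵥ weightedSum l) ⬝ᵥ x - wt ⬝ᵥ x = x ⬝ᵥ (V⁻¹ *ᵥ u) := by
    rw [hu, mulVec_sub, mulVec_mulVec, gram_inv_mul hlam, one_mulVec, dotProduct_sub,
      dotProduct_comm x, dotProduct_comm x]
  rw [e1]
  refine (dotProduct_sq_le hlam _ x u).trans ?_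
  refine mul_le_mul_of_nonneg_left ?_ (invNormSq_nonneg hlam _ x)
  have e2 : invNormSq lam (l.map Prod.fst) u = z ⬝ᵥ (V *ᵥ z) := by
    rw [hVz, invNormSq, dotProduct_comm]
  -- Here `u = Φᵀ(q - Φ wt) - lam wt`. Applying `2ab ≤ a² + b²` to each residual and to the
  -- regularization term bounds `z ⬝ᵥ u` by half of the quadratic form of `z` plus half of the
  -- claimed bound. Since `z ⬝ᵥ u` is that quadratic form, it is absorbed on the left.
  have e3 : z ⬝ᵥ u ≤ (z ⬝ᵥ (V *ᵥ z)) / 2 + (l.length * e ^ 2 + lam * (wt ⬝ᵥ wt)) / 2 := by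
    have a1 : z ⬝ᵥ u = (l.map fun y => (y.2 - wt ⬝ᵥ y.1) * (y.1 ⬝ᵥ z)).sum
        - lam * (wt ⬝ᵥ z) := by
      rw [hu, hV, gram_mulVec, dotProduct_sub, dotProduct_add, dotProduct_smul, smul_eq_mul,
        dotProduct_comm z wt]
      have : ∀ l : List ((Fin d → ℝ) × ℝ), z ⬝ᵥ weightedSum l -
          z ⬝ᵥ ((l.map Prod.fst).map fun x => (x ⬝ᵥ wt) • x).sum =
          (l.map fun y => (y.2 - wt ⬝ᵥ y.1) * (y.1 ⬝ᵥ z)).sum := by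
        intro l
        induction l with
        | nil => simp [weightedSum]
        | cons y l ih =>
          simp only [weightedSum, List.map_cons, List.sum_cons, ← ih, dotProduct_add,
            dotProduct_smul, smul_eq_mul, dotProduct_comm z y.1, dotProduct_comm wt y.1]
          ring
      rw [← this]
      ring
    have a2 : (l.map fun y => (y.2 - wt ⬝ᵥ y.1) * (y.1 ⬝ᵥ z)).sum ≤
        l.length * e ^ 2 / 2 + ((l.map Prod.fst).map fun x => (x ⬝ᵥ z) ^ 2).sum / 2 := by
      -- The vector `z` was built from `l`; it is made arbitrary so that it stays fixed in the
      -- induction on `l`.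
      clear e2 e1 a1 hVz
      clear_value z
      clear hu hz
      clear_value u
      clear u hV
      clear_value V
      clear V
      induction l with
      | nil => simp
      | cons y l ih =>
        have i1 := ih fun y hy => he y (List.mem_cons_of_mem _ hy)
        have i2 := sq_le_sq' (abs_le.1 (he y List.mem_cons_self)).1
          (abs_le.1 (he y List.mem_cons_self)).2
        simp only [List.map_cons, List.sum_cons, List.length_cons]
        push_cast
        nlinarith [sq_nonneg ((y.2 - wt ⬝ᵥ y.1) - y.1 ⬝ᵥ z)]
    have a3 : - (wt ⬝ᵥ z) ≤ (wt ⬝ᵥ wt + z ⬝ᵥ z) / 2 := by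
      have := dotProduct_self_nonneg' (wt + z)
      simp only [add_dotProduct, dotProduct_add, dotProduct_comm z wt] at this
      linarith
    rw [a1, hV, dotProduct_gram_mulVec]
    nlinarith
  rw [e2]
  rw [hVz] at e3 ⊢
  linarith

end Gram

end

section

/-! ### Correctness and cost of the linear-algebra programs -/

section Computations

open Matrix Prog

variable {S : Type u} {A : Type v} {d : ℕ} [MeasurableSpace S] [MeasurableSpace A]
variable {M : MDP S A} {φ : S × A → Fin d → ℝ} {G : GreedyOracle φ}

theorem computes_dot (x y : Fin d → ℝ) : Computes M φ G (dot x y) (d * 2) (x ⬝ᵥ y) :=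
  .sum fun i => .op .mul (x i) (y i)

theorem computes_mulVec (B : Matrix (Fin d) (Fin d) ℝ) (x : Fin d → ℝ) :
    Computes M φ G (LSPI.mulVec B x) (d * (d * 2)) (B *ᵥ x) :=
  .tabulate fun i => computes_dot (B i) x

/-- A bound on the cost of inverting the Gram matrix of `m` vectors. -/
def invGramCost (d m : ℕ) : ℕ := d * d + m * (d * (d * 2) + d * 2 + 1 + d * (d * 3))

/-- The inverse of the regularized Gram matrix. -/
abbrev gramInv (lam : ℝ) (l : List (Fin d → ℝ)) : Matrix (Fin d) (Fin d) ℝ := (gram lam l)⁻¹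

theorem computes_invGram {lam : ℝ} (hlam : 0 < lam) (l : List (Fin d → ℝ)) :
    Computes M φ G (invGram lam l) (invGramCost d l.length) (gramInv lam l) := by
  induction l with
  | nil =>
    have hv : (fun i j : Fin d => (if i = j then 1 else 0) / lam) = gramInv lam [] := by
      rw [gramInv, gram, Matrix.inv_eq_right_inv (B := lam⁻¹ • 1)]
      · ext i j
        simp [Matrix.one_apply, div_eq_inv_mul]
      · simp [hlam.ne']
    refine Computes.of_eq (Computes.le (Computes.tabulate fun i => Computes.tabulate fun j =>
      .op .div _ _) ?_) hv
    simp [invGramCost]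
  | cons x l ih =>
    have hv : (fun i j => gramInv lam l i j -
        (gramInv lam l *ᵥ x) i * (gramInv lam l *ᵥ x) j /
          (1 + x ⬝ᵥ (gramInv lam l *ᵥ x))) = gramInv lam (x :: l) := by
      rw [gramInv, gramInv, gram, inv_add_vecMulVec hlam]
      ext i j
      simp [vecMulVec_apply, invNormSq, div_eq_inv_mul]
    refine Computes.of_eq (Computes.le (ih.bind <| (computes_mulVec _ x).bind <| (computes_dot x _).bind <|
      (Computes.op .add _ _).bind <| Computes.tabulate fun i => Computes.tabulate fun j =>
      (Computes.op .mul _ _).bind <| (Computes.op .div _ _).bind <| .op .sub _ _) ?_) hv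
    rw [List.length_cons, invGramCost, invGramCost]
    exact le_of_eq (by ring)

/-- Invariant: `js` lists the columns still to be written; the residual `R` vanishes in the other
columns and is positive definite on the span of `js`, and `L` vanishes in the columns `js`. A pass
moves a rank-one matrix from `R` to `L Lᵀ`, leaving the Schur complement. Only the product `L Lᵀ`
matters later, so triangularity is not recorded. -/
theorem exists_computes_choleskyLoop (js : List (Fin d)) (hjs : js.Nodup)
    (R L : Matrix (Fin d) (Fin d) ℝ) (hsymm : Rᵀ = R) (hR : ∀ i, ∀ k ∉ js, R i k = 0)
    (hpos : ∀ x : Fin d → ℝ, x ≠ 0 → (∀ k ∉ js, x k = 0) → 0 < x ⬝ᵥ (R *ᵥ x))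
    (hL : ∀ i, ∀ k ∈ js, L i k = 0) :
    ∃ L' : Matrix (Fin d) (Fin d) ℝ,
      Computes M φ G (choleskyLoop js R L) (js.length * (1 + (d + d * (d * 2)))) L' ∧
      L' * L'ᵀ = L * Lᵀ + R := by
  induction js generalizing R L with
  | nil =>
    refine ⟨L, (Computes.ret L).le (by simp), ?_⟩
    have : R = 0 := by
      ext i k
      exact hR i k (by simp)
    rw [this, add_zero]
  | cons j js ih =>
    obtain ⟨hj, hjs⟩ := List.nodup_cons.1 hjs
    have hRjj : 0 < R j j := by
      have := hpos (Pi.single j 1) (by simp) fun k hk => by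
        rw [Pi.single_apply, if_neg]
        rintro rfl
        simp at hk
      simpa using this
    have hsq : Real.sqrt (R j j) * Real.sqrt (R j j) = R j j := Real.mul_self_sqrt hRjj.le
    set r : Fin d → ℝ := fun i => R i j with hr
    have hsymm' : ∀ i k, R i k = R k i := fun i k => congrFun (congrFun hsymm i) k |>.symm
    set R' : Matrix (Fin d) (Fin d) ℝ := R - (R j j)⁻¹ • vecMulVec r r with hR'
    have hcol : ∀ i k, R i j / Real.sqrt (R j j) * (R k j / Real.sqrt (R j j)) =
        (R j j)⁻¹ * (r i * r k) := fun i k => by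
      rw [div_mul_div_comm, hsq, div_eq_inv_mul]
    have hval : (fun i k => R i k - R i j / Real.sqrt (R j j) * (R k j / Real.sqrt (R j j))) =
        R' := by
      ext i k
      rw [hcol]
      rfl
    have hR'symm : R'ᵀ = R' := by
      rw [hR', transpose_sub, transpose_smul, transpose_vecMulVec, hsymm]
    have hquad : ∀ x : Fin d → ℝ, x ⬝ᵥ (R' *ᵥ x) = x ⬝ᵥ (R *ᵥ x) - (R j j)⁻¹ * (r ⬝ᵥ x) ^ 2 := by
      intro x
      rw [hR', sub_mulVec, dotProduct_sub, smul_mulVec, vecMulVec_mulVec, dotProduct_smul]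
      simp only [op_smul_eq_smul, dotProduct_smul, smul_eq_mul, dotProduct_comm x r]
      ring
    have h1 : ∀ i, ∀ k ∉ js, R' i k = 0 := by
      intro i k hk
      rw [hR', Matrix.sub_apply, Matrix.smul_apply, vecMulVec_apply, smul_eq_mul]
      by_cases hkj : k = j
      · rw [hkj]
        simp only [hr]
        field_simp
        ring
      · have : R k j = 0 := by
          rw [hsymm']
          exact hR j k (by simp [hkj, hk])
        simp [hr, this, hR i k (by simp [hkj, hk])]
    have h2 : ∀ x : Fin d → ℝ, x ≠ 0 → (∀ k ∉ js, x k = 0) → 0 < x ⬝ᵥ (R' *ᵥ x) := by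
      intro x hx hxs
      rw [hquad]
      have hxj : x j = 0 := hxs j hj
      -- This `t` minimizes the form of `R` on the line `x + t e_j`; the minimum is the value of the
      -- Schur complement `R'` at `x`, which is therefore positive.
      set t := - (r ⬝ᵥ x) / R j j with ht
      have hne : x + t • Pi.single j 1 ≠ 0 := by
        intro h
        refine hx (funext fun k => ?_)
        by_cases hkj : k = j
        · rw [hkj, hxj]
          rfl
        · simpa [hkj] using congrFun h k
      have := hpos (x + t • Pi.single j 1) hne fun k hk => by
        simp only [List.mem_cons, not_or] at hk
        simp [hk.1, hxs k hk.2]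
      have hRx : (R *ᵥ x) j = r ⬝ᵥ x := by
        simp only [Matrix.mulVec, hr]
        exact congrArg (· ⬝ᵥ x) (funext fun k => hsymm' j k)
      have hRj : x ⬝ᵥ (R *ᵥ Pi.single j 1) = r ⬝ᵥ x := by
        rw [mulVec_single_one, dotProduct_comm]
        rfl
      rw [mulVec_add, mulVec_smul, add_dotProduct, dotProduct_add, dotProduct_add,
        smul_dotProduct, smul_dotProduct, dotProduct_smul, dotProduct_smul, single_one_dotProduct,
        single_one_dotProduct, hRx, hRj, mulVec_single_one] at this
      simp only [smul_eq_mul, col_apply] at this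
      have e : (R j j)⁻¹ * (r ⬝ᵥ x) ^ 2 = - (t * (r ⬝ᵥ x) + (t * (r ⬝ᵥ x) + t * (t * R j j))) := by
        rw [ht]
        field_simp
        ring
      rw [e]
      linarith
    have h3 : ∀ i, ∀ k ∈ js,
        (if k = j then R i j / Real.sqrt (R j j) else L i k) = 0 := by
      intro i k hk
      rw [if_neg (by rintro rfl; exact hj hk)]
      exact hL i k (List.mem_cons_of_mem _ hk)
    obtain ⟨L', hL', hmul⟩ := ih hjs R' (fun i k => if k = j then R i j / Real.sqrt (R j j)
        else L i k) hR'symm h1 h2 h3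
    refine ⟨L', ?_, ?_⟩
    · refine Computes.le ((Computes.op .sqrt _ _).bind <| Computes.bind
        (.tabulate fun i => .op .div (R i j) (Real.sqrt (R j j))) <| Computes.bind
        (.tabulate fun i => .tabulate fun k => (Computes.op .mul _ _).bind <| .op .sub _ _)
        (?_ : Computes M φ G (choleskyLoop js _ _) (js.length * (1 + (d + d * (d * 2)))) L')) ?_
      · rw [← hval] at hL'
        exact hL'
      · rw [List.length_cons]
        exact le_of_eq (by ring)
    · rw [hmul]
      ext i k
      have : ∀ l, (if l = j then R i j / Real.sqrt (R j j) else L i l) *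
          (if l = j then R k j / Real.sqrt (R j j) else L k l) = L i l * L k l +
          (if l = j then R i j / Real.sqrt (R j j) * (R k j / Real.sqrt (R j j)) else 0) := by
        intro l
        split_ifs with h
        · rw [h, hL i j List.mem_cons_self, zero_mul, zero_add]
        · rw [add_zero]
      change (∑ l, (if l = j then R i j / Real.sqrt (R j j) else L i l) *
        (if l = j then R k j / Real.sqrt (R j j) else L k l)) + R' i k =
        (∑ l, L i l * L k l) + R i k
      rw [← hval]
      simp only [this, Finset.sum_add_distrib, Finset.sum_ite_eq', Finset.mem_univ, if_true]
      ring

theorem exists_computes_cholesky (B : Matrix (Fin d) (Fin d) ℝ) (hB : B.PosDef) :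
    ∃ L : Matrix (Fin d) (Fin d) ℝ,
      Computes M φ G (cholesky B) (d * (1 + (d + d * (d * 2)))) L ∧ L * Lᵀ = B := by
  obtain ⟨L, hL, h⟩ := exists_computes_choleskyLoop (M := M) (φ := φ) (G := G) (List.finRange d)
    (List.nodup_finRange d) B 0 (by
      rw [← conjTranspose_eq_transpose_of_trivial]
      exact hB.isHermitian) (by simp)
    (fun x hx _ => hB.dotProduct_mulVec_pos hx) (by simp)
  refine ⟨L, ?_, by simpa using h⟩
  rw [List.length_finRange] at hL
  exact hL

/-! ### The uncertainty check -/

theorem computes_readFeat (s : S) (a : A) : Computes M φ G (readFeat s a) d (φ (s, a)) := by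
  have := Computes.tabulate (M := M) (φ := φ) (G := G) (n := d)
    (f := fun i => coord s a i ret) (t := 1) (v := φ (s, a)) fun i X => .coord (.ret ⟨rfl, rfl⟩)
  rwa [mul_one] at this

variable (φ G) in
/-- The result of the loop of the uncertainty check. -/
def egssResult (τ : ℝ) (s : S) (L : Matrix (Fin d) (Fin d) ℝ) :
    List (Fin d × ℝ) → Option (CoreElt S A d)
  | [] => none
  | (l, σ) :: vs =>
      open Classical in
      if τ < (φ (s, G.act (fun i => σ * L i l) s) ⬝ᵥ fun i => σ * L i l) *
          (φ (s, G.act (fun i => σ * L i l) s) ⬝ᵥ fun i => σ * L i l) then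
        some ⟨s, G.act (fun i => σ * L i l) s, φ (s, G.act (fun i => σ * L i l) s)⟩
      else egssResult τ s L vs

theorem computes_egssLoop (τ : ℝ) (s : S) (L : Matrix (Fin d) (Fin d) ℝ)
    (vs : List (Fin d × ℝ)) :
    Computes M φ G (egssLoop τ s L vs) (vs.length * (d * 4 + 3)) (egssResult φ G τ s L vs) := by
  induction vs with
  | nil => exact (Computes.ret none).le (Nat.zero_le _)
  | cons v vs ih =>
    obtain ⟨l, σ⟩ := v
    rw [egssResult]
    refine Computes.le (p := egssLoop τ s L ((l, σ) :: vs)) (Computes.bind (.tabulate fun i => .op .mul σ (L i l)) <| Computes.greedy <|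
      (computes_readFeat _ _).bind <| (computes_dot _ _).bind <| (Computes.op .mul _ _).bind
      (t' := vs.length * (d * 4 + 3) + 1) ?_) ?_
    · intro X
      refine .less (fun h => ?_) fun h => ?_
      · exact .ret ⟨rfl, (if_pos h).symm⟩
      · exact (ih X).weaken le_rfl le_rfl fun X' x _ hx => ⟨hx.1, hx.2.trans (if_neg h).symm⟩
    · rw [List.length_cons]
      exact le_of_eq (by ring)

/-- A bound on the cost of the uncertainty check with `m` core elements. -/
def checkCost (d m : ℕ) : ℕ :=
  invGramCost d m + d * (1 + (d + d * (d * 2))) + d * 2 * (d * 4 + 3)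

/-- The factor depends on the core set only, hence one `L` serves for all states. -/
theorem exists_computes_uncertaintyCheck (prm : Params) (hlam : 0 < prm.lam)
    (C : List (CoreElt S A d)) :
    ∃ L : Matrix (Fin d) (Fin d) ℝ, L * Lᵀ = (gram prm.lam (C.map CoreElt.feat))⁻¹ ∧
      ∀ s, Computes M φ G (uncertaintyCheck prm s C) (checkCost d C.length)
        (egssResult φ G prm.τ s L (directions d)) := by
  obtain ⟨L, hL, h⟩ := exists_computes_cholesky (M := M) (φ := φ) (G := G)
    (gramInv prm.lam (C.map CoreElt.feat)) (gram_posDef hlam _).inv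
  refine ⟨L, h, fun s => Computes.le ((computes_invGram hlam _).bind <| hL.bind <|
    computes_egssLoop _ _ _ _) ?_⟩
  rw [checkCost, List.length_map]
  have : (directions d).length = d * 2 := by simp [directions]
  rw [this]
  exact le_of_eq (by ring)

/-- Since the inverse is `L Lᵀ`, the form is the squared Euclidean norm of `Lᵀ x`, whose coordinates
are the directions searched. -/
theorem invNormSq_eq_sum {lam : ℝ} {l : List (Fin d → ℝ)} {L : Matrix (Fin d) (Fin d) ℝ}
    (hL : L * Lᵀ = (gram lam l)⁻¹) (x : Fin d → ℝ) :
    invNormSq lam l x = ∑ k, (x ⬝ᵥ fun i => L i k) ^ 2 := by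
  rw [invNormSq, ← hL, ← mulVec_mulVec, dotProduct_mulVec, ← mulVec_transpose]
  simp only [dotProduct, Matrix.mulVec, transpose_apply, sq]
  simp only [mul_comm]

theorem egssResult_eq_some {τ : ℝ} {s : S} {L : Matrix (Fin d) (Fin d) ℝ}
    {vs : List (Fin d × ℝ)} (hvs : ∀ v ∈ vs, v.2 ^ 2 = 1) {z : CoreElt S A d}
    (h : egssResult φ G τ s L vs = some z) :
    z.state = s ∧ z.feat = φ (s, z.action) ∧ ∃ k, τ < (z.feat ⬝ᵥ fun i => L i k) ^ 2 := by
  induction vs with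
  | nil => simp [egssResult] at h
  | cons v vs ih =>
    obtain ⟨l, σ⟩ := v
    rw [egssResult] at h
    split_ifs at h with hτ
    · obtain rfl := Option.some_injective _ h
      refine ⟨rfl, rfl, l, hτ.trans_le (le_of_eq ?_)⟩
      have hσ := hvs _ List.mem_cons_self
      have : (fun i => σ * L i l) = σ • fun i => L i l := rfl
      rw [this, dotProduct_smul, smul_eq_mul]
      linear_combination (_ ⬝ᵥ fun i => L i l) ^ 2 * hσ
    · exact ih (fun v hv => hvs v (List.mem_cons_of_mem _ hv)) h

/-- The oracle's action maximizes the score in the direction `v`, so one comparison bounds the score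
of every action. The sign of `v` matters: the absolute value is bounded only once `v` and `-v` have
both been tried. -/
theorem egssResult_eq_none {τ : ℝ} {s : S} {L : Matrix (Fin d) (Fin d) ℝ}
    {vs : List (Fin d × ℝ)} (h : egssResult φ G τ s L vs = none) {v : Fin d × ℝ} (hv : v ∈ vs)
    (a : A) : v.2 * (φ (s, a) ⬝ᵥ fun i => L i v.1) ≤ Real.sqrt τ := by
  induction vs with
  | nil => simp at hv
  | cons v' vs ih =>
    obtain ⟨l, σ⟩ := v'
    rw [egssResult] at h
    split_ifs at h with hτ
    rcases List.mem_cons.1 hv with rfl | hv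
    · have h1 := G.isMax (fun i => σ * L i l) s a
      rw [dotProduct_comm, dotProduct_comm _ (φ _)] at h1
      have h2 : (φ (s, a) ⬝ᵥ fun i => σ * L i l) = σ * (φ (s, a) ⬝ᵥ fun i => L i l) := by
        have : (fun i => σ * L i l) = σ • fun i => L i l := rfl
        rw [this, dotProduct_smul, smul_eq_mul]
      rw [h2] at h1
      refine h1.trans (Real.le_sqrt_of_sq_le ?_)
      rw [sq]
      exact not_lt.1 hτ
    · exact ih h hv

theorem mem_directions (l : Fin d) : (l, (1 : ℝ)) ∈ directions d ∧ (l, (-1 : ℝ)) ∈ directions d := by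
  simp [directions]

theorem sq_eq_one_of_mem_directions {v : Fin d × ℝ} (hv : v ∈ directions d) : v.2 ^ 2 = 1 := by
  simp only [directions, List.mem_flatMap, List.mem_cons, List.not_mem_nil, or_false] at hv
  obtain ⟨l, -, rfl | rfl⟩ := hv <;> norm_num

/-- The price of searching by linear maximization: each of the `d` squares is at most `τ`, so the
norm is controlled only up to the factor `d`. -/
theorem invNormSq_le_of_egssResult_eq_none {lam τ : ℝ} (hτ : 0 ≤ τ) {l : List (Fin d → ℝ)}
    {L : Matrix (Fin d) (Fin d) ℝ} (hL : L * Lᵀ = (gram lam l)⁻¹) {s : S}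
    (h : egssResult φ G τ s L (directions d) = none) (a : A) :
    invNormSq lam l (φ (s, a)) ≤ d * τ := by
  rw [invNormSq_eq_sum hL]
  calc _ ≤ ∑ _k : Fin d, τ := Finset.sum_le_sum fun k _ => by
        have h1 := egssResult_eq_none h (mem_directions k).1 a
        have h2 := egssResult_eq_none h (mem_directions k).2 a
        rw [← Real.sq_sqrt hτ]
        exact sq_le_sq' (by simp only at h2; linarith) (by simp only at h1; linarith)
    _ = d * τ := by simp

theorem lt_invNormSq_of_egssResult_eq_some {lam τ : ℝ} {l : List (Fin d → ℝ)}
    {L : Matrix (Fin d) (Fin d) ℝ} (hL : L * Lᵀ = (gram lam l)⁻¹) {s : S} {z : CoreElt S A d}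
    (h : egssResult φ G τ s L (directions d) = some z) :
    z.state = s ∧ z.feat = φ (s, z.action) ∧ τ < invNormSq lam l z.feat := by
  obtain ⟨h1, h2, k, hk⟩ := egssResult_eq_some (fun v hv => sq_eq_one_of_mem_directions hv) h
  refine ⟨h1, h2, hk.trans_le ?_⟩
  rw [invNormSq_eq_sum hL]
  exact Finset.single_le_sum (f := fun k => (z.feat ⬝ᵥ fun i => L i k) ^ 2)
    (fun _ _ => sq_nonneg _) (Finset.mem_univ k)

/-- Needed because virtual policies switch between two actions on this set and must be kernels. -/
theorem measurableSet_egssResult_eq_none (hφ : Measurable φ) (τ : ℝ)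
    (L : Matrix (Fin d) (Fin d) ℝ) (vs : List (Fin d × ℝ)) :
    MeasurableSet {s | egssResult φ G τ s L vs = none} := by
  induction vs with
  | nil => simp [egssResult]
  | cons v vs ih =>
    obtain ⟨l, σ⟩ := v
    have hm : Measurable fun s => φ (s, G.act (fun i => σ * L i l) s) ⬝ᵥ fun i => σ * L i l := by
      simp only [dotProduct]
      refine Finset.measurable_sum _ fun i _ => Measurable.mul_const ?_ _
      exact (measurable_pi_apply i).comp (hφ.comp (measurable_id.prodMk (G.measurable_act _)))
    have : {s | egssResult φ G τ s L ((l, σ) :: vs) = none} =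
        {s | τ < (φ (s, G.act (fun i => σ * L i l) s) ⬝ᵥ fun i => σ * L i l) *
          (φ (s, G.act (fun i => σ * L i l) s) ⬝ᵥ fun i => σ * L i l)}ᶜ ∩
        {s | egssResult φ G τ s L vs = none} := by
      ext s
      simp only [egssResult, Set.mem_ofPred_eq, Set.mem_inter_iff, Set.mem_compl_iff]
      split_ifs with h <;> simp [h]
    rw [this]
    exact (measurableSet_lt measurable_const (hm.mul hm)).compl.inter ih

/-! ### Least squares -/

theorem computes_combine (l : List ((Fin d → ℝ) × ℝ)) :
    Computes M φ G (combine l) (l.length * (d * 2)) (weightedSum l) := by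
  induction l with
  | nil => exact (Computes.ret _).le (Nat.zero_le _)
  | cons x l ih =>
    obtain ⟨f, q⟩ := x
    have := ih.bind (f := fun y => tabulate d fun i => (Prog.op .mul q (f i)).bind fun m =>
      Prog.op .add (y i) m) <| Computes.tabulate fun i => (Computes.op .mul _ _).bind <|
      .op .add (weightedSum l i) (q * f i)
    exact Computes.le this (by rw [List.length_cons]; exact le_of_eq (by ring))

theorem computes_leastSquares {lam : ℝ} (hlam : 0 < lam) (C : List (CoreElt S A d)) (q : List ℝ) :
    Computes M φ G (leastSquares lam C q)
      (invGramCost d C.length + C.length * (d * 2) + d * (d * 2))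
      (gramInv lam (C.map CoreElt.feat) *ᵥ weightedSum ((C.map CoreElt.feat).zip q)) := by
  refine Computes.le ((computes_invGram hlam _).bind <| (computes_combine _).bind <|
    computes_mulVec (gramInv lam _) _) ?_
  rw [List.length_map, List.length_zip, List.length_map, ← add_assoc]
  gcongr
  exact min_le_left _ _

end Computations

end

section

attribute [instance] MDP.markov Policy.markov

/-! ### Value functions, policy iteration and truncated returns -/

section MDPs

variable {S : Type u} {A : Type v} [MeasurableSpace S] [MeasurableSpace A]

theorem integrable_of_mem_Icc {X : Type*} [MeasurableSpace X] (μ : Measure X) [IsFiniteMeasure μ]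
    {f : X → ℝ} (hf : Measurable f) {a b : ℝ} (h : ∀ x, f x ∈ Set.Icc a b) : Integrable f μ :=
  .of_mem_Icc a b hf.aemeasurable (.of_forall h)

theorem integral_mem_Icc {X : Type*} [MeasurableSpace X] (μ : Measure X) [IsProbabilityMeasure μ]
    {f : X → ℝ} {a b : ℝ} (h : ∀ x, f x ∈ Set.Icc a b) (hf : Measurable f) :
    ∫ x, f x ∂μ ∈ Set.Icc a b := by
  have hi := integrable_of_mem_Icc μ hf h
  have h1 := integral_mono (integrable_const a) hi fun x => (h x).1
  have h2 := integral_mono hi (integrable_const b) fun x => (h x).2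
  simpa using And.intro h1 h2

theorem measurable_integral_kernel {X Y : Type*} [MeasurableSpace X] [MeasurableSpace Y]
    (κ : Kernel X Y) {f : Y → ℝ} (hf : Measurable f) : Measurable fun x => ∫ y, f y ∂κ x :=
  (hf.stronglyMeasurable.integral_kernel (κ := κ)).measurable

variable (M : MDP S A) (π : Policy S A)

instance isMarkovKernel_stateLaw (t : ℕ) : IsMarkovKernel (stateLaw M π t) := by
  induction t with
  | zero => rw [stateLaw]; infer_instance
  | succ t ih => rw [stateLaw]; infer_instance

instance isMarkovKernel_pairLaw (t : ℕ) : IsMarkovKernel (pairLaw M π t) := by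
  rw [pairLaw]
  infer_instance

/-- One step of the Markov chain of states. -/
def stepLaw : Kernel S S := M.P ∘ₖ (Kernel.id ×ₖ π.act)

instance isMarkovKernel_stepLaw : IsMarkovKernel (stepLaw M π) := by
  rw [stepLaw]
  infer_instance

/-- The definition appends steps at the end; the Bellman equation needs the first step split off. -/
theorem stateLaw_succ' (t : ℕ) : stateLaw M π (t + 1) = stateLaw M π t ∘ₖ stepLaw M π := by
  induction t with
  | zero =>
    change M.P ∘ₖ ((Kernel.id ×ₖ π.act) ∘ₖ Kernel.id) = Kernel.id ∘ₖ _
    rw [stepLaw, Kernel.comp_id, Kernel.id_comp]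
  | succ t ih =>
    change M.P ∘ₖ (_ ∘ₖ stateLaw M π (t + 1)) = (M.P ∘ₖ (_ ∘ₖ stateLaw M π t)) ∘ₖ stepLaw M π
    rw [ih, Kernel.comp_assoc, Kernel.comp_assoc]

theorem pairLaw_succ' (t : ℕ) : pairLaw M π (t + 1) = pairLaw M π t ∘ₖ stepLaw M π := by
  rw [pairLaw, pairLaw, stateLaw_succ', Kernel.comp_assoc]

theorem id_prod_apply_eq_map (s : S) : (Kernel.id ×ₖ π.act) s = (π.act s).map (Prod.mk s) := by
  rw [Kernel.prod_apply, Kernel.id_apply, Measure.dirac_prod]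

theorem integral_id_prod {f : S × A → ℝ} (hf : Measurable f) (s : S) :
    ∫ x, f x ∂((Kernel.id ×ₖ π.act) s) = ∫ a, f (s, a) ∂(π.act s) := by
  rw [id_prod_apply_eq_map, integral_map measurable_prodMk_left.aemeasurable
    hf.aestronglyMeasurable]

theorem one_sub_gamma_pos : 0 < 1 - M.γ := by linarith [M.γ_lt_one]

/-- The expected reward in step `t`. -/
def stepReward (t : ℕ) (s : S) : ℝ := ∫ x, M.r x ∂(pairLaw M π t s)

theorem measurable_stepReward (t : ℕ) : Measurable (stepReward M π t) :=
  measurable_integral_kernel _ M.measurable_r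

theorem stepReward_mem (t : ℕ) (s : S) : stepReward M π t s ∈ Set.Icc (0 : ℝ) 1 :=
  integral_mem_Icc _ M.r_mem M.measurable_r

theorem summable_stepReward (s : S) : Summable fun t => M.γ ^ t * stepReward M π t s := by
  refine Summable.of_nonneg_of_le (fun t => mul_nonneg (pow_nonneg M.γ_nonneg t)
    (stepReward_mem M π t s).1) (fun t => ?_)
    (summable_geometric_of_lt_one M.γ_nonneg M.γ_lt_one)
  exact mul_le_of_le_one_right (pow_nonneg M.γ_nonneg t) (stepReward_mem M π t s).2

theorem V_eq_tsum (s : S) : V M π s = ∑' t, M.γ ^ t * stepReward M π t s := rfl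

theorem measurable_V : Measurable (V M π) :=
  Measurable.tsum fun t => (measurable_stepReward M π t).const_mul _

theorem V_mem (s : S) : V M π s ∈ Set.Icc (0 : ℝ) (1 - M.γ)⁻¹ := by
  constructor
  · exact tsum_nonneg fun t => mul_nonneg (pow_nonneg M.γ_nonneg t) (stepReward_mem M π t s).1
  · rw [← tsum_geometric_of_lt_one M.γ_nonneg M.γ_lt_one]
    refine (summable_stepReward M π s).tsum_le_tsum (fun t => ?_)
      (summable_geometric_of_lt_one M.γ_nonneg M.γ_lt_one)
    exact mul_le_of_le_one_right (pow_nonneg M.γ_nonneg t) (stepReward_mem M π t s).2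

theorem integrable_V (μ : Measure S) [IsFiniteMeasure μ] : Integrable (V M π) μ :=
  integrable_of_mem_Icc μ (measurable_V M π) (V_mem M π)

theorem measurable_Q : Measurable fun x : S × A => Q M π x.1 x.2 :=
  M.measurable_r.add ((measurable_integral_kernel M.P (measurable_V M π)).const_mul _)

theorem Q_mem (s : S) (a : A) : Q M π s a ∈ Set.Icc (0 : ℝ) (1 - M.γ)⁻¹ := by
  have h1 := M.r_mem (s, a)
  have h2 := integral_mem_Icc (M.P (s, a)) (V_mem M π) (measurable_V M π)
  have h3 := one_sub_gamma_pos M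
  have h4 : (1 - M.γ)⁻¹ = 1 + M.γ * (1 - M.γ)⁻¹ := by
    field_simp
    ring
  refine ⟨add_nonneg h1.1 (mul_nonneg M.γ_nonneg h2.1), ?_⟩
  rw [h4]
  exact add_le_add h1.2 (mul_le_mul_of_nonneg_left h2.2 M.γ_nonneg)

theorem measurable_Q_right (s : S) : Measurable (Q M π s) :=
  (measurable_Q M π).comp measurable_prodMk_left

theorem integrable_Q (s : S) (μ : Measure A) [IsFiniteMeasure μ] : Integrable (Q M π s) μ :=
  integrable_of_mem_Icc μ (measurable_Q_right M π s) (Q_mem M π s)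

/-- The Bellman equation. -/
theorem V_eq_integral_Q (s : S) : V M π s = ∫ a, Q M π s a ∂(π.act s) := by
  have hstep : ∀ t s, stepReward M π (t + 1) s = ∫ s', stepReward M π t s' ∂(stepLaw M π s) := by
    intro t s
    rw [stepReward, pairLaw_succ', Kernel.integral_comp]
    · rfl
    · exact integrable_of_mem_Icc _ M.measurable_r M.r_mem
  -- The interchange of series and integral is justified by the geometric majorant `γ ^ t`.
  have hsum : ∫ s', V M π s' ∂(stepLaw M π s) =
      ∑' t, M.γ ^ t * stepReward M π (t + 1) s := by
    simp only [hstep, ← integral_const_mul]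
    symm
    refine integral_tsum_of_summable_integral_norm
      (F := fun t s' => M.γ ^ t * stepReward M π t s') (fun t => ?_) ?_
    · exact (integrable_of_mem_Icc _ (measurable_stepReward M π t) (stepReward_mem M π t)).const_mul _
    · refine Summable.of_nonneg_of_le (fun t => integral_nonneg fun _ => norm_nonneg _) (fun t => ?_)
        (summable_geometric_of_lt_one M.γ_nonneg M.γ_lt_one)
      refine (integral_mem_Icc _ (a := 0) (fun s' => ⟨norm_nonneg _, ?_⟩)
        ((measurable_stepReward M π t).const_mul _).norm).2
      rw [Real.norm_of_nonneg (mul_nonneg (pow_nonneg M.γ_nonneg t) (stepReward_mem M π t s').1)]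
      exact mul_le_of_le_one_right (pow_nonneg M.γ_nonneg t) (stepReward_mem M π t s').2
  have hV : V M π s = stepReward M π 0 s + M.γ * ∫ s', V M π s' ∂(stepLaw M π s) := by
    rw [V_eq_tsum, (summable_stepReward M π s).tsum_eq_zero_add, hsum, ← tsum_mul_left]
    simp only [pow_zero, one_mul, pow_succ']
    simp only [mul_assoc]
  have hr : stepReward M π 0 s = ∫ a, M.r (s, a) ∂(π.act s) := by
    rw [stepReward, pairLaw, stateLaw, Kernel.comp_id, integral_id_prod π M.measurable_r]
  rw [hV, hr, stepLaw, Kernel.integral_comp (integrable_V M π _), integral_id_prod π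
    (measurable_integral_kernel M.P (measurable_V M π)), ← integral_const_mul, ← integral_add]
  · rfl
  · exact integrable_of_mem_Icc _ (M.measurable_r.comp measurable_prodMk_left) fun a => M.r_mem _
  · exact (integrable_of_mem_Icc _ ((measurable_integral_kernel M.P (measurable_V M π)).comp
      measurable_prodMk_left) fun a => integral_mem_Icc _ (V_mem M π) (measurable_V M π)).const_mul _

/-! ### Approximate policy iteration -/

/-- Taking `D` to be the supremum gives `sup f ≤ c + γ sup f`; boundedness makes the supremum
meaningful, so no iteration is needed. -/
theorem le_div_of_contraction {X : Type*} {f : X → ℝ} (hf : BddAbove (Set.range f)) {c γ : ℝ}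
    (hγ : γ < 1) (h : ∀ D, (∀ x, f x ≤ D) → ∀ x, f x ≤ c + γ * D) (x : X) :
    f x ≤ c / (1 - γ) := by
  have : Nonempty X := ⟨x⟩
  have h1 : (⨆ x, f x) ≤ c + γ * ⨆ x, f x := ciSup_le (h _ fun x => le_ciSup hf x)
  refine (le_ciSup hf x).trans ?_
  rw [le_div_iff₀ (by linarith)]
  linarith

theorem Q_sub_Q_le (π' : Policy S A) {D : ℝ} (h : ∀ s, V M π s - V M π' s ≤ D) (s : S) (a : A) :
    Q M π s a - Q M π' s a ≤ M.γ * D := by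
  have : Q M π s a - Q M π' s a = M.γ * ∫ s', (V M π s' - V M π' s') ∂(M.P (s, a)) := by
    rw [integral_sub (integrable_V M π _) (integrable_V M π' _), Q, Q]
    ring
  rw [this]
  refine mul_le_mul_of_nonneg_left ?_ M.γ_nonneg
  have := integral_mono ((integrable_V M π _).sub (integrable_V M π' (M.P (s, a))))
    (integrable_const D) h
  simpa using this

theorem integral_Q_sub_le (π' : Policy S A) {D : ℝ} (h : ∀ s, V M π s - V M π' s ≤ D) (s : S)
    (μ : Measure A) [IsProbabilityMeasure μ] :
    ∫ a, Q M π s a ∂μ - ∫ a, Q M π' s a ∂μ ≤ M.γ * D := by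
  rw [← integral_sub (integrable_Q M π s _) (integrable_Q M π' s _)]
  have := integral_mono ((integrable_Q M π s _).sub (integrable_Q M π' s μ))
    (integrable_const (M.γ * D)) (Q_sub_Q_le M π π' h s)
  simpa using this

theorem bddAbove_range_V_sub (π' : Policy S A) :
    BddAbove (Set.range fun s => V M π s - V M π' s) := by
  refine ⟨(1 - M.γ)⁻¹, ?_⟩
  rintro _ ⟨s, rfl⟩
  have h1 := (V_mem M π s).2
  have h2 := (V_mem M π' s).1
  simp only
  linarith

/-- If one step of `π'` loses at most `c` against `π`, the loss of `π'` is at most `c / (1 - γ)`. -/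
theorem V_sub_V_le_of_step (π' : Policy S A) {c : ℝ}
    (h : ∀ s, V M π s - ∫ a, Q M π s a ∂(π'.act s) ≤ c) (s : S) :
    V M π s - V M π' s ≤ c / (1 - M.γ) := by
  refine le_div_of_contraction (f := fun s => V M π s - V M π' s) (bddAbove_range_V_sub M π π')
    M.γ_lt_one (fun D hD s => ?_) s
  have h1 := integral_Q_sub_le M π π' hD s (π'.act s)
  have h2 := h s
  have h3 := V_eq_integral_Q M π' s
  linarith

/-- One step of approximate policy iteration. -/
theorem policy_improvement (π' πs : Policy S A) (q : S → A → ℝ) (g : S → A) {η D : ℝ}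
    (hq : ∀ s a, |q s a - Q M π s a| ≤ η) (hg : ∀ s a, q s a ≤ q s (g s))
    (hπ' : ∀ s, π'.act s = Measure.dirac (g s)) (hD : ∀ s, V M πs s - V M π s ≤ D) (s : S) :
    V M πs s - V M π' s ≤ M.γ * D + 2 * η / (1 - M.γ) := by
  have hγ := one_sub_gamma_pos M
  have hint : ∀ (f : Policy S A) s, ∫ a, Q M f s a ∂(π'.act s) = Q M f s (g s) := fun f s => by
    rw [hπ', integral_dirac' _ _ (measurable_Q_right M f s).stronglyMeasurable]
  -- The action greedy for `q` loses at most `2η` against any distribution of actions, one `η` for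
  -- each passage between `q` and `Q`.
  have hgreedy : ∀ s (μ : Measure A) [IsProbabilityMeasure μ],
      ∫ a, Q M π s a ∂μ ≤ Q M π s (g s) + 2 * η := by
    intro s μ _
    have := integral_mono (integrable_Q M π s μ) (integrable_const (Q M π s (g s) + 2 * η))
      fun a => by
        have h1 := abs_le.1 (hq s a)
        have h2 := abs_le.1 (hq s (g s))
        have h3 := hg s a
        simp only
        linarith
    simpa using this
  have himp : ∀ s, V M π s - V M π' s ≤ 2 * η / (1 - M.γ) :=
    V_sub_V_le_of_step M π π' fun s => by
      rw [hint, V_eq_integral_Q]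
      linarith [hgreedy s (π.act s)]
  have h1 := integral_Q_sub_le M πs π hD s (πs.act s)
  have h2 := hgreedy s (πs.act s)
  have h3 := Q_sub_Q_le M π π' himp s (g s)
  -- The one-step greedy loss `2η` and the discounted loss of `π'` against `π` from the next state
  -- on add up to the same fraction.
  have h4 : 2 * η / (1 - M.γ) = 2 * η + M.γ * (2 * η / (1 - M.γ)) := by
    field_simp
    ring
  rw [V_eq_integral_Q M πs, V_eq_integral_Q M π', hint]
  linarith

/-! ### Laws of truncated returns -/

/-- The law of `r(s, a) + γ x`, where `s'` is the next state and `x` has law `κ s'`. -/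
def prependLaw (κ : Kernel S ℝ) : Kernel (S × A) ℝ :=
  (Kernel.id ×ₖ (κ ∘ₖ M.P)).map fun p : (S × A) × ℝ => M.r p.1 + M.γ * p.2

theorem measurable_prepend : Measurable fun p : (S × A) × ℝ => M.r p.1 + M.γ * p.2 :=
  (M.measurable_r.comp measurable_fst).add (measurable_snd.const_mul _)

instance isMarkovKernel_prependLaw (κ : Kernel S ℝ) [IsMarkovKernel κ] :
    IsMarkovKernel (prependLaw M κ) :=
  Kernel.IsMarkovKernel.map _ (measurable_prepend M)

/-- The law of the discounted return of `m` steps. -/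
def returnLaw : ℕ → Kernel S ℝ
  | 0 => Kernel.const S (Measure.dirac 0)
  | m + 1 => prependLaw M (returnLaw m) ∘ₖ (Kernel.id ×ₖ π.act)

instance isMarkovKernel_returnLaw (m : ℕ) : IsMarkovKernel (returnLaw M π m) := by
  induction m with
  | zero => rw [returnLaw]; infer_instance
  | succ m ih => rw [returnLaw]; infer_instance

theorem lintegral_prependLaw (κ : Kernel S ℝ) [IsMarkovKernel κ] {f : ℝ → ℝ≥0∞}
    (hf : Measurable f) (s : S) (a : A) : ∫⁻ x, f x ∂(prependLaw M κ (s, a)) =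
      ∫⁻ s', ∫⁻ x, f (M.r (s, a) + M.γ * x) ∂(κ s') ∂(M.P (s, a)) := by
  have h : Measurable fun p : (S × A) × ℝ => f (M.r p.1 + M.γ * p.2) :=
    hf.comp (measurable_prepend M)
  rw [prependLaw, Kernel.lintegral_map _ (measurable_prepend M) _ hf,
    Kernel.lintegral_id_prod h, Kernel.lintegral_comp]
  exact h.comp measurable_prodMk_left

theorem lintegral_returnLaw_succ (m : ℕ) {f : ℝ → ℝ≥0∞} (hf : Measurable f) (s : S) :
    ∫⁻ x, f x ∂(returnLaw M π (m + 1) s) =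
      ∫⁻ a, ∫⁻ s', ∫⁻ x, f (M.r (s, a) + M.γ * x) ∂(returnLaw M π m s') ∂(M.P (s, a))
        ∂(π.act s) := by
  rw [returnLaw, Kernel.lintegral_comp _ _ _ hf, id_prod_apply_eq_map,
    lintegral_map hf.lintegral_kernel measurable_prodMk_left]
  simp only [lintegral_prependLaw M _ hf]

theorem ae_prependLaw (κ : Kernel S ℝ) [IsMarkovKernel κ] {c : ℝ}
    (h : ∀ s, ∀ᵐ x ∂(κ s), x ∈ Set.Icc 0 c) (s : S) (a : A) :
    ∀ᵐ x ∂(prependLaw M κ (s, a)), x ∈ Set.Icc 0 (1 + M.γ * c) := by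
  have hB : MeasurableSet (Set.Icc (0 : ℝ) (1 + M.γ * c))ᶜ := measurableSet_Icc.compl
  rw [ae_iff]
  change prependLaw M κ (s, a) (Set.Icc (0 : ℝ) (1 + M.γ * c))ᶜ = 0
  rw [← lintegral_indicator_one hB, lintegral_prependLaw M κ (measurable_one.indicator hB)]
  rw [lintegral_eq_zero_of_ae_eq_zero]
  refine .of_forall fun s' => lintegral_eq_zero_of_ae_eq_zero ?_
  filter_upwards [h s'] with x hx
  have h1 := M.r_mem (s, a)
  refine Set.indicator_of_notMem ?_ _
  rw [Set.notMem_compl_iff]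
  exact ⟨add_nonneg h1.1 (mul_nonneg M.γ_nonneg hx.1),
    add_le_add h1.2 (mul_le_mul_of_nonneg_left hx.2 M.γ_nonneg)⟩

theorem ae_returnLaw (m : ℕ) (s : S) :
    ∀ᵐ x ∂(returnLaw M π m s), x ∈ Set.Icc 0 (1 - M.γ)⁻¹ := by
  have h3 := one_sub_gamma_pos M
  have h4 : 1 + M.γ * (1 - M.γ)⁻¹ = (1 - M.γ)⁻¹ := by
    field_simp
    ring
  induction m generalizing s with
  | zero =>
    rw [returnLaw, Kernel.const_apply]
    refine (ae_dirac_iff (p := fun x => x ∈ Set.Icc 0 (1 - M.γ)⁻¹) measurableSet_Icc).2 ?_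
    exact ⟨le_rfl, (inv_pos.2 h3).le⟩
  | succ m ih =>
    have hB : MeasurableSet (Set.Icc (0 : ℝ) (1 - M.γ)⁻¹)ᶜ := measurableSet_Icc.compl
    rw [ae_iff]
    change returnLaw M π (m + 1) s (Set.Icc (0 : ℝ) (1 - M.γ)⁻¹)ᶜ = 0
    rw [← lintegral_indicator_one hB, returnLaw, Kernel.lintegral_comp _ _ _
      (measurable_one.indicator hB), lintegral_eq_zero_of_ae_eq_zero]
    refine .of_forall fun x => (lintegral_indicator_one hB).trans ?_
    have := ae_prependLaw M (returnLaw M π m) ih x.1 x.2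
    rw [h4, ae_iff] at this
    exact this

theorem ae_prependLaw_returnLaw (m : ℕ) (s : S) (a : A) :
    ∀ᵐ x ∂(prependLaw M (returnLaw M π m) (s, a)), x ∈ Set.Icc 0 (1 - M.γ)⁻¹ := by
  have h3 := one_sub_gamma_pos M
  have h4 : 1 + M.γ * (1 - M.γ)⁻¹ = (1 - M.γ)⁻¹ := by
    field_simp
    ring
  have := ae_prependLaw M (returnLaw M π m) (ae_returnLaw M π m) s a
  rwa [h4] at this

theorem integral_prependLaw (κ : Kernel S ℝ) [IsMarkovKernel κ] {c : ℝ}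
    (h : ∀ s, ∀ᵐ x ∂(κ s), x ∈ Set.Icc 0 c) (s : S) (a : A) :
    ∫ x, x ∂(prependLaw M κ (s, a)) = M.r (s, a) + M.γ * ∫ s', ∫ x, x ∂(κ s') ∂(M.P (s, a)) := by
  have hκ : ∀ᵐ x ∂((κ ∘ₖ M.P) (s, a)), x ∈ Set.Icc 0 c := by
    have hB : MeasurableSet (Set.Icc (0 : ℝ) c)ᶜ := measurableSet_Icc.compl
    rw [ae_iff]
    change (κ ∘ₖ M.P) (s, a) (Set.Icc (0 : ℝ) c)ᶜ = 0
    rw [Kernel.comp_apply' _ _ _ hB, lintegral_eq_zero_of_ae_eq_zero]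
    exact .of_forall fun s' => (ae_iff.1 (h s') :)
  have hi : Integrable (fun x : ℝ => x) ((κ ∘ₖ M.P) (s, a)) :=
    .of_mem_Icc 0 c measurable_id.aemeasurable hκ
  have hmap : prependLaw M κ (s, a) =
      ((κ ∘ₖ M.P) (s, a)).map fun x => M.r (s, a) + M.γ * x := by
    have h2 : Measurable fun x : ℝ => M.r (s, a) + M.γ * x :=
      (measurable_id.const_mul _).const_add _
    ext B hB
    rw [← lintegral_indicator_one hB, lintegral_prependLaw M κ (measurable_one.indicator hB),
      ← lintegral_indicator_one hB, lintegral_map (measurable_one.indicator hB) h2]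
    exact (Kernel.lintegral_comp _ _ _ ((measurable_one.indicator hB).comp h2)).symm
  have h2 : Measurable fun x : ℝ => M.r (s, a) + M.γ * x :=
    (measurable_id.const_mul _).const_add _
  rw [hmap, integral_map (f := fun x => x) h2.aemeasurable measurable_id.aestronglyMeasurable,
    integral_add (integrable_const _) (hi.const_mul _), integral_const_mul,
    Kernel.integral_comp hi]
  simp

theorem integral_mem_Icc_of_ae (μ : Measure ℝ) [IsProbabilityMeasure μ] {a b : ℝ}
    (h : ∀ᵐ x ∂μ, x ∈ Set.Icc a b) : ∫ x, x ∂μ ∈ Set.Icc a b := by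
  have hi : Integrable (fun x : ℝ => x) μ := .of_mem_Icc a b measurable_id.aemeasurable h
  have h1 := integral_mono_ae (integrable_const a) hi (h.mono fun x hx => hx.1)
  have h2 := integral_mono_ae hi (integrable_const b) (h.mono fun x hx => hx.2)
  simpa using And.intro h1 h2

/-- The expected return of `m` steps is close to the value. -/
theorem abs_Q_sub_prepend_le (m : ℕ)
    (h : ∀ s, |V M π s - ∫ x, x ∂(returnLaw M π m s)| ≤ M.γ ^ m / (1 - M.γ)) (s : S) (a : A) :
    |Q M π s a - ∫ x, x ∂(prependLaw M (returnLaw M π m) (s, a))| ≤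
      M.γ ^ (m + 1) / (1 - M.γ) := by
  have hm : Measurable fun s' => ∫ x, x ∂(returnLaw M π m s') :=
    measurable_integral_kernel _ measurable_id
  rw [integral_prependLaw M _ (ae_returnLaw M π m), Q, add_sub_add_left_eq_sub, ← mul_sub,
    ← integral_sub (integrable_V M π _) (integrable_of_mem_Icc _ hm
    fun s => integral_mem_Icc_of_ae _ (ae_returnLaw M π m s)), abs_mul, abs_of_nonneg M.γ_nonneg,
    pow_succ', mul_div_assoc]
  refine mul_le_mul_of_nonneg_left ?_ M.γ_nonneg
  exact abs_le.2 (integral_mem_Icc _ (fun s => abs_le.1 (h s)) ((measurable_V M π).sub hm))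

theorem abs_V_sub_return_le (m : ℕ) (s : S) :
    |V M π s - ∫ x, x ∂(returnLaw M π m s)| ≤ M.γ ^ m / (1 - M.γ) := by
  induction m generalizing s with
  | zero =>
    rw [returnLaw, Kernel.const_apply, integral_dirac, sub_zero, abs_of_nonneg (V_mem M π s).1, pow_zero, one_div]
    exact (V_mem M π s).2
  | succ m ih =>
    have hm : Measurable fun x : S × A => ∫ y, y ∂(prependLaw M (returnLaw M π m) x) :=
      measurable_integral_kernel _ measurable_id
    have hi : Integrable (fun x : ℝ => x) ((prependLaw M (returnLaw M π m) ∘ₖ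
        (Kernel.id ×ₖ π.act)) s) :=
      .of_mem_Icc _ _ measurable_id.aemeasurable (ae_returnLaw M π (m + 1) s)
    have hms : Measurable fun a => ∫ y, y ∂(prependLaw M (returnLaw M π m) (s, a)) :=
      hm.comp measurable_prodMk_left
    rw [returnLaw, Kernel.integral_comp hi, integral_id_prod π hm, V_eq_integral_Q,
      ← integral_sub (integrable_Q M π s _) (integrable_of_mem_Icc _ hms fun a =>
        integral_mem_Icc_of_ae _ (ae_prependLaw_returnLaw M π m s a))]
    exact abs_le.2 (integral_mem_Icc _ (fun a => abs_le.1 (abs_Q_sub_prepend_le M π m ih s a))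
      ((measurable_Q_right M π s).sub hms))

end MDPs

end

section

/-! ### Probability bounds for programs -/

section Prob

variable {S : Type u} {A : Type v} {d : ℕ} {α : Type w} {β : Type w'}
variable [MeasurableSpace S] [MeasurableSpace A]
variable {M : MDP S A} {φ : S × A → Fin d → ℝ} {G : GreedyOracle φ} {π₀ : Policy S A}

theorem expect_mono (p : Prog S A d α) {f g : α → ℝ≥0∞} (h : ∀ x, f x ≤ g x) :
    p.expect M φ G π₀ f ≤ p.expect M φ G π₀ g := by
  induction p with
  | ret x => exact h x
  | query s a k ih => exact lintegral_mono fun s' => ih _ _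
  | greedy wt s k ih => exact ih _
  | coord s a i k ih => exact ih _
  | initAct s k ih => exact lintegral_mono fun a => ih _
  | arith o x y k ih => exact ih _
  | less x y k ih =>
    simp only [Prog.expect]
    split_ifs
    exacts [ih _, ih _]

theorem prob_eq_expect (p : Prog S A d α) (E : α → Prop) :
    p.prob M φ G π₀ E = p.expect M φ G π₀ ({x | E x}.indicator 1) := rfl

theorem prob_mono_of_within {p : Prog S A d α} {R : Set S → α → Prop} {X : Set S} {q t : ℕ}
    (hp : Prog.Within M φ G R p X q t) {E E' : α → Prop}
    (h : ∀ X' x, R X' x → E x → E' x) : p.prob M φ G π₀ E ≤ p.prob M φ G π₀ E' := by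
  refine hp.expect_mono π₀ fun X' x hx => ?_
  by_cases hE : E x
  · rw [Set.indicator_of_mem (show x ∈ {x | E x} from hE),
      Set.indicator_of_mem (show x ∈ {x | E' x} from h X' x hx hE)]
  · rw [Set.indicator_of_notMem (show x ∉ {x | E x} from hE)]
    exact zero_le

theorem prob_of_forall (p : Prog S A d α) {E : α → Prop} (h : ∀ x, E x) :
    p.prob M φ G π₀ E = 1 := by
  rw [prob_eq_expect, show {x | E x} = Set.univ from Set.eq_univ_of_forall h, Set.indicator_univ]
  exact Prog.expect_const M φ G π₀ p 1

theorem prob_of_forall_ret {x : α} {E : α → Prop} (h : E x) :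
    (Prog.ret x : Prog S A d α).prob M φ G π₀ E = 1 :=
  Set.indicator_of_mem (s := {x | E x}) h 1

theorem ofReal_one_sub_add_le {a b : ℝ} (ha : 0 ≤ a) (hb : 0 ≤ b) :
    ENNReal.ofReal (1 - (a + b)) ≤ ENNReal.ofReal (1 - b) * ENNReal.ofReal (1 - a) := by
  rcases le_total b 1 with h | h
  · rw [← ENNReal.ofReal_mul (by linarith)]
    exact ENNReal.ofReal_le_ofReal (by nlinarith)
  · rw [ENNReal.ofReal_of_nonpos (by linarith)]
    exact zero_le

/-- The union bound for the failure probabilities of two programs run one after the other. -/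
theorem prob_bind {p : Prog S A d α} {f : α → Prog S A d β} {E : α → Prop} {E' : β → Prop}
    {a b : ℝ} (ha : 0 ≤ a) (hb : 0 ≤ b) (hp : ENNReal.ofReal (1 - a) ≤ p.prob M φ G π₀ E)
    (hf : ∀ x, E x → ENNReal.ofReal (1 - b) ≤ (f x).prob M φ G π₀ E') :
    ENNReal.ofReal (1 - (a + b)) ≤ (p.bind f).prob M φ G π₀ E' := by
  rw [prob_eq_expect, Prog.expect_bind]
  calc ENNReal.ofReal (1 - (a + b))
      ≤ ENNReal.ofReal (1 - b) * p.prob M φ G π₀ E :=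
        (ofReal_one_sub_add_le ha hb).trans (mul_le_mul_right hp _)
    _ = p.expect M φ G π₀ fun x => ENNReal.ofReal (1 - b) * {x | E x}.indicator 1 x :=
        (Prog.expect_const_mul M φ G π₀ p _ ENNReal.ofReal_ne_top _).symm
    _ ≤ _ := expect_mono p fun x => ?_
  by_cases hE : E x
  · rw [Set.indicator_of_mem (show x ∈ {x | E x} from hE), Pi.one_apply, mul_one]
    exact hf x hE
  · rw [Set.indicator_of_notMem (show x ∉ {x | E x} from hE), mul_zero]
    exact zero_le

theorem prob_computes_bind {p : Prog S A d α} {t : ℕ} {v : α} (h : Prog.Computes M φ G p t v)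
    (f : α → Prog S A d β) (E : β → Prop) :
    (p.bind f).prob M φ G π₀ E = (f v).prob M φ G π₀ E :=
  h.expect_bind π₀ f _

/-! ### Rollouts -/

/-- Equality may fail for nonmeasurable `f`. The inequality points in the useful direction, because
probabilities are bounded from below. -/
theorem lintegral_dirac_le {X : Type*} [MeasurableSpace X] (f : X → ℝ≥0∞) (x : X) :
    ∫⁻ y, f y ∂(Measure.dirac x) ≤ f x := by
  obtain ⟨g, hg, hgf, heq⟩ := exists_measurable_le_lintegral_eq (Measure.dirac x) f
  rw [heq, lintegral_dirac' _ hg]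
  exact hgf x

theorem lintegral_act_le_expect_sampleAct (s : S) (pol : Pol d) (f : A → ℝ≥0∞) :
    ∫⁻ a, f a ∂((pol.toPolicy G π₀).act s) ≤ (sampleAct s pol).expect M φ G π₀ f := by
  cases pol with
  | none => exact le_rfl
  | some wt =>
    change ∫⁻ a, f a ∂(Kernel.deterministic (G.act wt) (G.measurable_act wt) s) ≤ f (G.act wt s)
    rw [Kernel.deterministic_apply]
    exact lintegral_dirac_le f _

/-- `E` is the expectation of the rest of a program and need not be measurable. Additivity of the
integral holds because both added failure terms are measurable. -/
theorem one_le_lintegral_add {X : Type*} [MeasurableSpace X] {μ : Measure X}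
    [IsProbabilityMeasure μ] {E f₁ f₂ : X → ℝ≥0∞} (h₁ : Measurable f₁) (h₂ : Measurable f₂)
    (h : ∀ x, 1 ≤ E x + f₁ x + f₂ x) :
    1 ≤ ∫⁻ x, E x ∂μ + ∫⁻ x, f₁ x ∂μ + ∫⁻ x, f₂ x ∂μ := by
  rw [← lintegral_add_right _ h₁, ← lintegral_add_right _ h₂]
  calc (1 : ℝ≥0∞) = ∫⁻ _, 1 ∂μ := by simp
    _ ≤ _ := lintegral_mono h

theorem one_le_lintegral_prependLaw {κ₁ κ₂ : Kernel S ℝ} [IsMarkovKernel κ₁] [IsMarkovKernel κ₂]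
    {E : S → ℝ≥0∞} {f₁ f₂ : ℝ → ℝ≥0∞} (h₁ : Measurable f₁) (h₂ : Measurable f₂) (s : S) (a : A)
    (h : ∀ s', 1 ≤ E s' + ∫⁻ x, f₁ (M.r (s, a) + M.γ * x) ∂(κ₁ s') +
      ∫⁻ x, f₂ (M.r (s, a) + M.γ * x) ∂(κ₂ s')) :
    1 ≤ ∫⁻ s', E s' ∂(M.P (s, a)) + ∫⁻ x, f₁ x ∂(prependLaw M κ₁ (s, a)) +
      ∫⁻ x, f₂ x ∂(prependLaw M κ₂ (s, a)) := by
  have hm : Measurable fun x : ℝ => M.r (s, a) + M.γ * x :=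
    (measurable_id.const_mul _).const_add _
  rw [lintegral_prependLaw M κ₁ h₁, lintegral_prependLaw M κ₂ h₂]
  exact one_le_lintegral_add (h₁.comp hm).lintegral_kernel (h₂.comp hm).lintegral_kernel h

theorem lintegral_returnLaw_succ_eq_prependLaw (π : Policy S A) (m : ℕ) {f : ℝ → ℝ≥0∞}
    (hf : Measurable f) (s : S) : ∫⁻ x, f x ∂(returnLaw M π (m + 1) s) =
      ∫⁻ a, ∫⁻ x, f x ∂(prependLaw M (returnLaw M π m) (s, a)) ∂(π.act s) := by
  rw [lintegral_returnLaw_succ M π m hf]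
  simp only [lintegral_prependLaw M _ hf]

/-- A rollout with `pol` which is not stopped looks like a rollout with any policy that agrees with
`pol` in the certain states; here for two such policies. -/
theorem one_le_expect_rolloutSteps {prm : Params} {C : List (CoreElt S A d)} {T : ℕ}
    {chk : S → Option (CoreElt S A d)}
    (hchk : ∀ s, Prog.Computes M φ G (uncertaintyCheck prm s C) T (chk s)) {pol : Pol d}
    {π₁ π₂ : Policy S A} (hπ₁ : ∀ s, chk s = none → π₁.act s = (pol.toPolicy G π₀).act s)
    (hπ₂ : ∀ s, chk s = none → π₂.act s = (pol.toPolicy G π₀).act s)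
    {f : CoreElt S A d ⊕ ℝ → ℝ≥0∞} {h₁ h₂ : ℝ → ℝ≥0∞} (hm₁ : Measurable h₁) (hm₂ : Measurable h₂)
    (hl : ∀ z, 1 ≤ f (.inl z)) (hr : ∀ x, 1 ≤ f (.inr x) + h₁ x + h₂ x)
    (m : ℕ) (s : S) (g acc : ℝ) :
    1 ≤ (rolloutSteps prm M.γ pol C m s g acc).expect M φ G π₀ f +
      ∫⁻ x, h₁ (acc + g * x) ∂(returnLaw M π₁ m s) +
      ∫⁻ x, h₂ (acc + g * x) ∂(returnLaw M π₂ m s) := by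
  induction m generalizing s g acc with
  | zero =>
    simpa [rolloutSteps, returnLaw, Prog.expect] using hr acc
  | succ m ih =>
    rw [rolloutSteps, (hchk s).expect_bind]
    cases hc : chk s with
    | some z => exact ((hl z).trans le_self_add).trans le_self_add
    | none =>
      have hmeas : ∀ {h : ℝ → ℝ≥0∞}, Measurable h → Measurable fun x => h (acc + g * x) :=
        fun hh => hh.comp ((measurable_id.const_mul _).const_add _)
      -- At a certain state both reference policies draw their action as `pol` does, so the three
      -- terms are integrals over the same action law.
      rw [lintegral_returnLaw_succ_eq_prependLaw _ _ (hmeas hm₁),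
        lintegral_returnLaw_succ_eq_prependLaw _ _ (hmeas hm₂), hπ₁ s hc, hπ₂ s hc]
      have key : ∀ a, 1 ≤ ∫⁻ s', (rolloutSteps prm M.γ pol C m s' (g * M.γ)
            (acc + g * M.r (s, a))).expect M φ G π₀ f ∂(M.P (s, a)) +
          ∫⁻ x, h₁ (acc + g * x) ∂(prependLaw M (returnLaw M π₁ m) (s, a)) +
          ∫⁻ x, h₂ (acc + g * x) ∂(prependLaw M (returnLaw M π₂ m) (s, a)) := by
        intro a
        refine one_le_lintegral_prependLaw (hmeas hm₁) (hmeas hm₂) s a fun s' => ?_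
        have e : ∀ x, acc + g * (M.r (s, a) + M.γ * x) = acc + g * M.r (s, a) + g * M.γ * x :=
          fun x => by ring
        simp only [e]
        exact ih s' _ _
      refine (one_le_lintegral_add (μ := (pol.toPolicy G π₀).act s)
        ((hmeas hm₁).lintegral_kernel.comp measurable_prodMk_left)
        ((hmeas hm₂).lintegral_kernel.comp measurable_prodMk_left) key).trans ?_
      refine add_le_add (add_le_add ?_ le_rfl) le_rfl
      rw [Prog.expect_bind]
      exact lintegral_act_le_expect_sampleAct s pol _

/-- The expectation of `h (tot + x₁ + … + xₘ)`, for independent `xᵢ` with law `ν`. -/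
def iterLaw (ν : Measure ℝ) (h : ℝ → ℝ≥0∞) : ℕ → ℝ → ℝ≥0∞
  | 0, tot => h tot
  | m + 1, tot => ∫⁻ x, iterLaw ν h m (tot + x) ∂ν

theorem measurable_iterLaw (ν : Measure ℝ) [SFinite ν] {h : ℝ → ℝ≥0∞} (hh : Measurable h)
    (m : ℕ) : Measurable (iterLaw ν h m) := by
  induction m with
  | zero => exact hh
  | succ m ih =>
    exact Measurable.lintegral_prod_right' (f := fun p : ℝ × ℝ => iterLaw ν h m (p.1 + p.2))
      (ih.comp (measurable_fst.add measurable_snd))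

theorem iterLaw_add (ν : Measure ℝ) [SFinite ν] {h h' : ℝ → ℝ≥0∞} (hh : Measurable h)
    (m : ℕ) (tot : ℝ) :
    iterLaw ν (fun x => h x + h' x) m tot = iterLaw ν h m tot + iterLaw ν h' m tot := by
  induction m generalizing tot with
  | zero => rfl
  | succ m ih =>
    simp only [iterLaw, ih]
    exact lintegral_add_left
      ((measurable_iterLaw ν hh m).comp (measurable_id.const_add _)) _

/-- Each rollout uses fresh draws, so the three-term inequality iterates: the remaining loop plays
the role of `f`, and the remaining convolutions those of `h₁` and `h₂`. -/
theorem one_le_expect_rolloutLoop {prm : Params} {C : List (CoreElt S A d)} {T : ℕ}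
    {chk : S → Option (CoreElt S A d)}
    (hchk : ∀ s, Prog.Computes M φ G (uncertaintyCheck prm s C) T (chk s)) {pol : Pol d}
    {π₁ π₂ : Policy S A} (hπ₁ : ∀ s, chk s = none → π₁.act s = (pol.toPolicy G π₀).act s)
    (hπ₂ : ∀ s, chk s = none → π₂.act s = (pol.toPolicy G π₀).act s)
    {f : CoreElt S A d ⊕ ℝ → ℝ≥0∞} {h₁ h₂ : ℝ → ℝ≥0∞} (hm₁ : Measurable h₁) (hm₂ : Measurable h₂)
    (hl : ∀ z, 1 ≤ f (.inl z)) (hr : ∀ x, 1 ≤ f (.inr x) + h₁ x + h₂ x)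
    (z : CoreElt S A d) (m : ℕ) (tot : ℝ) :
    1 ≤ (rolloutLoop prm M.γ pol C z m tot).expect M φ G π₀ f +
      iterLaw (prependLaw M (returnLaw M π₁ prm.H) (z.state, z.action)) h₁ m tot +
      iterLaw (prependLaw M (returnLaw M π₂ prm.H) (z.state, z.action)) h₂ m tot := by
  induction m generalizing tot with
  | zero => exact hr tot
  | succ m ih =>
    have hmeas : ∀ (π : Policy S A) {h : ℝ → ℝ≥0∞}, Measurable h → Measurable fun x =>
        iterLaw (prependLaw M (returnLaw M π prm.H) (z.state, z.action)) h m (tot + x) :=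
      fun π h hh => (measurable_iterLaw _ hh m).comp (measurable_id.const_add _)
    refine one_le_lintegral_prependLaw (hmeas π₁ hm₁) (hmeas π₂ hm₂) z.state z.action fun s' => ?_
    rw [Prog.expect_bind]
    exact one_le_expect_rolloutSteps (f := fun out => (match out with
        | .inl z' => .ret (.inl z')
        | .inr x => (Prog.op .add tot x).bind fun tot' => rolloutLoop prm M.γ pol C z m tot' :
          Prog S A d (CoreElt S A d ⊕ ℝ)).expect M φ G π₀ f)
      hchk hπ₁ hπ₂ (hmeas π₁ hm₁) (hmeas π₂ hm₂) (fun z => hl z)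
      (fun x => ih (tot + x)) prm.H s' M.γ (M.r (z.state, z.action))

/-- Hoeffding's lemma. -/
theorem lintegral_exp_le (ν : Measure ℝ) [IsProbabilityMeasure ν] {R : ℝ} (hR : 0 ≤ R)
    (h : ∀ᵐ x ∂ν, x ∈ Set.Icc 0 R) (l : ℝ) :
    ∫⁻ x, ENNReal.ofReal (Real.exp (l * x)) ∂ν ≤
      ENNReal.ofReal (Real.exp (l * ∫ x, x ∂ν + l ^ 2 * R ^ 2 / 8)) := by
  have hs := hasSubgaussianMGF_of_mem_Icc (X := fun x : ℝ => x) measurable_id.aemeasurable h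
  have hle := hs.mgf_le l
  have hint := hs.integrable_exp_mul l
  set μ := ∫ x, x ∂ν with hμ
  have h1 : ∀ x, Real.exp (l * x) = Real.exp (l * μ) * Real.exp (l * (x - μ)) := fun x => by
    rw [← Real.exp_add]
    congr 1
    ring
  rw [lintegral_congr fun x => (congrArg ENNReal.ofReal (h1 x)).trans
    (ENNReal.ofReal_mul (Real.exp_pos _).le), lintegral_const_mul' _ _ ENNReal.ofReal_ne_top, Real.exp_add,
    ENNReal.ofReal_mul (Real.exp_pos _).le]
  refine mul_le_mul_right ?_ _
  rw [← ofReal_integral_eq_lintegral_ofReal hint (.of_forall fun _ => (Real.exp_pos _).le)]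
  refine ENNReal.ofReal_le_ofReal (hle.trans (Real.exp_le_exp.2 (le_of_eq ?_)))
  simp only [sub_zero, NNReal.coe_pow, NNReal.coe_div, coe_nnnorm, Real.norm_of_nonneg hR]
  norm_num
  ring

theorem iterLaw_exp_le (ν : Measure ℝ) [IsProbabilityMeasure ν] {R : ℝ} (hR : 0 ≤ R)
    (h : ∀ᵐ x ∂ν, x ∈ Set.Icc 0 R) (l c : ℝ) (m : ℕ) (tot : ℝ) :
    iterLaw ν (fun t => ENNReal.ofReal (Real.exp (l * t + c))) m tot ≤
      ENNReal.ofReal (Real.exp (l * tot + c + m * (l * ∫ x, x ∂ν + l ^ 2 * R ^ 2 / 8))) := by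
  induction m generalizing tot with
  | zero => simp [iterLaw]
  | succ m ih =>
    set B := l * ∫ x, x ∂ν + l ^ 2 * R ^ 2 / 8 with hB
    calc _ ≤ ∫⁻ x, ENNReal.ofReal (Real.exp (l * tot + c + m * B)) *
          ENNReal.ofReal (Real.exp (l * x)) ∂ν := by
          refine lintegral_mono fun x => (ih (tot + x)).trans (le_of_eq ?_)
          rw [← ENNReal.ofReal_mul (Real.exp_pos _).le, ← Real.exp_add]
          congr 2
          ring
      _ ≤ ENNReal.ofReal (Real.exp (l * tot + c + m * B)) * ENNReal.ofReal (Real.exp B) := by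
          rw [lintegral_const_mul' _ _ ENNReal.ofReal_ne_top]
          exact mul_le_mul_right (lintegral_exp_le ν hR h l) _
      _ = _ := by
          rw [← ENNReal.ofReal_mul (Real.exp_pos _).le, ← Real.exp_add]
          congr 2
          push_cast
          ring

/-- The bound of Hoeffding's inequality. -/
def failureProb (n : ℕ) (θ γ : ℝ) : ℝ := Real.exp (-(2 * n * θ ^ 2 * (1 - γ) ^ 2))

theorem failureProb_nonneg (n : ℕ) (θ γ : ℝ) : 0 ≤ failureProb n θ γ := (Real.exp_pos _).le

/-- The function which majorizes the indicator of the event that the average of `n` returns with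
total `t` differs by more than `θ` from `μ`. -/
def deviationBound (n : ℕ) (θ γ μ t : ℝ) : ℝ≥0∞ :=
  ENNReal.ofReal (Real.exp (4 * θ * (1 - γ) ^ 2 * t + -(4 * θ * (1 - γ) ^ 2 * (n * (μ + θ))))) +
  ENNReal.ofReal (Real.exp (-(4 * θ * (1 - γ) ^ 2) * t + 4 * θ * (1 - γ) ^ 2 * (n * (μ - θ))))

theorem measurable_deviationBound (n : ℕ) (θ γ μ : ℝ) : Measurable (deviationBound n θ γ μ) := by
  unfold deviationBound
  fun_prop

theorem one_le_deviationBound {n : ℕ} (hn : 0 < n) {θ γ μ t : ℝ} (hθ : 0 ≤ θ)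
    (h : θ < |t / n - μ|) : 1 ≤ deviationBound n θ γ μ t := by
  have hn' : (0 : ℝ) < n := by exact_mod_cast hn
  have hl : 0 ≤ 4 * θ * (1 - γ) ^ 2 := by positivity
  have ht : t = n * (t / n) := by field_simp
  rw [deviationBound]
  rcases lt_abs.1 h with h | h
  · refine le_add_right ?_
    rw [← ENNReal.ofReal_one]
    refine ENNReal.ofReal_le_ofReal (Real.one_le_exp ?_)
    have : n * (μ + θ) ≤ n * (t / n) := mul_le_mul_of_nonneg_left (by linarith) hn'.le
    rw [← ht] at this
    nlinarith
  · refine le_add_left ?_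
    rw [← ENNReal.ofReal_one]
    refine ENNReal.ofReal_le_ofReal (Real.one_le_exp ?_)
    have : n * (t / n) ≤ n * (μ - θ) := mul_le_mul_of_nonneg_left (by linarith) hn'.le
    rw [← ht] at this
    nlinarith

/-- The Chernoff exponent `n (l² R²/8 - l θ)` with `R = (1-γ)⁻¹` is minimal at `l = 4θ(1-γ)²`, where
it equals `-2nθ²(1-γ)²`. The factor 2 counts the two tails. -/
theorem iterLaw_deviationBound_le (ν : Measure ℝ) [IsProbabilityMeasure ν] {γ : ℝ} (hγ : γ < 1)
    (h : ∀ᵐ x ∂ν, x ∈ Set.Icc 0 (1 - γ)⁻¹) (n : ℕ) (θ : ℝ) :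
    iterLaw ν (deviationBound n θ γ (∫ x, x ∂ν)) n 0 ≤
      ENNReal.ofReal (2 * failureProb n θ γ) := by
  have hγ' : 0 < 1 - γ := by linarith
  have hR : (0 : ℝ) ≤ (1 - γ)⁻¹ := (inv_pos.2 hγ').le
  unfold deviationBound
  rw [iterLaw_add _ (by fun_prop), two_mul, ENNReal.ofReal_add (failureProb_nonneg n θ γ)
    (failureProb_nonneg n θ γ)]
  refine add_le_add ((iterLaw_exp_le ν hR h _ _ n 0).trans (le_of_eq ?_))
    ((iterLaw_exp_le ν hR h _ _ n 0).trans (le_of_eq ?_)) <;>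
  · rw [failureProb]
    congr 2
    field_simp
    ring

/-- The expected discounted return of a rollout of length `H` with `π`. -/
def truncQ (M : MDP S A) (π : Policy S A) (H : ℕ) (s : S) (a : A) : ℝ :=
  ∫ x, x ∂(prependLaw M (returnLaw M π H) (s, a))

theorem abs_Q_sub_truncQ_le (M : MDP S A) (π : Policy S A) (H : ℕ) (s : S) (a : A) :
    |Q M π s a - truncQ M π H s a| ≤ M.γ ^ (H + 1) / (1 - M.γ) :=
  abs_Q_sub_prepend_le M π H (abs_V_sub_return_le M π H) s a

/-- The average return `x` from `z` is `θ`-close to the expected return for `π₁` and for `π₂`. -/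
def Accurate (M : MDP S A) (H : ℕ) (θ : ℝ) (π₁ π₂ : Policy S A) (z : CoreElt S A d) (x : ℝ) :
    Prop :=
  |x - truncQ M π₁ H z.state z.action| ≤ θ ∧ |x - truncQ M π₂ H z.state z.action| ≤ θ

/-- The factor 4 counts two tails for each of two reference policies. A stopped rollout satisfies
the event vacuously. -/
theorem prob_rollout_accurate {prm : Params} {C : List (CoreElt S A d)} {T : ℕ}
    {chk : S → Option (CoreElt S A d)}
    (hchk : ∀ s, Prog.Computes M φ G (uncertaintyCheck prm s C) T (chk s)) {pol : Pol d}
    {π₁ π₂ : Policy S A} (hπ₁ : ∀ s, chk s = none → π₁.act s = (pol.toPolicy G π₀).act s)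
    (hπ₂ : ∀ s, chk s = none → π₂.act s = (pol.toPolicy G π₀).act s) (hn : 0 < prm.n)
    {θ : ℝ} (hθ : 0 ≤ θ) (z : CoreElt S A d) :
    ENNReal.ofReal (1 - 4 * failureProb prm.n θ M.γ) ≤ (rollout prm M.γ pol C z).prob M φ G π₀
      fun out => ∀ x, out = .inr x → Accurate M prm.H θ π₁ π₂ z x := by
  have h4 := failureProb_nonneg prm.n θ M.γ
  rw [ENNReal.ofReal_sub _ (by linarith), ENNReal.ofReal_one, tsub_le_iff_right, prob_eq_expect,
    rollout, Prog.expect_bind]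
  refine (one_le_expect_rolloutLoop (f := fun out => (match out with
      | .inl z' => .ret (.inl z')
      | .inr tot => (Prog.op .div tot prm.n).bind fun x => .ret (.inr x) :
        Prog S A d (CoreElt S A d ⊕ ℝ)).expect M φ G π₀
      ({out | ∀ x, out = .inr x → Accurate M prm.H θ π₁ π₂ z x}.indicator 1)) hchk hπ₁ hπ₂
    (measurable_deviationBound prm.n θ M.γ (truncQ M π₁ prm.H z.state z.action))
    (measurable_deviationBound prm.n θ M.γ (truncQ M π₂ prm.H z.state z.action))
    (fun z' => ?_) (fun tot => ?_) z prm.n 0).trans ?_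
  · refine le_of_eq (Set.indicator_of_mem (f := (1 : CoreElt S A d ⊕ ℝ → ℝ≥0∞)) ?_).symm
    intro x hx
    cases hx
  · by_cases hacc : Accurate M prm.H θ π₁ π₂ z (tot / prm.n)
    · refine (le_of_eq (Set.indicator_of_mem (f := (1 : CoreElt S A d ⊕ ℝ → ℝ≥0∞)) ?_).symm).trans
        (le_add_right le_self_add)
      intro x hx
      obtain rfl := Sum.inr_injective hx
      exact hacc
    · rw [Accurate, not_and_or, not_le, not_le] at hacc
      rcases hacc with h | h
      · exact le_add_right (le_add_left (one_le_deviationBound hn hθ h))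
      · exact le_add_left (one_le_deviationBound hn hθ h)
  · rw [add_assoc]
    refine add_le_add le_rfl ?_
    rw [show 4 * failureProb prm.n θ M.γ = 2 * failureProb prm.n θ M.γ +
      2 * failureProb prm.n θ M.γ by ring, ENNReal.ofReal_add (by linarith) (by linarith)]
    exact add_le_add
      (iterLaw_deviationBound_le _ M.γ_lt_one (ae_prependLaw_returnLaw M π₁ _ _ _) _ _)
      (iterLaw_deviationBound_le _ M.γ_lt_one (ae_prependLaw_returnLaw M π₂ _ _ _) _ _)

theorem prob_evaluate_accurate {prm : Params} {C : List (CoreElt S A d)} {T : ℕ}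
    {chk : S → Option (CoreElt S A d)}
    (hchk : ∀ s, Prog.Computes M φ G (uncertaintyCheck prm s C) T (chk s)) {pol : Pol d}
    {π₁ π₂ : Policy S A} (hπ₁ : ∀ s, chk s = none → π₁.act s = (pol.toPolicy G π₀).act s)
    (hπ₂ : ∀ s, chk s = none → π₂.act s = (pol.toPolicy G π₀).act s) (hn : 0 < prm.n)
    {θ : ℝ} (hθ : 0 ≤ θ) (zs : List (CoreElt S A d)) :
    ENNReal.ofReal (1 - zs.length * (4 * failureProb prm.n θ M.γ)) ≤
      (evaluate prm M.γ pol C zs).prob M φ G π₀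
      fun out => ∀ q, out = .inr q → List.Forall₂ (Accurate M prm.H θ π₁ π₂) zs q := by
  have h4 : 0 ≤ 4 * failureProb prm.n θ M.γ :=
    mul_nonneg (by norm_num) (failureProb_nonneg prm.n θ M.γ)
  induction zs with
  | nil =>
    rw [evaluate, prob_of_forall_ret]
    · simp
    · intro q hq
      obtain rfl := Sum.inr_injective hq
      exact .nil
  | cons z zs ih =>
    have e : ((z :: zs).length : ℝ) * (4 * failureProb prm.n θ M.γ) =
      4 * failureProb prm.n θ M.γ + zs.length * (4 * failureProb prm.n θ M.γ) := by
        rw [List.length_cons]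
        push_cast
        ring
    rw [e, evaluate]
    refine prob_bind h4 (by positivity) (prob_rollout_accurate hchk hπ₁ hπ₂ hn hθ z)
      fun out hout => ?_
    cases out with
    | inl z' =>
      rw [prob_of_forall_ret]
      · exact ENNReal.ofReal_le_one.2 (sub_le_self _ (by positivity))
      · intro q hq
        cases hq
    | inr x =>
      -- Collecting the estimates cannot fail, hence `b := 0`.
      have := prob_bind (f := fun out => (match out with
        | .inl z' => .ret (.inl z')
        | .inr xs => .ret (.inr (x :: xs)) : Prog S A d (CoreElt S A d ⊕ List ℝ)))
        (E' := fun out => ∀ q, out = .inr q →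
          List.Forall₂ (Accurate M prm.H θ π₁ π₂) (z :: zs) q) (b := 0)
        (by positivity) le_rfl ih fun out hout' => ?_
      · rwa [add_zero] at this
      · cases out with
        | inl z' =>
          rw [prob_of_forall_ret]
          · simp
          · intro q hq
            cases hq
        | inr xs =>
          rw [prob_of_forall_ret]
          · simp
          · intro q hq
            obtain rfl := Sum.inr_injective hq
            exact .cons (hout x rfl) (hout' xs rfl)

end Prob

end

section

/-! ### Growth of the core set and the cost of a run -/

section Runs

open Prog

variable {S : Type u} {A : Type v} {d : ℕ} [MeasurableSpace S] [MeasurableSpace A]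
variable {M : MDP S A} {φ : S × A → Fin d → ℝ} {G : GreedyOracle φ}

/-- The quadratic form of the inverse of the regularized Gram matrix of a core set. -/
abbrev coreNormSq (lam : ℝ) (C : List (CoreElt S A d)) (x : Fin d → ℝ) : ℝ :=
  invNormSq lam (C.map CoreElt.feat) x

variable (φ) in
/-- `z` may be added to the core set `C` as an uncertain element. -/
structure IsUncertain (lam : ℝ) (C : List (CoreElt S A d)) (z : CoreElt S A d) : Prop where
  feat_eq : z.feat = φ (z.state, z.action)
  one_lt : 1 < coreNormSq lam C z.feat

variable (φ) in
/-- The invariant of the core set. -/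
structure IsCore (lam : ℝ) (C : List (CoreElt S A d)) : Prop where
  feat_eq : ∀ z ∈ C, z.feat = φ (z.state, z.action)
  length_pos : 0 < C.length
  le_det : lam ^ d * 2 ^ (C.length - 1) ≤ (gram lam (C.map CoreElt.feat)).det

-- The exponent in the invariant is the length minus one, because the first pair enters without a
-- check. Every later one contributes a factor above 2.
omit [MeasurableSpace S] [MeasurableSpace A] in
theorem IsCore.append {lam : ℝ} (hlam : 0 < lam) {C : List (CoreElt S A d)} (hC : IsCore φ lam C)
    {z : CoreElt S A d} (hz : IsUncertain φ lam C z) : IsCore φ lam (C ++ [z]) where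
  feat_eq z' hz' := by
    rcases List.mem_append.1 hz' with h | h
    · exact hC.feat_eq z' h
    · rw [List.mem_singleton.1 h]
      exact hz.feat_eq
  length_pos := by simp
  le_det := by
    have h1 := hC.le_det
    have h2 := hC.length_pos
    have h3 := hz.one_lt
    have h4 := (gram_posDef hlam (C.map CoreElt.feat)).det_pos
    rw [List.map_append, List.map_cons, List.map_nil, det_gram_append hlam, List.length_append,
      List.length_singleton, Nat.add_sub_cancel]
    obtain ⟨k, hk⟩ := Nat.exists_eq_add_of_lt h2
    rw [hk] at h1 ⊢
    simp only [Nat.zero_add, Nat.add_sub_cancel] at h1 ⊢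
    rw [pow_succ]
    nlinarith

omit [MeasurableSpace S] [MeasurableSpace A] in
theorem isCore_singleton {lam : ℝ} (hlam : 0 < lam) (s : S) (a : A) :
    IsCore φ lam [⟨s, a, φ (s, a)⟩] where
  feat_eq z hz := by rw [List.mem_singleton.1 hz]
  length_pos := by simp
  le_det := by
    have h := det_gram_append hlam [] (φ (s, a))
    rw [List.nil_append] at h
    have h' : (gram lam ([] : List (Fin d → ℝ))).det = lam ^ d := by simp [gram]
    simp only [List.map_cons, List.map_nil, h, h', List.length_singleton, Nat.sub_self, pow_zero,
      mul_one]
    exact le_mul_of_one_le_right (by positivity)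
      (le_add_of_nonneg_right (invNormSq_nonneg hlam _ _))

omit [MeasurableSpace S] [MeasurableSpace A] in
theorem IsCore.length_le {lam : ℝ} (hlam : 0 < lam) (hd : 0 < d) (hφ : BoundedFeatures φ)
    {C : List (CoreElt S A d)} (hC : IsCore φ lam C) : C.length ≤ ⌊cMax d 1 lam⌋₊ := by
  refine Nat.le_floor ?_
  have := length_le_cMax hlam hd (C.map CoreElt.feat) (fun x hx => ?_)
    (by rw [List.length_map]; exact hC.le_det)
  · rwa [List.length_map] at this
  · obtain ⟨z, hz, rfl⟩ := List.mem_map.1 hx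
    rw [hC.feat_eq z hz, ← norm_toLp_sq]
    exact pow_le_one₀ (norm_nonneg _) (hφ _)

/-- All later arguments use the check through these properties, and the Cholesky factor disappears.
The bounds are asymmetric: a certain state has norm at most `d`, a reported pair above 1. -/
theorem exists_check (hφ : Measurable φ) (prm : Params) (hlam : 0 < prm.lam) (hτ : prm.τ = 1)
    (C : List (CoreElt S A d)) :
    ∃ chk : S → Option (CoreElt S A d),
      (∀ s, Computes M φ G (uncertaintyCheck prm s C) (checkCost d C.length) (chk s)) ∧
      MeasurableSet {s | chk s = none} ∧
      (∀ s, chk s = none → ∀ a, coreNormSq prm.lam C (φ (s, a)) ≤ d) ∧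
      ∀ s z, chk s = some z → z.state = s ∧ IsUncertain φ prm.lam C z := by
  obtain ⟨L, hL, h⟩ := exists_computes_uncertaintyCheck (M := M) (φ := φ) (G := G) prm hlam C
  refine ⟨_, h, measurableSet_egssResult_eq_none hφ _ _ _, fun s hs a => ?_, fun s z hz => ?_⟩
  · have := invNormSq_le_of_egssResult_eq_none (by rw [hτ]; exact zero_le_one) hL hs a
    rwa [hτ, mul_one] at this
  · obtain ⟨h1, h2, h3⟩ := lt_invNormSq_of_egssResult_eq_some hL hz
    subst h1
    exact ⟨rfl, h2, hτ ▸ h3⟩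

theorem within_sampleAct (s : S) (pol : Pol d) (X : Set S) :
    Within M φ G (fun X' _ => X' = X) (sampleAct s pol) X 0 1 := by
  cases pol with
  | none => exact .initAct fun a => .ret rfl
  | some wt => exact .greedy (.ret rfl)

variable (φ) in
/-- If the answer is an element, it is uncertain and its state is known. -/
def FindsUncertain {β : Type*} (lam : ℝ) (C : List (CoreElt S A d)) (X : Set S)
    (out : CoreElt S A d ⊕ β) : Prop :=
  ∀ z, out = .inl z → z.state ∈ X ∧ IsUncertain φ lam C z

omit [MeasurableSpace S] [MeasurableSpace A] in
theorem FindsUncertain.of_inl {β γ : Type*} {lam : ℝ} {C : List (CoreElt S A d)} {X : Set S}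
    {z : CoreElt S A d} (h : FindsUncertain φ lam C X (.inl z : CoreElt S A d ⊕ β)) :
    FindsUncertain φ lam C X (.inl z : CoreElt S A d ⊕ γ) := fun z' hz' => by
  obtain rfl := Sum.inl_injective hz'
  exact h z rfl

section Phase

variable {prm : Params} {C : List (CoreElt S A d)} {T : ℕ} {chk : S → Option (CoreElt S A d)}

theorem within_rolloutSteps
    (hchk : ∀ s, Computes M φ G (uncertaintyCheck prm s C) T (chk s))
    (hsome : ∀ s z, chk s = some z → z.state = s ∧ IsUncertain φ prm.lam C z) (pol : Pol d)
    (m : ℕ) (s : S) (g acc : ℝ) {X : Set S} (hs : s ∈ X) :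
    Within M φ G (FindsUncertain φ prm.lam C) (rolloutSteps prm M.γ pol C m s g acc) X m
      (m * (T + 5)) := by
  induction m generalizing s g acc X with
  | zero => exact .ret fun z hz => by cases hz
  | succ m ih =>
    rw [rolloutSteps]
    -- Besides the check, a pass draws an action, makes one query and performs three arithmetic
    -- operations: five steps.
    refine Within.le (.computes_bind (hchk s) (q := m + 1) (t' := m * (T + 5) + 5) ?_) le_rfl
      (le_of_eq (by ring))
    cases hc : chk s with
    | some z =>
      obtain ⟨rfl, h⟩ := hsome s z hc
      exact .ret fun z' hz' => by
        obtain rfl := Sum.inl_injective hz'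
        exact ⟨hs, h⟩
    | none =>
      refine Within.le ((within_sampleAct s pol X).bind (q' := m + 1) (t' := m * (T + 5) + 3 + 1)
        fun X' a _ hX' => ?_) (by omega) (le_of_eq (by ring))
      subst hX'
      exact .query hs fun s' => .arith <| .arith <| .arith <| ih s' _ _ (Set.mem_insert _ _)

theorem within_rolloutLoop
    (hchk : ∀ s, Computes M φ G (uncertaintyCheck prm s C) T (chk s))
    (hsome : ∀ s z, chk s = some z → z.state = s ∧ IsUncertain φ prm.lam C z) (pol : Pol d)
    (z : CoreElt S A d) (m : ℕ) (tot : ℝ) {X : Set S} (hz : z.state ∈ X) :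
    Within M φ G (FindsUncertain φ prm.lam C) (rolloutLoop prm M.γ pol C z m tot) X
      (m * (1 + prm.H)) (m * (2 + prm.H * (T + 5))) := by
  induction m generalizing tot X with
  | zero => exact .ret fun z hz => by cases hz
  | succ m ih =>
    rw [rolloutLoop]
    refine Within.le (.query hz (q := prm.H + m * (1 + prm.H))
      (t := prm.H * (T + 5) + (m * (2 + prm.H * (T + 5)) + 1)) fun s' => ?_) (le_of_eq (by ring))
      (le_of_eq (by ring))
    refine (within_rolloutSteps hchk hsome pol _ s' _ _ (Set.mem_insert _ _)).bind
      fun X' out hX hout => ?_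
    cases out with
    | inl z' => exact .ret hout.of_inl
    | inr x => exact .arith (ih _ (hX (Set.mem_insert_of_mem _ hz)))

theorem within_rollout
    (hchk : ∀ s, Computes M φ G (uncertaintyCheck prm s C) T (chk s))
    (hsome : ∀ s z, chk s = some z → z.state = s ∧ IsUncertain φ prm.lam C z) (pol : Pol d)
    (z : CoreElt S A d) {X : Set S} (hz : z.state ∈ X) :
    Within M φ G (FindsUncertain φ prm.lam C) (rollout prm M.γ pol C z) X
      (prm.n * (1 + prm.H)) (prm.n * (2 + prm.H * (T + 5)) + 1) := by
  refine (within_rolloutLoop hchk hsome pol z prm.n 0 hz).bind (q' := 0)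
    fun X' out hX hout => ?_
  cases out with
  | inl z' => exact .ret hout.of_inl
  | inr x => exact .arith (.ret fun z hz => by cases hz)

theorem within_evaluate
    (hchk : ∀ s, Computes M φ G (uncertaintyCheck prm s C) T (chk s))
    (hsome : ∀ s z, chk s = some z → z.state = s ∧ IsUncertain φ prm.lam C z) (pol : Pol d)
    (zs : List (CoreElt S A d)) {X : Set S} (hzs : ∀ z ∈ zs, z.state ∈ X) :
    Within M φ G (FindsUncertain φ prm.lam C) (evaluate prm M.γ pol C zs) X
      (zs.length * (prm.n * (1 + prm.H))) (zs.length * (prm.n * (2 + prm.H * (T + 5)) + 1)) := by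
  induction zs generalizing X with
  | nil => exact .ret fun z hz => by cases hz
  | cons z zs ih =>
    rw [evaluate]
    refine Within.le ((within_rollout hchk hsome pol z (hzs z List.mem_cons_self)).bind
      (q' := zs.length * (prm.n * (1 + prm.H)))
      (t' := zs.length * (prm.n * (2 + prm.H * (T + 5)) + 1)) fun X' out hX hout => ?_)
      (le_of_eq (by rw [List.length_cons]; ring)) (le_of_eq (by rw [List.length_cons]; ring))
    cases out with
    | inl z' => exact .ret hout.of_inl
    | inr x =>
      refine (ih fun z hz => hX (hzs z (List.mem_cons_of_mem _ hz))).bind (q' := 0) (t' := 0)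
        fun X'' out hX' hout' => ?_
      cases out with
      | inl z' => exact .ret hout'.of_inl
      | inr xs => exact .ret fun z hz => by cases hz

end Phase

/-- A bound on the queries of one policy iteration with `m` core elements. -/
def phaseQueries (prm : Params) (m : ℕ) : ℕ := m * (prm.n * (1 + prm.H))

/-- A bound on the cost of one policy iteration with `m` core elements. -/
def phaseCost (d : ℕ) (prm : Params) (m : ℕ) : ℕ :=
  m * (prm.n * (2 + prm.H * (checkCost d m + 5)) + 1) +
    (invGramCost d m + m * (d * 2) + d * (d * 2))

theorem invGramCost_mono (d : ℕ) : Monotone (invGramCost d) := fun m m' h => by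
  unfold invGramCost
  gcongr

theorem checkCost_mono (d : ℕ) : Monotone (checkCost d) := fun m m' h => by
  unfold checkCost
  gcongr
  exact invGramCost_mono d h

theorem phaseQueries_mono (prm : Params) : Monotone (phaseQueries prm) := fun m m' h => by
  unfold phaseQueries
  gcongr

theorem phaseCost_mono (d : ℕ) (prm : Params) : Monotone (phaseCost d prm) := fun m m' h => by
  unfold phaseCost
  gcongr
  · exact checkCost_mono d h
  · exact invGramCost_mono d h

theorem within_iterations (hφ : Measurable φ) {prm : Params} (hlam : 0 < prm.lam) (hτ : prm.τ = 1)
    {C : List (CoreElt S A d)} (m : ℕ) (prev cur : Pol d) {X : Set S}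
    (hC : ∀ z ∈ C, z.state ∈ X) :
    Within M φ G (fun X' out => X ⊆ X' ∧ FindsUncertain φ prm.lam C X' out)
      (iterations prm M.γ C m prev cur) X
      (m * phaseQueries prm C.length) (m * phaseCost d prm C.length) := by
  obtain ⟨chk, hchk, -, -, hsome⟩ := exists_check (M := M) (G := G) hφ prm hlam hτ C
  induction m generalizing prev cur X with
  | zero => exact .ret ⟨subset_rfl, fun z hz => by cases hz⟩
  | succ m ih =>
    rw [iterations]
    refine Within.le ((within_evaluate hchk hsome cur C hC).bind
      (q' := m * phaseQueries prm C.length)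
      (t' := (invGramCost d C.length + C.length * (d * 2) + d * (d * 2)) +
        m * phaseCost d prm C.length) fun X' out hX hout => ?_)
      (le_of_eq (by rw [phaseQueries]; ring)) (le_of_eq (by rw [phaseCost]; ring))
    cases out with
    | inl z' => exact .ret ⟨hX, hout.of_inl⟩
    | inr q =>
      refine .computes_bind (computes_leastSquares hlam C q) ?_
      exact (ih cur _ fun z hz => hX (hC z hz)).weaken le_rfl le_rfl
        fun _ _ _ h => ⟨hX.trans h.1, h.2⟩

/-- The number of passes still possible is `cMax + 1` minus the current length: a restart enlarges
the core set by one, and the invariant bounds its size. Per-pass costs are majorized by those at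
maximal size. -/
theorem within_mainLoop (hφ : Measurable φ) (hb : BoundedFeatures φ) (hd : 0 < d) {prm : Params}
    (hlam : 0 < prm.lam) (hτ : prm.τ = 1) {C : List (CoreElt S A d)} (hcore : IsCore φ prm.lam C)
    (N : ℕ) (hN : ⌊cMax d 1 prm.lam⌋₊ + 1 - C.length ≤ N) {X : Set S}
    (hC : ∀ z ∈ C, z.state ∈ X) :
    Within M φ G (fun _ out => out ≠ none) (mainLoop prm M.γ N C) X
      ((⌊cMax d 1 prm.lam⌋₊ + 1 - C.length) *
        (prm.K * phaseQueries prm ⌊cMax d 1 prm.lam⌋₊))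
      ((⌊cMax d 1 prm.lam⌋₊ + 1 - C.length) *
        (prm.K * phaseCost d prm ⌊cMax d 1 prm.lam⌋₊)) := by
  induction N generalizing C X with
  -- No pass is left only if the core set has outgrown `cMax`, which the invariant excludes.
  | zero =>
    have := hcore.length_le hlam hd hb
    omega
  | succ N ih =>
    have hlen := hcore.length_le hlam hd hb
    set m := ⌊cMax d 1 prm.lam⌋₊ with hm
    obtain ⟨k, hk⟩ := Nat.exists_eq_add_of_le hlen
    have e : m + 1 - C.length = k + 1 := by omega
    rw [mainLoop, e]
    refine Within.le ((within_iterations hφ hlam hτ prm.K none none hC).bind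
      (q' := k * (prm.K * phaseQueries prm m)) (t' := k * (prm.K * phaseCost d prm m))
      fun X' out hX hout => ?_) ?_ ?_
    · cases out with
      | inl z =>
        obtain ⟨hz, hunc⟩ := hout.2 z rfl
        have hlen' : (C ++ [z]).length = C.length + 1 := by simp
        have := ih (hcore.append hlam hunc) (by omega) (X := X') (fun z' hz' => by
          rcases List.mem_append.1 hz' with h | h
          · exact hX (hC z' h)
          · rw [List.mem_singleton.1 h]
            exact hz)
        have e' : m + 1 - (C ++ [z]).length = k := by omega
        rwa [e'] at this
      | inr pol => exact .ret (Option.some_ne_none _)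
    · have := phaseQueries_mono prm hlen
      calc _ ≤ prm.K * phaseQueries prm m + k * (prm.K * phaseQueries prm m) := by gcongr
        _ = _ := by ring
    · have := phaseCost_mono d prm hlen
      calc _ ≤ prm.K * phaseCost d prm m + k * (prm.K * phaseCost d prm m) := by gcongr
        _ = _ := by ring

variable (φ) in
/-- There is a measurable set of states which contains `ρ` and in which all features have a small
norm. -/
def IsCertainAt (lam : ℝ) (C : List (CoreElt S A d)) (ρ : S) : Prop :=
  ∃ U : Set S, MeasurableSet U ∧ ρ ∈ U ∧ ∀ s ∈ U, ∀ a, coreNormSq lam C (φ (s, a)) ≤ d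

-- A larger core set has another Cholesky factor, so `ρ` is not known to pass the check again. The
-- norm bound, however, can only improve.
omit [MeasurableSpace A] in
theorem IsCertainAt.append {lam : ℝ} (hlam : 0 < lam) {C : List (CoreElt S A d)} {ρ : S}
    (h : IsCertainAt φ lam C ρ) (z : CoreElt S A d) : IsCertainAt φ lam (C ++ [z]) ρ := by
  obtain ⟨U, hU, hρ, h⟩ := h
  refine ⟨U, hU, hρ, fun s hs a => le_trans ?_ (h s hs a)⟩
  rw [coreNormSq, List.map_append, List.map_cons, List.map_nil]
  exact invNormSq_append_le hlam _ _ _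

theorem within_initCore (hφ : Measurable φ) (hb : BoundedFeatures φ) (hd : 0 < d) {prm : Params}
    (hlam : 0 < prm.lam) (hτ : prm.τ = 1) {C : List (CoreElt S A d)} (hcore : IsCore φ prm.lam C)
    (ρ : S) (N : ℕ) (hN : ⌊cMax d 1 prm.lam⌋₊ + 1 - C.length ≤ N) {X : Set S} (hρ : ρ ∈ X)
    (hC : ∀ z ∈ C, z.state ∈ X) :
    Within M φ G (fun X' out => ∃ C', out = some C' ∧ IsCore φ prm.lam C' ∧
        IsCertainAt φ prm.lam C' ρ ∧ ∀ z ∈ C', z.state ∈ X') (initCore prm ρ N C) X 0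
      ((⌊cMax d 1 prm.lam⌋₊ + 1 - C.length) * checkCost d ⌊cMax d 1 prm.lam⌋₊) := by
  induction N generalizing C with
  | zero =>
    have := hcore.length_le hlam hd hb
    omega
  | succ N ih =>
    have hlen := hcore.length_le hlam hd hb
    set m := ⌊cMax d 1 prm.lam⌋₊ with hm
    obtain ⟨k, hk⟩ := Nat.exists_eq_add_of_le hlen
    have e : m + 1 - C.length = k + 1 := by omega
    obtain ⟨chk, hchk, hmeas, hnone, hsome⟩ := exists_check (M := M) (G := G) hφ prm hlam hτ C
    rw [initCore, e]
    refine Within.le (.computes_bind (hchk ρ) (q := 0) (t' := k * checkCost d m) ?_) le_rfl ?_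
    · cases hc : chk ρ with
      | some z =>
        obtain ⟨rfl, hunc⟩ := hsome ρ z hc
        have hlen' : (C ++ [z]).length = C.length + 1 := by simp
        have := ih (hcore.append hlam hunc) (by omega) (fun z' hz' => by
          rcases List.mem_append.1 hz' with h | h
          · exact hC z' h
          · rw [List.mem_singleton.1 h]
            exact hρ)
        have e' : m + 1 - (C ++ [z]).length = k := by omega
        rwa [e'] at this
      | none => exact .ret ⟨C, rfl, hcore, ⟨_, hmeas, hc, hnone⟩, hC⟩
    · have := checkCost_mono d hlen
      calc _ ≤ checkCost d m + k * checkCost d m := by gcongr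
        _ = _ := by ring

/-- A bound on the queries of the algorithm, for core sets of at most `m` elements. -/
def totalQueries (prm : Params) (m : ℕ) : ℕ := m * (prm.K * phaseQueries prm m)

/-- A bound on the cost of the algorithm, for core sets of at most `m` elements. -/
def totalCost (d : ℕ) (prm : Params) (m : ℕ) : ℕ :=
  d + (m * checkCost d m + m * (prm.K * phaseCost d prm m))

/-- The budget does not depend on the cutoff `N`, and `none` never occurs. This expresses
termination of the loops; since they start with at least one core element, `cMax` passes suffice. -/
theorem within_confidentMCLSPI (hφ : Measurable φ) (hb : BoundedFeatures φ) (hd : 0 < d)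
    {prm : Params} (hlam : 0 < prm.lam) (hτ : prm.τ = 1) (ρ : S) (a₀ : A) (N : ℕ)
    (hN : cMax d 1 prm.lam ≤ N) :
    Within M φ G (fun _ out => out ≠ none) (confidentMCLSPI prm M.γ ρ a₀ N) {ρ}
      (totalQueries prm ⌊cMax d 1 prm.lam⌋₊) (totalCost d prm ⌊cMax d 1 prm.lam⌋₊) := by
  have hN' : ⌊cMax d 1 prm.lam⌋₊ ≤ N := Nat.floor_le_of_le hN
  have hcore := isCore_singleton (φ := φ) hlam ρ a₀
  refine .computes_bind (computes_readFeat ρ a₀) ?_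
  refine Within.le ((within_initCore hφ hb hd hlam hτ hcore ρ N (by simpa using hN')
    (Set.mem_singleton ρ) (by simp)).bind (q' := totalQueries prm ⌊cMax d 1 prm.lam⌋₊)
    (t' := ⌊cMax d 1 prm.lam⌋₊ * (prm.K * phaseCost d prm ⌊cMax d 1 prm.lam⌋₊))
    fun X' out _ hout => ?_) (by rw [Nat.zero_add]) (by simp)
  obtain ⟨C, rfl, hC, -, hX⟩ := hout
  have hpos := hC.length_pos
  refine (within_mainLoop hφ hb hd hlam hτ hC N (by omega) hX).le ?_ ?_
  · rw [totalQueries]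
    gcongr
    omega
  · gcongr
    omega

end Runs

end

section

section Correctness

/-! ### Correctness: virtual policies and the union bound -/

open Prog

variable {S : Type u} {A : Type v} {d : ℕ} [MeasurableSpace S] [MeasurableSpace A]
variable {M : MDP S A} {φ : S × A → Fin d → ℝ} {G : GreedyOracle φ} {π₀ : Policy S A}

/-- The weights computed from the value estimates `q`. -/
def weights (lam : ℝ) (C : List (CoreElt S A d)) (q : List ℝ) : Fin d → ℝ :=
  (gramInv lam (C.map CoreElt.feat)).mulVec (weightedSum ((C.map CoreElt.feat).zip q))

omit [MeasurableSpace S] [MeasurableSpace A] in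
theorem exists_mem_of_mem_zip {P : CoreElt S A d → ℝ → Prop} {C : List (CoreElt S A d)}
    {q : List ℝ} (h : List.Forall₂ P C q) :
    ∀ y ∈ (C.map CoreElt.feat).zip q, ∃ z ∈ C, y.1 = z.feat ∧ P z y.2 := by
  induction h with
  | nil => simp
  | @cons z x C q hzx _ ih =>
    intro y hy
    rcases List.mem_cons.1 hy with rfl | hy
    · exact ⟨z, List.mem_cons_self, rfl, hzx⟩
    · obtain ⟨z', hz', h⟩ := ih y hy
      exact ⟨z', List.mem_cons_of_mem _ hz', h⟩

/-- The error of the regression from accurate estimates, at a certain state. -/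
theorem abs_prediction_sub_Q_le {lam b ε θ η : ℝ} (hlam : 0 < lam)
    (hreal : LinearRealizable M φ b ε) {C : List (CoreElt S A d)} (hC : IsCore φ lam C) {m H : ℕ}
    (hm : C.length ≤ m) (hεη : ε ≤ η)
    (hη : d * (m * (ε + θ + M.γ ^ (H + 1) / (1 - M.γ)) ^ 2 + lam * b ^ 2) ≤ (η - ε) ^ 2)
    (π : Policy S A) {q : List ℝ}
    (hq : List.Forall₂ (fun z x => |x - truncQ M π H z.state z.action| ≤ θ) C q) {s : S} {a : A}
    (hs : coreNormSq lam C (φ (s, a)) ≤ d) :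
    |weights lam C q ⬝ᵥ φ (s, a) - Q M π s a| ≤ η := by
  obtain ⟨wt, hwt, happrox⟩ := hreal π
  have hfst : ((C.map CoreElt.feat).zip q).map Prod.fst = C.map CoreElt.feat :=
    List.map_fst_zip (by rw [List.length_map, hq.length_eq])
  have hlen : (((C.map CoreElt.feat).zip q).length : ℝ) ≤ m := by
    rw [List.length_zip, List.length_map, ← hq.length_eq, min_self]
    exact_mod_cast hm
  have hw : wt ⬝ᵥ wt ≤ b ^ 2 := by
    rw [← norm_toLp_sq]
    exact pow_le_pow_left₀ (norm_nonneg _) hwt 2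
  -- An estimate differs from the linear score by misspecification, sampling error and truncation.
  -- One further `ε` leads from the score at `(s, a)` back to `Q`, whence `η - ε` in the hypothesis.
  have h1 := leastSquares_error hlam ((C.map CoreElt.feat).zip q) wt (φ (s, a))
    (ε + θ + M.γ ^ (H + 1) / (1 - M.γ)) fun y hy => by
      obtain ⟨z, hz, hy1, hy2⟩ := exists_mem_of_mem_zip hq y hy
      have e1 := abs_le.1 (happrox z.state z.action)
      have e2 := abs_le.1 (abs_Q_sub_truncQ_le M π H z.state z.action)
      have e3 := abs_le.1 hy2
      rw [hy1, hC.feat_eq z hz, abs_le]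
      constructor <;> linarith
  rw [hfst] at h1
  have h2 : (weights lam C q ⬝ᵥ φ (s, a) - wt ⬝ᵥ φ (s, a)) ^ 2 ≤ (η - ε) ^ 2 := by
    refine (h1.trans ?_).trans hη
    refine mul_le_mul hs ?_ ?_ (Nat.cast_nonneg d)
    · gcongr
    · have := dotProduct_self_nonneg' wt
      positivity
  have h3 := abs_le_of_sq_le_sq h2 (by linarith)
  have h4 := happrox s a
  rw [abs_le] at h3 h4 ⊢
  constructor <;> linarith

variable (G) in
/-- Greedy with respect to `wt` in `U` and with respect to `wt'` elsewhere. -/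
def virtualPolicy {U : Set S} (hU : MeasurableSet U) (wt wt' : Fin d → ℝ) : Policy S A :=
  open Classical in
  ⟨Kernel.deterministic (fun s => if s ∈ U then G.act wt s else G.act wt' s)
    (Measurable.ite hU (G.measurable_act wt) (G.measurable_act wt')), inferInstance⟩

open Classical in
theorem virtualPolicy_act_apply {U : Set S} (hU : MeasurableSet U) (wt wt' : Fin d → ℝ) (s : S) :
    (virtualPolicy G hU wt wt').act s =
      Measure.dirac (if s ∈ U then G.act wt s else G.act wt' s) :=
  Kernel.deterministic_apply (Measurable.ite hU (G.measurable_act wt) (G.measurable_act wt')) s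

variable (M G π₀) in
/-- Some policy agrees with `cur` in `U` and is as good as the `k`-th iterate of approximate policy
iteration with errors at most `η`. -/
def IsStage (U : Set S) (η : ℝ) (k : ℕ) (cur : Pol d) : Prop :=
  ∃ π : Policy S A, (∀ s ∈ U, π.act s = (cur.toPolicy G π₀).act s) ∧
    ∀ πs s, V M πs s - V M π s ≤ M.γ ^ k / (1 - M.γ) + 2 * η / (1 - M.γ) ^ 2

theorem isStage_zero (U : Set S) {η : ℝ} (hη : 0 ≤ η) : IsStage M G π₀ U η 0 none := by
  refine ⟨π₀, fun s _ => rfl, fun πs s => ?_⟩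
  have h1 := (V_mem M πs s).2
  have h2 := (V_mem M π₀ s).1
  have h3 := one_sub_gamma_pos M
  have h4 : 0 ≤ 2 * η / (1 - M.γ) ^ 2 := by positivity
  rw [pow_zero, one_div]
  linarith

/-- Outside `U` the computed weights are useless, so the virtual policy uses weights realizing the
action values of `π`. It is then greedy for one function that is `η`-close to these values
everywhere, as policy improvement requires. -/
theorem exists_isStage_succ {U : Set S} (hU : MeasurableSet U) {b ε η : ℝ} (hεη : ε ≤ η)
    (hreal : LinearRealizable M φ b ε) {k : ℕ} {π : Policy S A}
    (hπ : ∀ πs s, V M πs s - V M π s ≤ M.γ ^ k / (1 - M.γ) + 2 * η / (1 - M.γ) ^ 2)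
    {wt : Fin d → ℝ} (hwt : ∀ s ∈ U, ∀ a, |wt ⬝ᵥ φ (s, a) - Q M π s a| ≤ η) :
    IsStage M G π₀ U η (k + 1) (some wt) := by
  classical
  obtain ⟨wt', -, hwt'⟩ := hreal π
  have hγ := one_sub_gamma_pos M
  refine ⟨virtualPolicy G hU wt wt', fun s hs => ?_, fun πs s => ?_⟩
  · rw [virtualPolicy_act_apply, if_pos hs]
    exact (Kernel.deterministic_apply (G.measurable_act wt) s).symm
  · refine (policy_improvement M π (virtualPolicy G hU wt wt') πs
      (fun s a => if s ∈ U then wt ⬝ᵥ φ (s, a) else wt' ⬝ᵥ φ (s, a))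
      (fun s => if s ∈ U then G.act wt s else G.act wt' s) (η := η)
      (fun s a => ?_) (fun s a => ?_) (fun s => ?_) (hπ πs) s).trans (le_of_eq ?_)
    · split_ifs with hs
      · exact hwt s hs a
      · rw [abs_sub_comm]
        exact (hwt' s a).trans hεη
    · split_ifs with hs
      · exact G.isMax wt s a
      · exact G.isMax wt' s a
    · exact virtualPolicy_act_apply hU wt wt' s
    · field_simp
      ring

variable {prm : Params} {b ε θ η : ℝ}

/-- The same prediction approximates the action values of the virtual and of the actual policy at
`ρ`, where both draw the same actions. Passing between them costs `2η`. -/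
theorem Vstar_sub_V_le {U : Set S} {ρ : S} (hρ : ρ ∈ U) {k : ℕ} {cur : Pol d} {π : Policy S A}
    (hcur : ∀ s ∈ U, π.act s = (cur.toPolicy G π₀).act s)
    (hπ : ∀ πs s, V M πs s - V M π s ≤ M.γ ^ k / (1 - M.γ) + 2 * η / (1 - M.γ) ^ 2)
    {wt : Fin d → ℝ} (h1 : ∀ a, |wt ⬝ᵥ φ (ρ, a) - Q M π ρ a| ≤ η)
    (h2 : ∀ a, |wt ⬝ᵥ φ (ρ, a) - Q M (cur.toPolicy G π₀) ρ a| ≤ η) :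
    Vstar M ρ - V M (cur.toPolicy G π₀) ρ ≤
      M.γ ^ k / (1 - M.γ) + 2 * η / (1 - M.γ) ^ 2 + 2 * η := by
  have hne : Nonempty (Policy S A) := ⟨π₀⟩
  rw [sub_le_iff_le_add]
  refine ciSup_le fun πs => ?_
  have h3 := hπ πs ρ
  have h4 : V M π ρ ≤ V M (cur.toPolicy G π₀) ρ + 2 * η := by
    rw [V_eq_integral_Q M π, V_eq_integral_Q M (cur.toPolicy G π₀), hcur ρ hρ]
    set π' := cur.toPolicy G π₀
    have := integral_mono (integrable_Q M π ρ (π'.act ρ))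
      ((integrable_Q M π' ρ (π'.act ρ)).add (integrable_const (2 * η))) fun a => by
        have e1 := abs_le.1 (h1 a)
        have e2 := abs_le.1 (h2 a)
        simp only [Pi.add_apply]
        linarith
    rw [integral_add' (integrable_Q M π' ρ _) (integrable_const _)] at this
    simpa using this
  linarith

/-- The induction carries the virtual companion of the current policy; only the last evaluation has
to compare it with the computed policy at `ρ`. -/
theorem prob_iterations (hlam : 0 < prm.lam) (hn : 0 < prm.n)
    (hθ : 0 ≤ θ) (hreal : LinearRealizable M φ b ε) {C : List (CoreElt S A d)}
    (hC : IsCore φ prm.lam C) {l : ℕ} (hl : C.length ≤ l) (hεη : ε ≤ η)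
    (hη : d * (l * (ε + θ + M.γ ^ (prm.H + 1) / (1 - M.γ)) ^ 2 + prm.lam * b ^ 2) ≤ (η - ε) ^ 2)
    {ρ : S} {U : Set S} (hU : MeasurableSet U) (hρ : ρ ∈ U)
    (hUd : ∀ s ∈ U, ∀ a, coreNormSq prm.lam C (φ (s, a)) ≤ d)
    {chk : S → Option (CoreElt S A d)} {T : ℕ}
    (hchk : ∀ s, Computes M φ G (uncertaintyCheck prm s C) T (chk s))
    (hchkU : ∀ s, chk s = none → s ∈ U)
    {g : ℝ} (hg : M.γ ^ (prm.K - 1) / (1 - M.γ) + 2 * η / (1 - M.γ) ^ 2 + 2 * η ≤ g)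
    (m k : ℕ) (hk : k + m = prm.K) (prev cur : Pol d) (hcur : IsStage M G π₀ U η k cur)
    (hprev : m = 0 → Vstar M ρ - V M (prev.toPolicy G π₀) ρ ≤ g) :
    ENNReal.ofReal (1 - m * (C.length * (4 * failureProb prm.n θ M.γ))) ≤
      (iterations prm M.γ C m prev cur).prob M φ G π₀ fun out =>
        ∀ pol, out = .inr pol → Vstar M ρ - V M (pol.toPolicy G π₀) ρ ≤ g := by
  have h4 : 0 ≤ (C.length : ℝ) * (4 * failureProb prm.n θ M.γ) :=
    mul_nonneg (Nat.cast_nonneg _) (mul_nonneg (by norm_num) (failureProb_nonneg prm.n θ M.γ))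
  induction m generalizing k prev cur with
  | zero =>
    rw [iterations, prob_of_forall_ret]
    · simp
    · intro pol hpol
      obtain rfl := Sum.inr_injective hpol
      exact hprev rfl
  | succ m ih =>
    obtain ⟨π, hagree, hπ⟩ := hcur
    have e : ((m + 1 : ℕ) : ℝ) * (C.length * (4 * failureProb prm.n θ M.γ)) =
        C.length * (4 * failureProb prm.n θ M.γ) +
          m * (C.length * (4 * failureProb prm.n θ M.γ)) := by
      push_cast
      ring
    rw [e, iterations]
    -- One set of rollouts is accurate for both policies, because they agree wherever a rollout
    -- continues.
    refine prob_bind h4 (by positivity) (prob_evaluate_accurate (π₁ := π)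
      (π₂ := cur.toPolicy G π₀) hchk (fun s hs => hagree s (hchkU s hs)) (fun _ _ => rfl) hn hθ C)
      fun out hout => ?_
    cases out with
    | inl z =>
      rw [prob_of_forall_ret]
      · exact ENNReal.ofReal_le_one.2 (sub_le_self _ (by positivity))
      · intro q hq
        cases hq
    | inr q =>
      have hq := hout q rfl
      have hw : ∀ s ∈ U, ∀ a, |weights prm.lam C q ⬝ᵥ φ (s, a) - Q M π s a| ≤ η := fun s hs a =>
        abs_prediction_sub_Q_le hlam hreal hC hl hεη hη π (hq.imp fun _ _ h => h.1) (hUd s hs a)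
      have hw' : ∀ s ∈ U, ∀ a,
          |weights prm.lam C q ⬝ᵥ φ (s, a) - Q M (cur.toPolicy G π₀) s a| ≤ η := fun s hs a =>
        abs_prediction_sub_Q_le hlam hreal hC hl hεη hη _ (hq.imp fun _ _ h => h.2) (hUd s hs a)
      refine le_of_le_of_eq ?_ (prob_computes_bind (computes_leastSquares hlam C q) _ _).symm
      refine ih (k + 1) (by omega) cur _ (exists_isStage_succ hU hεη hreal hπ hw) fun hm => ?_
      refine (Vstar_sub_V_le hρ hagree hπ (hw ρ hρ) (hw' ρ hρ)).trans ?_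
      -- The last evaluation certifies the policy it evaluates, which has index `K - 1`.
      have : k = prm.K - 1 := by omega
      rwa [this]

/-- A restart begins again at stage 0 with a new set `U`, so no accuracy is inherited from the
abandoned pass; the failure probabilities of the passes simply add up. -/
theorem prob_mainLoop (hφ : Measurable φ) (hb : BoundedFeatures φ) (hd : 0 < d)
    (hlam : 0 < prm.lam) (hτ : prm.τ = 1) (hn : 0 < prm.n) (hK : 0 < prm.K)
    (hθ : 0 ≤ θ) (hreal : LinearRealizable M φ b ε) (hε : 0 ≤ ε) {l : ℕ}
    (hl : ⌊cMax d 1 prm.lam⌋₊ = l) (hεη : ε ≤ η)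
    (hη : d * (l * (ε + θ + M.γ ^ (prm.H + 1) / (1 - M.γ)) ^ 2 + prm.lam * b ^ 2) ≤ (η - ε) ^ 2)
    {ρ : S} {g : ℝ} (hg : M.γ ^ (prm.K - 1) / (1 - M.γ) + 2 * η / (1 - M.γ) ^ 2 + 2 * η ≤ g)
    {C : List (CoreElt S A d)} (hC : IsCore φ prm.lam C) (hCρ : IsCertainAt φ prm.lam C ρ)
    (N : ℕ) (hN : l + 1 - C.length ≤ N) :
    ENNReal.ofReal (1 - (l + 1 - C.length : ℕ) *
        (prm.K * (l * (4 * failureProb prm.n θ M.γ)))) ≤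
      (mainLoop prm M.γ N C).prob M φ G π₀ (IsOptimalUpTo M G π₀ ρ g) := by
  have h4 : 0 ≤ 4 * failureProb prm.n θ M.γ :=
    mul_nonneg (by norm_num) (failureProb_nonneg prm.n θ M.γ)
  induction N generalizing C with
  | zero =>
    have := hC.length_le hlam hd hb
    omega
  | succ N ih =>
    have hlen := hC.length_le hlam hd hb
    rw [hl] at hlen
    obtain ⟨k, hk⟩ := Nat.exists_eq_add_of_le hlen
    have e : l + 1 - C.length = k + 1 := by omega
    obtain ⟨U₀, hU₀, hρ, hU₀d⟩ := hCρ
    obtain ⟨chk, hchk, hmeas, hnone, hsome⟩ := exists_check (M := M) (G := G) hφ prm hlam hτ C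
    -- The set `U` joins the states certain for the present core set with the older set containing
    -- `ρ`, since `ρ` need not pass the present check.
    have hp := prob_iterations (π₀ := π₀) (G := G) hlam hn hθ hreal hC hlen hεη hη
      (hU₀.union hmeas) (Or.inl hρ) (fun s hs a => hs.elim (fun h => hU₀d s h a)
      fun h => hnone s h a) hchk (fun s hs => Or.inr hs) hg prm.K 0 (by omega) none none
      (isStage_zero _ (hε.trans hεη)) (fun h => by omega)
    -- The sure fact that a reported pair is uncertain is added to the event; local access is
    -- irrelevant here, so all states count as known.
    have hp' := hp.trans (prob_mono_of_within (within_iterations (M := M) (G := G) hφ hlam hτ prm.K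
      none none (X := Set.univ) (C := C) (fun _ _ => Set.mem_univ _))
      (E' := fun out => (∀ pol, out = .inr pol → Vstar M ρ - V M (pol.toPolicy G π₀) ρ ≤ g) ∧
        ∀ z, out = .inl z → IsUncertain φ prm.lam C z)
      fun X' out hR hE => ⟨hE, fun z hz => (hR.2 z hz).2⟩)
    have hp'' : ENNReal.ofReal (1 - prm.K * (l * (4 * failureProb prm.n θ M.γ))) ≤ _ :=
      (ENNReal.ofReal_le_ofReal (by gcongr)).trans hp'
    have e' : ((l + 1 - C.length : ℕ) : ℝ) * (prm.K * (l * (4 * failureProb prm.n θ M.γ))) =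
        prm.K * (l * (4 * failureProb prm.n θ M.γ)) +
          k * (prm.K * (l * (4 * failureProb prm.n θ M.γ))) := by
      rw [e]
      push_cast
      ring
    rw [e', mainLoop]
    refine prob_bind (by positivity) (by positivity) hp'' fun out hout => ?_
    cases out with
    | inl z =>
      have hz := hout.2 z rfl
      have hlen' : (C ++ [z]).length = C.length + 1 := by simp
      have e'' : l + 1 - (C ++ [z]).length = k := by omega
      have := ih (hC.append hlam hz) (IsCertainAt.append hlam ⟨U₀, hU₀, hρ, hU₀d⟩ z) (by omega)
      rwa [e''] at this
    | inr pol =>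
      rw [prob_of_forall_ret]
      · exact ENNReal.ofReal_le_one.2 (sub_le_self _ (by positivity))
      · exact ⟨pol, rfl, hout.1 pol rfl⟩

theorem prob_confidentMCLSPI (hφ : Measurable φ) (hb : BoundedFeatures φ) (hd : 0 < d)
    (hlam : 0 < prm.lam) (hτ : prm.τ = 1) (hn : 0 < prm.n) (hK : 0 < prm.K)
    (hθ : 0 ≤ θ) (hreal : LinearRealizable M φ b ε) (hε : 0 ≤ ε) {l : ℕ}
    (hl : ⌊cMax d 1 prm.lam⌋₊ = l) (hεη : ε ≤ η)
    (hη : d * (l * (ε + θ + M.γ ^ (prm.H + 1) / (1 - M.γ)) ^ 2 + prm.lam * b ^ 2) ≤ (η - ε) ^ 2)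
    {g : ℝ} (hg : M.γ ^ (prm.K - 1) / (1 - M.γ) + 2 * η / (1 - M.γ) ^ 2 + 2 * η ≤ g)
    {δ : ℝ} (hδ : l * (prm.K * (l * (4 * failureProb prm.n θ M.γ))) ≤ δ)
    (ρ : S) (a₀ : A) (N : ℕ) (hN : cMax d 1 prm.lam ≤ N) :
    ENNReal.ofReal (1 - δ) ≤ (confidentMCLSPI prm M.γ ρ a₀ N).prob M φ G π₀
      (IsOptimalUpTo M G π₀ ρ g) := by
  have h4 : 0 ≤ 4 * failureProb prm.n θ M.γ :=
    mul_nonneg (by norm_num) (failureProb_nonneg prm.n θ M.γ)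
  have hN' : l ≤ N := hl ▸ Nat.floor_le_of_le hN
  refine le_of_le_of_eq ?_ (prob_computes_bind (computes_readFeat ρ a₀) _ _).symm
  -- Completing the core set at `ρ` succeeds in every run, hence with failure probability 0.
  have hp : ENNReal.ofReal (1 - 0) ≤ _ := (le_of_eq (by
      rw [sub_zero, ENNReal.ofReal_one, prob_of_forall _ fun _ => trivial])).trans <|
    prob_mono_of_within (π₀ := π₀) (within_initCore (M := M) (G := G) hφ hb hd hlam hτ
      (isCore_singleton (φ := φ) hlam ρ a₀) ρ N (by simpa [hl] using hN') (Set.mem_singleton ρ)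
      (by simp)) (E := fun _ => True)
      (E' := fun out => ∃ C', out = some C' ∧ IsCore φ prm.lam C' ∧ IsCertainAt φ prm.lam C' ρ)
      fun X' out ⟨C', h1, h2, h3, _⟩ _ => ⟨C', h1, h2, h3⟩
  have := prob_bind (f := fun out => (match out with
      | none => .ret none
      | some C => mainLoop prm M.γ N C : Prog S A d (Option (Pol d))))
    (b := l * (prm.K * (l * (4 * failureProb prm.n θ M.γ))))
    (E' := IsOptimalUpTo M G π₀ ρ g) le_rfl (by positivity) hp ?_
  · refine (ENNReal.ofReal_le_ofReal ?_).trans this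
    linarith
  · rintro _ ⟨C, rfl, hC, hCρ⟩
    have hpos := hC.length_pos
    refine le_trans (ENNReal.ofReal_le_ofReal ?_) (prob_mainLoop hφ hb hd hlam hτ hn hK hθ hreal hε
      hl hεη hη hg hC hCρ N (by omega))
    gcongr
    omega

end Correctness

end

section

/-! ### What the parameter settings achieve -/

section Parameters

/-- From `γ ≤ exp(-(1-γ))`. It converts the logarithmic choices of `H` and `K` into geometric decay.
-/
theorem pow_le_one_div {γ y : ℝ} {m : ℕ} (hγ : 0 ≤ γ) (hy : 0 < y)
    (h : Real.log y ≤ (1 - γ) * m) : γ ^ m ≤ 1 / y := by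
  have h1 : γ ≤ Real.exp (-(1 - γ)) := by
    have := Real.add_one_le_exp (-(1 - γ))
    linarith
  calc γ ^ m ≤ Real.exp (-(1 - γ)) ^ m := pow_le_pow_left₀ hγ h1 m
    _ = Real.exp (-((1 - γ) * m)) := by
        rw [← Real.exp_nat_mul]
        congr 1
        ring
    _ ≤ Real.exp (-Real.log y) := Real.exp_le_exp.2 (neg_le_neg h)
    _ = 1 / y := by rw [Real.exp_neg, Real.exp_log hy, one_div]

theorem natCeil_le_add_one {a c : ℝ} (h : a ≤ c) (hc : 0 ≤ c) : (⌈a⌉₊ : ℝ) ≤ c + 1 :=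
  (Nat.cast_le.2 (Nat.ceil_mono h)).trans (Nat.ceil_lt_add_one hc).le

theorem one_le_exp_one_div : 1 ≤ Real.exp 1 / (Real.exp 1 - 1) := by
  have := Real.exp_one_gt_d9
  rw [le_div_iff₀ (by linarith)]
  linarith

theorem exp_one_div_le : Real.exp 1 / (Real.exp 1 - 1) ≤ 8 / 5 := by
  have := Real.exp_one_gt_d9
  rw [div_le_iff₀ (by linarith)]
  linarith

variable {d : ℕ} {b γ κ δ : ℝ}

theorem lamOf_pos (hd : 0 < d) (hb : 0 < b) (hγ : γ < 1) (hκ : 0 < κ) : 0 < lamOf d b γ κ := by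
  have h1 : 0 < 1 - γ := by linarith
  have h2 : (0 : ℝ) < d := Nat.cast_pos.2 hd
  rw [lamOf]
  positivity

theorem cMaxOf_eq : cMaxOf d b γ κ =
    Real.exp 1 / (Real.exp 1 - 1) * 2 * d * (Real.log 2 + Real.log (1 + 1 / lamOf d b γ κ)) := by
  rw [cMaxOf, cMax]
  norm_num

theorem one_le_cMaxOf (hd : 0 < d) (hb : 0 < b) (hγ : γ < 1) (hκ : 0 < κ) :
    1 ≤ cMaxOf d b γ κ := by
  have h1 := lamOf_pos hd hb hγ hκ
  have h2 : (1 : ℝ) ≤ d := Nat.one_le_cast.2 hd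
  have h3 : 0 ≤ Real.log (1 + 1 / lamOf d b γ κ) :=
    Real.log_nonneg (by have := one_div_pos.2 h1; linarith)
  have h4 := Real.log_two_gt_d9
  have h5 := one_le_exp_one_div
  have h6 : 1 / 2 ≤ Real.log 2 := by linarith
  rw [cMaxOf_eq]
  calc (1 : ℝ) ≤ 1 * 2 * 1 * (1 / 2 + 0) := by norm_num
    _ ≤ _ := by gcongr

theorem cMaxOf_le {y : ℝ} (h : Real.log 2 + Real.log (1 + 1 / lamOf d b γ κ) ≤ y) (hy : 0 ≤ y) :
    cMaxOf d b γ κ ≤ 16 / 5 * d * y := by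
  rw [cMaxOf_eq]
  have h1 := one_le_exp_one_div
  have h2 := exp_one_div_le
  calc _ ≤ Real.exp 1 / (Real.exp 1 - 1) * 2 * d * y := mul_le_mul_of_nonneg_left h (by positivity)
    _ ≤ 8 / 5 * 2 * (d : ℝ) * y := by gcongr
    _ = _ := by ring

theorem one_le_KOf : 1 ≤ KOf γ κ := le_max_left _ _

/-- The regression amplifies estimation errors by at most `√(d · cMax)`. The parameters are chosen
so that every amplified error is measured in the unit `κ(1-γ)²/32`. -/
theorem sqrt_mul_thetaOf (hd : 0 < d) (hb : 0 < b) (hγ : γ < 1) (hκ : 0 < κ) :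
    Real.sqrt d * Real.sqrt (cMaxOf d b γ κ) * thetaOf d b γ κ = κ * (1 - γ) ^ 2 / 32 := by
  have h1 := one_le_cMaxOf hd hb hγ hκ
  have h2 : 0 < Real.sqrt (cMaxOf d b γ κ) := Real.sqrt_pos.2 (by linarith)
  have h3 : 0 < Real.sqrt d := Real.sqrt_pos.2 (Nat.cast_pos.2 hd)
  rw [thetaOf]
  field_simp

theorem thetaOf_pos (hd : 0 < d) (hb : 0 < b) (hγ : γ < 1) (hκ : 0 < κ) :
    0 < thetaOf d b γ κ := by
  have h1 := one_le_cMaxOf hd hb hγ hκ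
  have h2 : 0 < Real.sqrt (cMaxOf d b γ κ) := Real.sqrt_pos.2 (by linarith)
  have h3 : 0 < Real.sqrt d := Real.sqrt_pos.2 (Nat.cast_pos.2 hd)
  have h4 : 0 < 1 - γ := by linarith
  rw [thetaOf]
  positivity

theorem thetaOf_sq (hd : 0 < d) (hb : 0 < b) (hγ : γ < 1) (hκ : 0 < κ) :
    thetaOf d b γ κ ^ 2 = κ ^ 2 * (1 - γ) ^ 4 / (1024 * (d * cMaxOf d b γ κ)) := by
  have h1 := one_le_cMaxOf hd hb hγ hκ
  rw [thetaOf, div_pow, mul_pow, mul_pow, mul_pow, Real.sq_sqrt (Nat.cast_nonneg d),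
    Real.sq_sqrt (by linarith)]
  ring

theorem sqrt_mul_truncation_le (hd : 0 < d) (hb : 0 < b) (hγ0 : 0 ≤ γ) (hγ : γ < 1)
    (hκ : 0 < κ) : Real.sqrt d * Real.sqrt (cMaxOf d b γ κ) * (γ ^ (HOf d b γ κ + 1) / (1 - γ)) ≤
      κ * (1 - γ) ^ 2 / 32 := by
  have h1 := one_le_cMaxOf hd hb hγ hκ
  have h2 : 0 < Real.sqrt (cMaxOf d b γ κ) := Real.sqrt_pos.2 (by linarith)
  have h3 : 0 < Real.sqrt d := Real.sqrt_pos.2 (Nat.cast_pos.2 hd)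
  have h4 : 0 < 1 - γ := by linarith
  have h5 := pow_le_one_div (m := HOf d b γ κ + 1) hγ0
    (y := 32 * Real.sqrt (cMaxOf d b γ κ) * Real.sqrt d / (κ * (1 - γ) ^ 3)) (by positivity) (by
      rw [Real.log_div (by positivity) (by positivity), ← div_le_iff₀' h4, Nat.cast_add,
        Nat.cast_one, ← sub_le_iff_le_add]
      exact Nat.le_ceil _)
  calc _ ≤ Real.sqrt d * Real.sqrt (cMaxOf d b γ κ) *
        (1 / (32 * Real.sqrt (cMaxOf d b γ κ) * Real.sqrt d / (κ * (1 - γ) ^ 3)) / (1 - γ)) := by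
        gcongr
    _ = _ := by field_simp

theorem pow_KOf_div_le (hγ0 : 0 ≤ γ) (hγ : γ < 1) (hκ : 0 < κ) :
    γ ^ (KOf γ κ - 1) / (1 - γ) ≤ κ / 8 := by
  have h4 : 0 < 1 - γ := by linarith
  have h5 := pow_le_one_div (m := KOf γ κ - 1) hγ0 (y := 1 / (κ * (1 - γ) ^ 2) * 8)
    (by positivity) (by
      rw [Real.log_mul (by positivity) (by positivity), ← div_le_iff₀' h4,
        Nat.cast_sub one_le_KOf, Nat.cast_one, le_sub_iff_add_le]
      exact (Nat.le_ceil _).trans (Nat.cast_le.2 (le_max_right _ _)))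
  calc _ ≤ 1 / (1 / (κ * (1 - γ) ^ 2) * 8) / (1 - γ) := by gcongr
    _ = κ / 8 * (1 - γ) := by field_simp
    _ ≤ κ / 8 * 1 := by
      gcongr
      linarith
    _ = κ / 8 := mul_one _

theorem log_sub_log_pos (hd : 0 < d) (hb : 0 < b) (hγ : γ < 1) (hκ : 0 < κ) (hδ0 : 0 < δ)
    (hδ : δ < 1) : 0 < Real.log (4 * KOf γ κ * cMaxOf d b γ κ ^ 2) - Real.log δ := by
  have h1 := one_le_cMaxOf hd hb hγ hκ
  have h2 : (1 : ℝ) ≤ KOf γ κ := Nat.one_le_cast.2 one_le_KOf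
  have h3 := Real.log_neg hδ0 hδ
  have h4 : 0 ≤ Real.log (4 * KOf γ κ * cMaxOf d b γ κ ^ 2) := by
    refine Real.log_nonneg ?_
    calc (1 : ℝ) ≤ 4 * 1 * 1 ^ 2 := by norm_num
      _ ≤ _ := by gcongr
  linarith

theorem nOf_pos (hd : 0 < d) (hb : 0 < b) (hγ : γ < 1) (hκ : 0 < κ) (hδ0 : 0 < δ)
    (hδ : δ < 1) : 0 < nOf d b γ κ δ := by
  have h1 := log_sub_log_pos hd hb hγ hκ hδ0 hδ
  have h2 := thetaOf_pos hd hb hγ hκ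
  have h3 : 0 < 1 - γ := by linarith
  rw [nOf, Nat.ceil_pos]
  positivity

theorem failureProb_nOf_le (hd : 0 < d) (hb : 0 < b) (hγ : γ < 1) (hκ : 0 < κ) (hδ0 : 0 < δ) :
    failureProb (nOf d b γ κ δ) (thetaOf d b γ κ) γ ≤
      δ / (4 * KOf γ κ * cMaxOf d b γ κ ^ 2) := by
  have h1 := one_le_cMaxOf hd hb hγ hκ
  have h2 : (1 : ℝ) ≤ KOf γ κ := Nat.one_le_cast.2 one_le_KOf
  have h3 := thetaOf_pos hd hb hγ hκ
  have h4 : 0 < 1 - γ := by linarith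
  have h5 : 0 < 4 * KOf γ κ * cMaxOf d b γ κ ^ 2 := by positivity
  rw [failureProb, ← Real.log_le_log_iff (Real.exp_pos _) (by positivity), Real.log_exp,
    Real.log_div hδ0.ne' h5.ne', neg_le, neg_sub]
  have h6 : (Real.log (4 * KOf γ κ * cMaxOf d b γ κ ^ 2) - Real.log δ) /
      (2 * thetaOf d b γ κ ^ 2 * (1 - γ) ^ 2) ≤ nOf d b γ κ δ := Nat.le_ceil _
  rw [div_le_iff₀ (by positivity)] at h6
  linarith

/-- At most `cMax` passes, `K` iterations, `cMax` core elements and four failure events each: this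
product is the argument of the logarithm in `nOf`. -/
theorem union_bound_le (hd : 0 < d) (hb : 0 < b) (hγ : γ < 1) (hκ : 0 < κ) (hδ0 : 0 < δ)
    {l : ℕ} (hl : ⌊cMaxOf d b γ κ⌋₊ = l) :
    l * (KOf γ κ * (l * (4 * failureProb (nOf d b γ κ δ) (thetaOf d b γ κ) γ))) ≤ δ := by
  have h1 := one_le_cMaxOf hd hb hγ hκ
  have h2 : (1 : ℝ) ≤ KOf γ κ := Nat.one_le_cast.2 one_le_KOf
  have h3 : (l : ℝ) ≤ cMaxOf d b γ κ := hl ▸ Nat.floor_le (by linarith)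
  have h4 := failureProb_nOf_le hd hb hγ hκ hδ0
  have h5 := failureProb_nonneg (nOf d b γ κ δ) (thetaOf d b γ κ) γ
  calc _ ≤ cMaxOf d b γ κ * (KOf γ κ * (cMaxOf d b γ κ *
        (4 * (δ / (4 * KOf γ κ * cMaxOf d b γ κ ^ 2))))) := by gcongr
    _ = δ := by field_simp

/-- Sampling and truncation contribute one unit each, misspecification `e`; the regularization term
`d · lam · b²` is exactly one squared unit, which explains the choice of `lamOf`. -/
theorem leastSquares_bound_le {ε e : ℝ} (hd : 0 < d) (hb : 0 < b) (hγ0 : 0 ≤ γ) (hγ : γ < 1)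
    (hκ : 0 < κ) (hε : 0 ≤ ε) (he : Real.sqrt d * Real.sqrt (cMaxOf d b γ κ) * ε ≤ e) {l : ℕ}
    (hl : ⌊cMaxOf d b γ κ⌋₊ = l) :
    d * (l * (ε + thetaOf d b γ κ + γ ^ (HOf d b γ κ + 1) / (1 - γ)) ^ 2 + lamOf d b γ κ * b ^ 2) ≤
      (e + 2 * (κ * (1 - γ) ^ 2 / 32)) ^ 2 + (κ * (1 - γ) ^ 2 / 32) ^ 2 := by
  have h1 := one_le_cMaxOf hd hb hγ hκ
  have h2 : (0 : ℝ) < d := Nat.cast_pos.2 hd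
  have h3 : (l : ℝ) ≤ cMaxOf d b γ κ := hl ▸ Nat.floor_le (by linarith)
  have h4 := sqrt_mul_thetaOf hd hb hγ hκ
  have h5 := sqrt_mul_truncation_le hd hb hγ0 hγ hκ
  have h6 := (thetaOf_pos hd hb hγ hκ).le
  have h7 : 0 < 1 - γ := by linarith
  have h8 : d * (lamOf d b γ κ * b ^ 2) = (κ * (1 - γ) ^ 2 / 32) ^ 2 := by
    rw [lamOf]
    field_simp
    norm_num
  have h9 : d * (l * (ε + thetaOf d b γ κ + γ ^ (HOf d b γ κ + 1) / (1 - γ)) ^ 2) ≤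
      (e + 2 * (κ * (1 - γ) ^ 2 / 32)) ^ 2 := by
    calc _ ≤ d * (cMaxOf d b γ κ *
          (ε + thetaOf d b γ κ + γ ^ (HOf d b γ κ + 1) / (1 - γ)) ^ 2) := by gcongr
      _ = (Real.sqrt d * Real.sqrt (cMaxOf d b γ κ) *
          (ε + thetaOf d b γ κ + γ ^ (HOf d b γ κ + 1) / (1 - γ))) ^ 2 := by
        rw [mul_pow, mul_pow, Real.sq_sqrt h2.le, Real.sq_sqrt (by linarith)]
        ring
      _ ≤ _ := by
        refine pow_le_pow_left₀ (by positivity) ?_ 2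
        rw [mul_add, mul_add]
        linarith
  rw [mul_add, h8]
  linarith

theorem total_error_le {η : ℝ} (hγ0 : 0 ≤ γ) (hγ : γ < 1) (hκ : 0 < κ) (hη0 : 0 ≤ η) :
    γ ^ (KOf γ κ - 1) / (1 - γ) + 2 * η / (1 - γ) ^ 2 + 2 * η ≤ κ / 8 + 4 * (η / (1 - γ) ^ 2) := by
  have h1 := pow_KOf_div_le hγ0 hγ hκ
  have h2 : 0 < 1 - γ := by linarith
  have h3 : η ≤ η / (1 - γ) ^ 2 := by
    rw [le_div_iff₀ (by positivity)]
    exact mul_le_of_le_one_right hη0 (pow_le_one₀ h2.le (by linarith))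
  have h4 : 2 * η / (1 - γ) ^ 2 = 2 * (η / (1 - γ) ^ 2) := mul_div_assoc _ _ _
  linarith

end Parameters

end

section

/-! ### Logarithmic bounds for the parameters -/

section Complexity

variable {d : ℕ} {b γ κ δ x : ℝ}

theorem log_one_div_nonneg {y : ℝ} (h0 : 0 < y) (h1 : y ≤ 1) : 0 ≤ Real.log (1 / y) :=
  Real.log_nonneg ((one_le_div h0).2 h1)

theorem one_le_logFactor (hd : 0 < d) (hb : 0 < b) (hγ0 : 0 ≤ γ) (hγ : γ < 1) (hx : 0 < x)
    (hδ0 : 0 < δ) (hδ : δ < 1) : 1 ≤ logFactor d b γ x δ := by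
  have h1 : 0 ≤ Real.log d := Real.log_nonneg (Nat.one_le_cast.2 hd)
  have h2 := log_one_div_nonneg (show 0 < 1 - γ by linarith) (by linarith)
  have h3 : 0 ≤ Real.log (1 + 1 / x) := Real.log_nonneg (by have := one_div_pos.2 hx; linarith)
  have h4 := log_one_div_nonneg hδ0 hδ.le
  have h5 : 0 ≤ Real.log (1 + b) := Real.log_nonneg (by linarith)
  rw [logFactor]
  linarith

theorem logFactor_le_sizeFactor (hd : 0 < d) (hγ : γ < 1) (hx : 0 < x) :
    logFactor d b γ x δ ≤ sizeFactor d b γ x δ := by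
  have h0 : 0 < 1 - γ := by linarith
  have h1 := Real.log_le_sub_one_of_pos (show (0 : ℝ) < d from Nat.cast_pos.2 hd)
  have h2 := Real.log_le_sub_one_of_pos (one_div_pos.2 h0)
  have h3 := Real.log_le_sub_one_of_pos (show 0 < 1 + 1 / x by positivity)
  rw [logFactor, sizeFactor]
  linarith

/-- The quantity `1/lam` is a product of powers of `b`, `d`, `1/κ` and `1/(1-γ)`, and its logarithm
splits accordingly. Allowing any `x ≤ κ` serves both cases, with `x = κ` and with `x = ε`. -/
theorem log_one_add_inv_lamOf_le (hd : 0 < d) (hb : 0 < b) (hγ0 : 0 ≤ γ) (hγ : γ < 1)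
    (hx : 0 < x) (hxκ : x ≤ κ) (hδ0 : 0 < δ) (hδ : δ < 1) :
    Real.log (1 + 1 / lamOf d b γ κ) ≤ 8 * logFactor d b γ x δ := by
  have hκ : 0 < κ := hx.trans_le hxκ
  have h0 : 0 < 1 - γ := by linarith
  have hd' : (1 : ℝ) ≤ d := Nat.one_le_cast.2 hd
  have h1 : 0 ≤ Real.log d := Real.log_nonneg hd'
  have h2 := log_one_div_nonneg h0 (by linarith)
  have h3 : 0 ≤ Real.log (1 + 1 / x) := Real.log_nonneg (by have := one_div_pos.2 hx; linarith)
  have h4 := log_one_div_nonneg hδ0 hδ.le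
  have h5 : 0 ≤ Real.log (1 + b) := Real.log_nonneg (by linarith)
  have hg : 1 ≤ 1 / (1 - γ) := (one_le_div h0).2 (by linarith)
  have hxx : 1 / κ ≤ 1 + 1 / x := by
    have := one_div_le_one_div_of_le hx hxκ
    linarith
  have hx1 : 1 ≤ 1 + 1 / x := by have := one_div_pos.2 hx; linarith
  have h6 : 1 + 1 / lamOf d b γ κ ≤
      2 ^ 11 * ((1 + b) ^ 2 * d * (1 + 1 / x) ^ 2 * (1 / (1 - γ)) ^ 4) := by
    have h7 : 1 / lamOf d b γ κ = 1024 * (b ^ 2 * d * (1 / κ) ^ 2 * (1 / (1 - γ)) ^ 4) := by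
      rw [lamOf]
      field_simp
    have h8 : b ^ 2 * d * (1 / κ) ^ 2 * (1 / (1 - γ)) ^ 4 ≤
        (1 + b) ^ 2 * d * (1 + 1 / x) ^ 2 * (1 / (1 - γ)) ^ 4 := by
      gcongr
      linarith
    have h9 : 1 ≤ (1 + b) ^ 2 * d * (1 + 1 / x) ^ 2 * (1 / (1 - γ)) ^ 4 := by
      calc (1 : ℝ) = 1 ^ 2 * 1 * 1 ^ 2 * 1 ^ 4 := by norm_num
        _ ≤ _ := by
          gcongr
          linarith
    rw [h7]
    linarith
  have h10 : 0 < 1 + 1 / lamOf d b γ κ := by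
    have := lamOf_pos hd hb hγ hκ
    positivity
  have h11 := Real.log_le_log h10 h6
  have h12 : (0 : ℝ) < d := by linarith
  rw [Real.log_mul (by positivity) (by positivity), Real.log_mul (by positivity) (by positivity),
    Real.log_mul (by positivity) (by positivity), Real.log_mul (by positivity) (by positivity),
    Real.log_pow, Real.log_pow, Real.log_pow, Real.log_pow] at h11
  have h13 := Real.log_two_lt_d9
  push_cast at h11
  rw [logFactor]
  linarith

theorem cMaxOf_le_logFactor (hd : 0 < d) (hb : 0 < b) (hγ0 : 0 ≤ γ) (hγ : γ < 1)
    (hx : 0 < x) (hxκ : x ≤ κ) (hδ0 : 0 < δ) (hδ : δ < 1) :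
    cMaxOf d b γ κ ≤ 30 * d * logFactor d b γ x δ := by
  have h1 := one_le_logFactor hd hb hγ0 hγ hx hδ0 hδ
  have h2 := log_one_add_inv_lamOf_le hd hb hγ0 hγ hx hxκ hδ0 hδ
  have h3 := Real.log_two_lt_d9
  refine (cMaxOf_le (y := 9 * logFactor d b γ x δ) (by linarith) (by linarith)).trans ?_
  have h4 : 0 ≤ (d : ℝ) * logFactor d b γ x δ := by positivity
  linarith

theorem KOf_le_logFactor (hd : 0 < d) (hb : 0 < b) (hγ0 : 0 ≤ γ) (hγ : γ < 1)
    (hx : 0 < x) (hxκ : x ≤ κ) (hδ0 : 0 < δ) (hδ : δ < 1) :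
    (KOf γ κ : ℝ) ≤ 7 * (logFactor d b γ x δ * (1 / (1 - γ))) := by
  have hκ : 0 < κ := hx.trans_le hxκ
  have h0 : 0 < 1 - γ := by linarith
  have hL := one_le_logFactor hd hb hγ0 hγ hx hδ0 hδ
  have h1 : 0 ≤ Real.log d := Real.log_nonneg (Nat.one_le_cast.2 hd)
  have h2 := log_one_div_nonneg h0 (by linarith)
  have h3 : 0 ≤ Real.log (1 + 1 / x) := Real.log_nonneg (by have := one_div_pos.2 hx; linarith)
  have h4 := log_one_div_nonneg hδ0 hδ.le
  have h5 : 0 ≤ Real.log (1 + b) := Real.log_nonneg (by linarith)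
  have hg : 1 ≤ 1 / (1 - γ) := (one_le_div h0).2 (by linarith)
  have hLg : 1 ≤ logFactor d b γ x δ * (1 / (1 - γ)) := one_le_mul_of_one_le_of_one_le hL hg
  have h6 : Real.log (1 / κ) ≤ Real.log (1 + 1 / x) := by
    refine Real.log_le_log (one_div_pos.2 hκ) ?_
    have := one_div_le_one_div_of_le hx hxκ
    linarith
  have h7 : Real.log (1 / (κ * (1 - γ) ^ 2)) = Real.log (1 / κ) + 2 * Real.log (1 / (1 - γ)) := by
    rw [show 1 / (κ * (1 - γ) ^ 2) = 1 / κ * (1 / (1 - γ)) ^ 2 by field_simp,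
      Real.log_mul (by positivity) (by positivity), Real.log_pow]
    norm_num
  have h8 : Real.log 8 ≤ 3 := by
    rw [show (8 : ℝ) = 2 ^ 3 by norm_num, Real.log_pow]
    have := Real.log_two_lt_d9
    push_cast
    linarith
  have h9 : Real.log (1 / (κ * (1 - γ) ^ 2)) + Real.log 8 ≤ 5 * logFactor d b γ x δ := by
    rw [h7]
    rw [logFactor] at hL ⊢
    linarith
  rw [KOf, Nat.cast_max, Nat.cast_one]
  refine max_le (by linarith) ((natCeil_le_add_one
    (c := 5 * (logFactor d b γ x δ * (1 / (1 - γ))) + 1) ?_ (by linarith)).trans (by linarith))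
  have h10 := mul_le_mul_of_nonneg_right h9 (zero_le_one.trans hg)
  rw [div_eq_mul_one_div]
  linarith

theorem log_cMaxOf_le (hd : 0 < d) (hb : 0 < b) (hγ0 : 0 ≤ γ) (hγ : γ < 1)
    (hx : 0 < x) (hxκ : x ≤ κ) (hδ0 : 0 < δ) (hδ : δ < 1) :
    Real.log (cMaxOf d b γ κ) ≤ 6 * logFactor d b γ x δ := by
  have hκ : 0 < κ := hx.trans_le hxκ
  have h0 : 0 < 1 - γ := by linarith
  have hL := one_le_logFactor hd hb hγ0 hγ hx hδ0 hδ
  have hd' : (0 : ℝ) < d := Nat.cast_pos.2 hd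
  have h1 : 0 ≤ Real.log d := Real.log_nonneg (Nat.one_le_cast.2 hd)
  have h2 := log_one_div_nonneg h0 (by linarith)
  have h3 : 0 ≤ Real.log (1 + 1 / x) := Real.log_nonneg (by have := one_div_pos.2 hx; linarith)
  have h4 := log_one_div_nonneg hδ0 hδ.le
  have h5 : 0 ≤ Real.log (1 + b) := Real.log_nonneg (by linarith)
  have h6 := Real.log_le_log (zero_lt_one.trans_le (one_le_cMaxOf hd hb hγ hκ))
    (cMaxOf_le_logFactor hd hb hγ0 hγ hx hxκ hδ0 hδ)
  rw [Real.log_mul (by positivity) (by positivity),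
    Real.log_mul (by positivity) (by positivity)] at h6
  have h7 := Real.log_le_sub_one_of_pos (zero_lt_one.trans_le hL)
  have h8 : Real.log 30 ≤ 4 := by
    refine (Real.log_le_log (by norm_num) (show (30 : ℝ) ≤ 2 ^ 5 by norm_num)).trans ?_
    rw [Real.log_pow]
    have := Real.log_two_lt_d9
    push_cast
    linarith
  have h9 : Real.log d ≤ logFactor d b γ x δ := by
    rw [logFactor]
    linarith
  linarith

theorem HOf_le_logFactor (hd : 0 < d) (hb : 0 < b) (hγ0 : 0 ≤ γ) (hγ : γ < 1)
    (hx : 0 < x) (hxκ : x ≤ κ) (hδ0 : 0 < δ) (hδ : δ < 1) :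
    1 + (HOf d b γ κ : ℝ) ≤ 13 * (logFactor d b γ x δ * (1 / (1 - γ))) := by
  have hκ : 0 < κ := hx.trans_le hxκ
  have h0 : 0 < 1 - γ := by linarith
  have hL := one_le_logFactor hd hb hγ0 hγ hx hδ0 hδ
  have hC := one_le_cMaxOf hd hb hγ hκ
  have hd' : (0 : ℝ) < d := Nat.cast_pos.2 hd
  have h1 : 0 ≤ Real.log d := Real.log_nonneg (Nat.one_le_cast.2 hd)
  have h2 := log_one_div_nonneg h0 (by linarith)
  have h3 : 0 ≤ Real.log (1 + 1 / x) := Real.log_nonneg (by have := one_div_pos.2 hx; linarith)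
  have h4 := log_one_div_nonneg hδ0 hδ.le
  have h5 : 0 ≤ Real.log (1 + b) := Real.log_nonneg (by linarith)
  have hg : 1 ≤ 1 / (1 - γ) := (one_le_div h0).2 (by linarith)
  have hLg : 1 ≤ logFactor d b γ x δ * (1 / (1 - γ)) := one_le_mul_of_one_le_of_one_le hL hg
  have h6 : Real.log (1 / κ) ≤ Real.log (1 + 1 / x) := by
    refine Real.log_le_log (one_div_pos.2 hκ) ?_
    have := one_div_le_one_div_of_le hx hxκ
    linarith
  have h7 : -Real.log (κ * (1 - γ) ^ 3) = Real.log (1 / κ) + 3 * Real.log (1 / (1 - γ)) := by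
    rw [← Real.log_inv, show (κ * (1 - γ) ^ 3)⁻¹ = 1 / κ * (1 / (1 - γ)) ^ 3 by field_simp,
      Real.log_mul (by positivity) (by positivity), Real.log_pow]
    norm_num
  have h8 : Real.log 32 ≤ 4 := by
    rw [show (32 : ℝ) = 2 ^ 5 by norm_num, Real.log_pow]
    have := Real.log_two_lt_d9
    push_cast
    linarith
  have h9 : Real.log (32 * Real.sqrt (cMaxOf d b γ κ) * Real.sqrt d) =
      Real.log 32 + Real.log (cMaxOf d b γ κ) / 2 + Real.log d / 2 := by
    have : 0 < Real.sqrt (cMaxOf d b γ κ) := Real.sqrt_pos.2 (by linarith)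
    rw [Real.log_mul (by positivity) (by positivity), Real.log_mul (by positivity) (by positivity),
      Real.log_sqrt (by linarith), Real.log_sqrt hd'.le]
  have h10 := log_cMaxOf_le hd hb hγ0 hγ hx hxκ hδ0 hδ
  have h11 : Real.log (32 * Real.sqrt (cMaxOf d b γ κ) * Real.sqrt d)
      - Real.log (κ * (1 - γ) ^ 3) ≤ 11 * logFactor d b γ x δ := by
    rw [sub_eq_add_neg, h7, h9]
    have h12 : Real.log d / 2 + Real.log (1 / κ) + 3 * Real.log (1 / (1 - γ)) ≤
        3 * logFactor d b γ x δ := by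
      rw [logFactor]
      linarith
    linarith
  have h13 : (HOf d b γ κ : ℝ) ≤ 11 * (logFactor d b γ x δ * (1 / (1 - γ))) + 1 := by
    refine natCeil_le_add_one ?_ (by linarith)
    have h12 := mul_le_mul_of_nonneg_right h11 (zero_le_one.trans hg)
    rw [div_eq_mul_one_div]
    linarith
  linarith

/-- The summand 1 comes from rounding up; without it the bound would fail for large `κ`. One
logarithmic factor comes from the union bound, the other from `cMax` in `thetaOf`. -/
theorem nOf_le_logFactor (hd : 0 < d) (hb : 0 < b) (hγ0 : 0 ≤ γ) (hγ : γ < 1)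
    (hx : 0 < x) (hxκ : x ≤ κ) (hδ0 : 0 < δ) (hδ : δ < 1) :
    (nOf d b γ κ δ : ℝ) ≤
      400000 * (logFactor d b γ x δ ^ 2 * (1 + d ^ 2 / (κ ^ 2 * (1 - γ) ^ 6))) := by
  have hκ : 0 < κ := hx.trans_le hxκ
  have h0 : 0 < 1 - γ := by linarith
  have hL := one_le_logFactor hd hb hγ0 hγ hx hδ0 hδ
  have hC := one_le_cMaxOf hd hb hγ hκ
  have hd' : (0 : ℝ) < d := Nat.cast_pos.2 hd
  have hK : (1 : ℝ) ≤ KOf γ κ := Nat.one_le_cast.2 one_le_KOf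
  have hg : 1 ≤ 1 / (1 - γ) := (one_le_div h0).2 (by linarith)
  have h1 : Real.log (KOf γ κ) ≤ 6 + 2 * logFactor d b γ x δ := by
    have h2 := Real.log_le_log (by linarith) (KOf_le_logFactor hd hb hγ0 hγ hx hxκ hδ0 hδ)
    rw [Real.log_mul (by positivity) (by positivity), Real.log_mul (by positivity)
      (by positivity)] at h2
    have h3 := Real.log_le_sub_one_of_pos (zero_lt_one.trans_le hL)
    have h4 := Real.log_le_sub_one_of_pos (show (0 : ℝ) < 7 by norm_num)
    have h5 : Real.log (1 / (1 - γ)) ≤ logFactor d b γ x δ := by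
      have h1 : 0 ≤ Real.log d := Real.log_nonneg (Nat.one_le_cast.2 hd)
      have h3 : 0 ≤ Real.log (1 + 1 / x) :=
        Real.log_nonneg (by have := one_div_pos.2 hx; linarith)
      have h4 := log_one_div_nonneg hδ0 hδ.le
      have h5 : 0 ≤ Real.log (1 + b) := Real.log_nonneg (by linarith)
      rw [logFactor]
      linarith
    linarith
  have h2 : -Real.log δ ≤ logFactor d b γ x δ := by
    have h1 : 0 ≤ Real.log d := Real.log_nonneg (Nat.one_le_cast.2 hd)
    have h2 := log_one_div_nonneg h0 (by linarith)
    have h3 : 0 ≤ Real.log (1 + 1 / x) :=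
      Real.log_nonneg (by have := one_div_pos.2 hx; linarith)
    have h5 : 0 ≤ Real.log (1 + b) := Real.log_nonneg (by linarith)
    have h6 : Real.log (1 / δ) = -Real.log δ := by rw [one_div, Real.log_inv]
    rw [logFactor]
    linarith
  have h3 : Real.log (4 * KOf γ κ * cMaxOf d b γ κ ^ 2) - Real.log δ ≤
      24 * logFactor d b γ x δ := by
    rw [Real.log_mul (by positivity) (by positivity), Real.log_mul (by positivity) (by positivity),
      Real.log_pow]
    have h4 := log_cMaxOf_le hd hb hγ0 hγ hx hxκ hδ0 hδ
    have h5 := Real.log_le_sub_one_of_pos (show (0 : ℝ) < 4 by norm_num)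
    push_cast
    linarith
  have h4 : (Real.log (4 * KOf γ κ * cMaxOf d b γ κ ^ 2) - Real.log δ) /
      (2 * thetaOf d b γ κ ^ 2 * (1 - γ) ^ 2) ≤
      368640 * (logFactor d b γ x δ ^ 2 * (d ^ 2 / (κ ^ 2 * (1 - γ) ^ 6))) := by
    have h5 := cMaxOf_le_logFactor hd hb hγ0 hγ hx hxκ hδ0 hδ
    rw [thetaOf_sq hd hb hγ hκ]
    calc _ ≤ 24 * logFactor d b γ x δ /
          (2 * (κ ^ 2 * (1 - γ) ^ 4 / (1024 * (d * cMaxOf d b γ κ))) * (1 - γ) ^ 2) := by gcongr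
      _ = 12288 * logFactor d b γ x δ * d * cMaxOf d b γ κ / (κ ^ 2 * (1 - γ) ^ 6) := by
        field_simp
        norm_num
      _ ≤ 12288 * logFactor d b γ x δ * d * (30 * d * logFactor d b γ x δ) /
          (κ ^ 2 * (1 - γ) ^ 6) := by gcongr
      _ = _ := by ring
  refine (natCeil_le_add_one h4 (by positivity)).trans ?_
  have h5 : 1 ≤ logFactor d b γ x δ ^ 2 := one_le_pow₀ hL
  have h6 : 0 ≤ logFactor d b γ x δ ^ 2 * (d ^ 2 / (κ ^ 2 * (1 - γ) ^ 6)) := by positivity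
  rw [mul_add (logFactor d b γ x δ ^ 2)]
  linarith

end Complexity

end

section

/-! ### Total numbers of queries and steps -/

section Complexity

variable {d : ℕ} {b γ κ δ x : ℝ}

/-- Restarts, iterations, core elements, rollouts and steps per rollout are multiplied; they carry
1, 1, 1, 2 and 1 logarithmic factors. -/
theorem totalQueries_le (hd : 0 < d) (hb : 0 < b) (hγ0 : 0 ≤ γ) (hγ : γ < 1)
    (hx : 0 < x) (hxκ : x ≤ κ) (hδ0 : 0 < δ) (hδ : δ < 1) {l : ℕ}
    (hl : ⌊cMaxOf d b γ κ⌋₊ = l) :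
    (totalQueries (paramsOf d b γ κ δ) l : ℝ) ≤
      32760000000 * (d ^ 2 / (1 - γ) ^ 2 * (1 + d ^ 2 / (κ ^ 2 * (1 - γ) ^ 6))) *
        logFactor d b γ x δ ^ 6 := by
  have hκ : 0 < κ := hx.trans_le hxκ
  have h0 : 0 < 1 - γ := by linarith
  have hL := one_le_logFactor hd hb hγ0 hγ hx hδ0 hδ
  have hC := one_le_cMaxOf hd hb hγ hκ
  have hm : (l : ℝ) ≤ 30 * d * logFactor d b γ x δ :=
    (hl ▸ Nat.floor_le (by linarith) : (l : ℝ) ≤ cMaxOf d b γ κ).trans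
      (cMaxOf_le_logFactor hd hb hγ0 hγ hx hxκ hδ0 hδ)
  have hK := KOf_le_logFactor hd hb hγ0 hγ hx hxκ hδ0 hδ
  have hH := HOf_le_logFactor hd hb hγ0 hγ hx hxκ hδ0 hδ
  have hn := nOf_le_logFactor hd hb hγ0 hγ hx hxκ hδ0 hδ
  simp only [totalQueries, phaseQueries, paramsOf]
  push_cast
  calc _ ≤ 30 * d * logFactor d b γ x δ * (7 * (logFactor d b γ x δ * (1 / (1 - γ))) *
        (30 * d * logFactor d b γ x δ *
          (400000 * (logFactor d b γ x δ ^ 2 * (1 + d ^ 2 / (κ ^ 2 * (1 - γ) ^ 6))) *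
            (13 * (logFactor d b γ x δ * (1 / (1 - γ))))))) := by gcongr
    _ = _ := by
      generalize 1 - γ = w
      ring

theorem checkCost_le {m : ℕ} {B : ℝ} (hB : 1 ≤ B) (hd : (d : ℝ) ≤ B) (hm : (m : ℝ) ≤ B) :
    (checkCost d m : ℝ) ≤ 32 * B ^ 3 * B := by
  have hB0 : 0 ≤ B := by linarith
  simp only [checkCost, invGramCost]
  push_cast
  calc _ ≤ B * B + B * (B * (B * 2) + B * 2 + 1 + B * (B * 3)) + B * (1 + (B + B * (B * 2))) +
        B * 2 * (B * 4 + 3) := by gcongr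
    _ ≤ _ := by
      -- In `t = B - 1 ≥ 0` the difference of the two sides has nonnegative coefficients, so
      -- `positivity` decides it.
      obtain ⟨t, rfl⟩ : ∃ t, B = 1 + t := ⟨B - 1, by ring⟩
      have ht : 0 ≤ t := by linarith
      rw [← sub_nonneg]
      ring_nf
      positivity

theorem phaseCost_le {prm : Params} {m : ℕ} {B : ℝ} (hB : 1 ≤ B) (hd : (d : ℝ) ≤ B)
    (hm : (m : ℝ) ≤ B) (hn : (prm.n : ℝ) ≤ B) (hH : (prm.H : ℝ) ≤ B) :
    (phaseCost d prm m : ℝ) ≤ 64 * B ^ 7 := by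
  have hB0 : 0 ≤ B := by linarith
  have hc := checkCost_le hB hd hm
  simp only [phaseCost, invGramCost]
  push_cast
  calc _ ≤ B * (B * (2 + B * (32 * B ^ 3 * B + 5)) + 1) +
        (B * B + B * (B * (B * 2) + B * 2 + 1 + B * (B * 3)) + B * (B * 2) + B * (B * 2)) := by
        gcongr
    _ ≤ _ := by
      obtain ⟨t, rfl⟩ : ∃ t, B = 1 + t := ⟨B - 1, by ring⟩
      have ht : 0 ≤ t := by linarith
      rw [← sub_nonneg]
      ring_nf
      positivity

theorem totalCost_le {prm : Params} {m : ℕ} {B : ℝ} (hB : 1 ≤ B) (hd : (d : ℝ) ≤ B)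
    (hm : (m : ℝ) ≤ B) (hn : (prm.n : ℝ) ≤ B) (hH : (prm.H : ℝ) ≤ B) (hK : (prm.K : ℝ) ≤ B) :
    (totalCost d prm m : ℝ) ≤ 100 * B ^ 9 := by
  have hB0 : 0 ≤ B := by linarith
  have hc := checkCost_le hB hd hm
  have hp := phaseCost_le hB hd hm hn hH
  simp only [totalCost]
  push_cast
  calc _ ≤ B + (B * (32 * B ^ 3 * B) + B * (B * (64 * B ^ 7))) := by gcongr
    _ ≤ _ := by
      obtain ⟨t, rfl⟩ : ∃ t, B = 1 + t := ⟨B - 1, by ring⟩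
      have ht : 0 ≤ t := by linarith
      rw [← sub_nonneg]
      ring_nf
      positivity

/-- All sizes are at most `800000 Z^12`, the largest being `n`, with `Z² · Z^10` from its logarithms
and its polynomial part. The cost has degree 9 in such a bound, and `12 · 9 = 108`. -/
theorem totalCost_le_sizeFactor (hd : 0 < d) (hb : 0 < b) (hγ0 : 0 ≤ γ) (hγ : γ < 1)
    (hx : 0 < x) (hxκ : x ≤ κ) (hδ0 : 0 < δ) (hδ : δ < 1) {l : ℕ}
    (hl : ⌊cMaxOf d b γ κ⌋₊ = l) :
    (totalCost d (paramsOf d b γ κ δ) l : ℝ) ≤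
      100 * 800000 ^ 9 * sizeFactor d b γ x δ ^ 108 := by
  have hκ : 0 < κ := hx.trans_le hxκ
  have h0 : 0 < 1 - γ := by linarith
  have hL := one_le_logFactor hd hb hγ0 hγ hx hδ0 hδ
  have hC := one_le_cMaxOf hd hb hγ hκ
  have hLZ : logFactor d b γ x δ ≤ sizeFactor d b γ x δ := logFactor_le_sizeFactor hd hγ hx
  have hd' : (1 : ℝ) ≤ d := Nat.one_le_cast.2 hd
  have hg : 1 ≤ 1 / (1 - γ) := (one_le_div h0).2 (by linarith)
  have hx' : 0 < 1 / x := one_div_pos.2 hx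
  have h4 := log_one_div_nonneg hδ0 hδ.le
  have h5 : 0 ≤ Real.log (1 + b) := Real.log_nonneg (by linarith)
  have hdZ : (d : ℝ) ≤ sizeFactor d b γ x δ := by
    rw [sizeFactor]
    linarith
  have hgZ : 1 / (1 - γ) ≤ sizeFactor d b γ x δ := by
    rw [sizeFactor]
    linarith
  have hκZ : 1 / κ ≤ sizeFactor d b γ x δ := by
    refine (one_div_le_one_div_of_le hx hxκ).trans ?_
    rw [sizeFactor]
    linarith
  have hm : (l : ℝ) ≤ 30 * d * logFactor d b γ x δ :=
    (hl ▸ Nat.floor_le (by linarith) : (l : ℝ) ≤ cMaxOf d b γ κ).trans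
      (cMaxOf_le_logFactor hd hb hγ0 hγ hx hxκ hδ0 hδ)
  have hK := KOf_le_logFactor hd hb hγ0 hγ hx hxκ hδ0 hδ
  have hH := HOf_le_logFactor hd hb hγ0 hγ hx hxκ hδ0 hδ
  have hn := nOf_le_logFactor hd hb hγ0 hγ hx hxκ hδ0 hδ
  generalize sizeFactor d b γ x δ = Z at *
  generalize logFactor d b γ x δ = L at *
  have hZ : 1 ≤ Z := hL.trans hLZ
  have hZ12 : Z ≤ Z ^ 12 := le_self_pow₀ hZ (by norm_num)
  have hZ2 : Z * Z ≤ Z ^ 12 := by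
    rw [← pow_two]
    exact pow_le_pow_right₀ hZ (by norm_num)
  have hLg : L * (1 / (1 - γ)) ≤ Z ^ 12 := by
    refine (mul_le_mul hLZ hgZ (by positivity) (by linarith)).trans hZ2
  have hdL : d * L ≤ Z ^ 12 := (mul_le_mul hdZ hLZ (by linarith) (by linarith)).trans hZ2
  have hn' : L ^ 2 * (1 + d ^ 2 / (κ ^ 2 * (1 - γ) ^ 6)) ≤ 2 * Z ^ 12 := by
    have h6 : (d : ℝ) ^ 2 / (κ ^ 2 * (1 - γ) ^ 6) = d ^ 2 * (1 / κ) ^ 2 * (1 / (1 - γ)) ^ 6 := by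
      field_simp
    rw [h6]
    calc _ ≤ Z ^ 2 * (Z ^ 10 + Z ^ 2 * Z ^ 2 * Z ^ 6) := by
          gcongr
          exact one_le_pow₀ hZ
      _ = _ := by ring
  refine (totalCost_le (B := 800000 * Z ^ 12) ?_ ?_ ?_ ?_ ?_ ?_).trans (le_of_eq ?_)
  · linarith
  · linarith
  · linarith
  · exact hn.trans (by linarith)
  · change (HOf d b γ κ : ℝ) ≤ _
    linarith
  · exact hK.trans (by linarith)
  · rw [mul_pow, ← pow_mul, mul_assoc]

/-- Capping `κ` at `1/(1-γ)` keeps the leading term at least 1, so it absorbs the rounding term. -/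
theorem one_add_le_of_realizable (hd : 0 < d) (hγ0 : 0 ≤ γ) (hγ : γ < 1) (hκ : 0 < κ) :
    d ^ 2 / (1 - γ) ^ 2 * (1 + d ^ 2 / (κ ^ 2 * (1 - γ) ^ 6)) ≤
      2 * (d ^ 4 / (min κ (1 / (1 - γ)) ^ 2 * (1 - γ) ^ 8)) := by
  have h0 : 0 < 1 - γ := by linarith
  have hd' : (1 : ℝ) ≤ d := Nat.one_le_cast.2 hd
  have hm : 0 < min κ (1 / (1 - γ)) := lt_min hκ (one_div_pos.2 h0)
  have hg : 1 ≤ 1 / (1 - γ) := (one_le_div h0).2 (by linarith)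
  have h1 : (d : ℝ) ^ 2 / (κ ^ 2 * (1 - γ) ^ 6) ≤
      d ^ 2 / (min κ (1 / (1 - γ)) ^ 2 * (1 - γ) ^ 6) := by
    gcongr
    exact min_le_left _ _
  have h2 : 1 ≤ (d : ℝ) ^ 2 / (min κ (1 / (1 - γ)) ^ 2 * (1 - γ) ^ 6) := by
    calc (1 : ℝ) ≤ 1 ^ 2 / ((1 / (1 - γ)) ^ 2 * (1 - γ) ^ 6) := by
          rw [show (1 / (1 - γ)) ^ 2 * (1 - γ) ^ 6 = (1 - γ) ^ 4 by field_simp, one_pow]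
          exact (one_le_div (by positivity)).2 (pow_le_one₀ h0.le (by linarith))
      _ ≤ _ := by
        gcongr
        exact min_le_right _ _
  calc _ ≤ d ^ 2 / (1 - γ) ^ 2 * (2 * (d ^ 2 / (min κ (1 / (1 - γ)) ^ 2 * (1 - γ) ^ 6))) := by
        gcongr
        linarith
    _ = _ := by
        field_simp

/-- Here `κ` grows with `d` and `1/(1-γ)²`, which cancels `d²` and four powers of `1-γ` in the
rollout count. The cap on `ε` absorbs rounding as before. -/
theorem one_add_le_of_misspecified {ε : ℝ} (hd : 0 < d) (hγ : γ < 1)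
    (hε : 0 < ε) (hκ : ε * d / (1 - γ) ^ 2 ≤ κ) :
    d ^ 2 / (1 - γ) ^ 2 * (1 + d ^ 2 / (κ ^ 2 * (1 - γ) ^ 6)) ≤
      2 * (d ^ 2 / (min ε (1 / (1 - γ)) ^ 2 * (1 - γ) ^ 4)) := by
  have h0 : 0 < 1 - γ := by linarith
  have hd' : (1 : ℝ) ≤ d := Nat.one_le_cast.2 hd
  have hm : 0 < min ε (1 / (1 - γ)) := lt_min hε (one_div_pos.2 h0)
  have h1 : (d : ℝ) ^ 2 / (κ ^ 2 * (1 - γ) ^ 6) ≤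
      1 / (min ε (1 / (1 - γ)) ^ 2 * (1 - γ) ^ 2) := by
    calc _ ≤ (d : ℝ) ^ 2 / ((ε * d / (1 - γ) ^ 2) ^ 2 * (1 - γ) ^ 6) := by gcongr
      _ = 1 / (ε ^ 2 * (1 - γ) ^ 2) := by field_simp
      _ ≤ _ := by
        gcongr
        exact min_le_left _ _
  have h2 : 1 ≤ 1 / (min ε (1 / (1 - γ)) ^ 2 * (1 - γ) ^ 2) := by
    calc (1 : ℝ) = 1 / ((1 / (1 - γ)) ^ 2 * (1 - γ) ^ 2) := by field_simp
      _ ≤ _ := by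
        gcongr
        exact min_le_right _ _
  calc _ ≤ d ^ 2 / (1 - γ) ^ 2 * (2 * (1 / (min ε (1 / (1 - γ)) ^ 2 * (1 - γ) ^ 2))) := by
        gcongr
        linarith
    _ = _ := by
        field_simp

end Complexity

/-! ### Assembly of the bounds -/

section Main

variable {S : Type u} [MeasurableSpace S] {A : Type v} [MeasurableSpace A] {d : ℕ}
  {M : MDP S A} {φ : S × A → Fin d → ℝ} {G : GreedyOracle φ} {π₀ : Policy S A}
  {b κ δ x : ℝ}

theorem localAccess_and_sure_confidentMCLSPI (hφ : Measurable φ) (hbd : BoundedFeatures φ)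
    (hd : 0 < d) (hb : 0 < b) (hx : 0 < x) (hxκ : x ≤ κ) (hδ0 : 0 < δ) (hδ : δ < 1) (ρ : S)
    (a₀ : A) (N : ℕ) (hN : cMaxOf d b M.γ κ ≤ N) {Y : ℝ}
    (hY : d ^ 2 / (1 - M.γ) ^ 2 * (1 + d ^ 2 / (κ ^ 2 * (1 - M.γ) ^ 6)) ≤ 2 * Y) :
    (confidentMCLSPI (paramsOf d b M.γ κ δ) M.γ ρ a₀ N : Prog S A d (Option (Pol d))).LocalAccess
        M φ G {ρ} ∧
      (confidentMCLSPI (paramsOf d b M.γ κ δ) M.γ ρ a₀ N).Sure M φ G (fun q t out =>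
        out ≠ none ∧ (q : ℝ) ≤ 100 * 800000 ^ 9 * Y * logFactor d b M.γ x δ ^ 108 ∧
        (t : ℝ) ≤ 100 * 800000 ^ 9 * sizeFactor d b M.γ x δ ^ 108) := by
  have hγ := M.γ_lt_one
  have hκ := hx.trans_le hxκ
  have hw := within_confidentMCLSPI (M := M) (G := G) (prm := paramsOf d b M.γ κ δ) hφ hbd hd
    (lamOf_pos hd hb hγ hκ) rfl ρ a₀ N hN
  refine ⟨hw.localAccess, hw.sure.mono fun q t out => ?_⟩
  rintro ⟨hq, ht, -, hout⟩
  refine ⟨hout, ?_, ?_⟩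
  · have h1 := totalQueries_le hd hb M.γ_nonneg hγ hx hxκ hδ0 hδ rfl
    have hL := one_le_logFactor hd hb M.γ_nonneg hγ hx hδ0 hδ
    have h2 : 0 < 1 - M.γ := by linarith
    have h3 : 0 ≤ Y := by
      have : 0 ≤ d ^ 2 / (1 - M.γ) ^ 2 * (1 + d ^ 2 / (κ ^ 2 * (1 - M.γ) ^ 6)) := by positivity
      linarith
    refine ((Nat.cast_le.2 hq).trans h1).trans ?_
    calc _ ≤ 32760000000 * (2 * Y) * logFactor d b M.γ x δ ^ 108 := by
          gcongr 32760000000 * ?_ * ?_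
          exact pow_le_pow_right₀ hL (by norm_num)
      _ ≤ 100 * 800000 ^ 9 * Y * logFactor d b M.γ x δ ^ 108 := by
          gcongr ?_ * _
          norm_num
          linarith
  · exact (Nat.cast_le.2 ht).trans
      (totalCost_le_sizeFactor hd hb M.γ_nonneg hγ hx hxκ hδ0 hδ rfl)

/-- With `u = κ(1-γ)²/32` the squared regression error is at most `(2u + 2u)² + u² ≤ (5u)²`, and `ε
≤ u`, so `η = 6u` is admissible. The total loss is at most `κ/8 + 24κ/32 = 7κ/8`. -/
theorem prob_isOptimalUpTo (hφ : Measurable φ) (hbd : BoundedFeatures φ)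
    (hd : 0 < d) (hb : 0 < b) (hκ : 0 < κ) (hδ0 : 0 < δ) (hδ : δ < 1) (ρ : S)
    (a₀ : A) (N : ℕ) (hN : cMaxOf d b M.γ κ ≤ N) {ε : ℝ} (hε0 : 0 ≤ ε)
    (hreal : LinearRealizable M φ b ε) (hε : ε ≤ κ * (1 - M.γ) ^ 2 / 32)
    {g : ℝ} (hg : κ ≤ g)
    (hεC : Real.sqrt d * Real.sqrt (cMaxOf d b M.γ κ) * ε ≤ 2 * (κ * (1 - M.γ) ^ 2 / 32)) :
    ENNReal.ofReal (1 - δ) ≤ (confidentMCLSPI (paramsOf d b M.γ κ δ) M.γ ρ a₀ N).prob M φ G π₀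
      (IsOptimalUpTo M G π₀ ρ g) := by
  have hγ := M.γ_lt_one
  have h0 : 0 < 1 - M.γ := by linarith
  have hu : 0 < κ * (1 - M.γ) ^ 2 / 32 := by positivity
  refine prob_confidentMCLSPI (prm := paramsOf d b M.γ κ δ) (b := b) (ε := ε)
    (θ := thetaOf d b M.γ κ) (η := 6 * (κ * (1 - M.γ) ^ 2 / 32)) hφ hbd hd
    (lamOf_pos hd hb hγ hκ) rfl (nOf_pos hd hb hγ hκ hδ0 hδ) one_le_KOf
    (thetaOf_pos hd hb hγ hκ).le hreal hε0 rfl ?_ ?_ ?_ (union_bound_le hd hb hγ hκ hδ0 rfl)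
    ρ a₀ N hN
  · linarith
  · refine (leastSquares_bound_le hd hb M.γ_nonneg hγ hκ hε0 hεC rfl).trans ?_
    generalize κ * (1 - M.γ) ^ 2 / 32 = u at *
    have h1 : (5 * u) ^ 2 ≤ (6 * u - ε) ^ 2 := pow_le_pow_left₀ (by linarith) (by linarith) 2
    have h2 : 0 ≤ u ^ 2 := sq_nonneg u
    linarith
  · refine (total_error_le M.γ_nonneg hγ hκ (by linarith)).trans ?_
    have h1 : 6 * (κ * (1 - M.γ) ^ 2 / 32) / (1 - M.γ) ^ 2 = 6 * κ / 32 := by field_simp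
    rw [h1]
    linarith

end Main

section Misspecified

variable {d : ℕ} {b γ ε : ℝ}

theorem one_le_one_add_log (hd : 0 < d) (hb : 0 < b) (hε : 0 < ε) :
    1 ≤ 1 + Real.log (1 + b ^ 2 / (ε ^ 2 * d)) := by
  have h1 : (0 : ℝ) < d := Nat.cast_pos.2 hd
  have h2 : 0 ≤ Real.log (1 + b ^ 2 / (ε ^ 2 * d)) :=
    Real.log_nonneg (by have : 0 < b ^ 2 / (ε ^ 2 * d) := by positivity
                        linarith)
  linarith

theorem le_kappaOf (hd : 0 < d) (hb : 0 < b) (hγ : γ < 1) (hε : 0 < ε) :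
    32 * ε * d / (1 - γ) ^ 2 ≤ kappaOf d b γ ε := by
  have h0 : 0 < 1 - γ := by linarith
  have h1 : 1 ≤ Real.sqrt (1 + Real.log (1 + b ^ 2 / (ε ^ 2 * d))) :=
    Real.one_le_sqrt.2 (one_le_one_add_log hd hb hε)
  exact le_mul_of_one_le_right (by positivity) h1

/-- `kappaOf` solves a circular requirement: `cMax` depends on `κ` through `lam`. With `Y` the term
under the root, this `κ` gives `1/lam ≤ b²/(ε²d)`, so `cMax ≤ (16/5) d Y`, and `√(d · cMax) ε ≤ 2 d
ε √Y` is two units. -/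
theorem sqrt_mul_misspecification_le (hd : 0 < d) (hb : 0 < b) (hγ : γ < 1) (hε : 0 < ε) :
    Real.sqrt d * Real.sqrt (cMaxOf d b γ (kappaOf d b γ ε)) * ε ≤
      2 * (kappaOf d b γ ε * (1 - γ) ^ 2 / 32) := by
  have h0 : 0 < 1 - γ := by linarith
  have hd' : (0 : ℝ) < d := Nat.cast_pos.2 hd
  have hY := one_le_one_add_log (b := b) hd hb hε
  set Y := 1 + Real.log (1 + b ^ 2 / (ε ^ 2 * d)) with hYdef
  have h1 : 1 / lamOf d b γ (kappaOf d b γ ε) ≤ b ^ 2 / (ε ^ 2 * d) := by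
    rw [lamOf, kappaOf, mul_pow, Real.sq_sqrt (by linarith), ← hYdef]
    have : 1 / ((32 * ε * d / (1 - γ) ^ 2) ^ 2 * Y * (1 - γ) ^ 4 / (1024 * b ^ 2 * d)) =
        b ^ 2 / (ε ^ 2 * d) / Y := by
      field_simp
      norm_num
    rw [this]
    exact div_le_self (by positivity) hY
  have hκ : 0 < kappaOf d b γ ε :=
    lt_of_lt_of_le (by positivity) (le_kappaOf hd hb hγ hε)
  have h2 : cMaxOf d b γ (kappaOf d b γ ε) ≤ 16 / 5 * d * Y := by
    refine cMaxOf_le ?_ (by linarith)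
    have h3 : Real.log (1 + 1 / lamOf d b γ (kappaOf d b γ ε)) ≤
        Real.log (1 + b ^ 2 / (ε ^ 2 * d)) := by
      refine Real.log_le_log ?_ (by linarith)
      have := lamOf_pos hd hb hγ hκ
      positivity
    have h4 := Real.log_two_lt_d9
    linarith
  have h3 : Real.sqrt d * Real.sqrt (cMaxOf d b γ (kappaOf d b γ ε)) ≤ 2 * d * Real.sqrt Y := by
    rw [← Real.sqrt_mul hd'.le]
    refine Real.sqrt_le_iff.2 ⟨by positivity, ?_⟩
    rw [mul_pow, Real.sq_sqrt (by linarith)]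
    calc _ ≤ (d : ℝ) * (4 * d * Y) := by
          gcongr
          refine h2.trans ?_
          gcongr
          norm_num
      _ = _ := by ring
  calc _ ≤ 2 * d * Real.sqrt Y * ε := by gcongr
    _ = _ := by
      rw [kappaOf, ← hYdef]
      field_simp

end Misspecified

end

end

end LSPI

theorem theorem1 :
    ∃ (c : ℝ) (p : ℕ), ∀ (S : Type u) [MeasurableSpace S] (A : Type v) [MeasurableSpace A]
      (M : MDP S A) (d : ℕ) (φ : S × A → Fin d → ℝ) (G : GreedyOracle φ) (π₀ : Policy S A)
      (ρ : S) (a₀ : A) (b δ : ℝ),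
      Measurable φ → 0 < d → 0 < b → 0 < δ → δ < 1 → BoundedFeatures φ →
      -- the realizable case
      (LinearRealizable M φ b 0 → ∀ κ : ℝ, 0 < κ → ∀ N : ℕ, cMaxOf d b M.γ κ ≤ N →
        let alg : Prog S A d (Option (Pol d)) :=
          confidentMCLSPI (paramsOf d b M.γ κ δ) M.γ ρ a₀ N
        alg.LocalAccess M φ G {ρ} ∧
        alg.Sure M φ G (fun q t out =>
          out ≠ none ∧
          (q : ℝ) ≤ c * (d ^ 4 / (min κ (1 / (1 - M.γ)) ^ 2 * (1 - M.γ) ^ 8))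
            * logFactor d b M.γ κ δ ^ p ∧
          (t : ℝ) ≤ c * sizeFactor d b M.γ κ δ ^ p) ∧
        ENNReal.ofReal (1 - δ) ≤ alg.prob M φ G π₀ (IsOptimalUpTo M G π₀ ρ κ)) ∧
      -- the misspecified case
      (∀ ε : ℝ, 0 < ε → LinearRealizable M φ b ε →
        ∀ N : ℕ, cMaxOf d b M.γ (kappaOf d b M.γ ε) ≤ N →
        let alg : Prog S A d (Option (Pol d)) :=
          confidentMCLSPI (paramsOf d b M.γ (kappaOf d b M.γ ε) δ) M.γ ρ a₀ N
        alg.LocalAccess M φ G {ρ} ∧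
        alg.Sure M φ G (fun q t out =>
          out ≠ none ∧
          (q : ℝ) ≤ c * (d ^ 2 / (min ε (1 / (1 - M.γ)) ^ 2 * (1 - M.γ) ^ 4))
            * logFactor d b M.γ ε δ ^ p ∧
          (t : ℝ) ≤ c * sizeFactor d b M.γ ε δ ^ p) ∧
        ENNReal.ofReal (1 - δ) ≤ alg.prob M φ G π₀ (IsOptimalUpTo M G π₀ ρ
          (64 * ε * d / (1 - M.γ) ^ 2
            * Real.sqrt (1 + Real.log (1 + b ^ 2 / (ε ^ 2 * d)))))) := by
  -- The constants of the step bound; they also dominate those of the query bound.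
  refine ⟨100 * 800000 ^ 9, 108, ?_⟩
  intro S _ A _ M d φ G π₀ ρ a₀ b δ hφ hd hb hδ0 hδ hbd
  have hγ := M.γ_lt_one
  have h0 : 0 < 1 - M.γ := by linarith
  refine ⟨fun hreal κ hκ N hN => ?_, fun ε hε hreal N hN => ?_⟩
  · have h1 := localAccess_and_sure_confidentMCLSPI (G := G) hφ hbd hd hb hκ le_rfl hδ0 hδ ρ a₀ N hN
      (one_add_le_of_realizable hd M.γ_nonneg hγ hκ)
    refine ⟨h1.1, h1.2, ?_⟩
    refine prob_isOptimalUpTo hφ hbd hd hb hκ hδ0 hδ ρ a₀ N hN le_rfl hreal (by positivity) le_rfl ?_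
    rw [mul_zero]
    positivity
  · have h1 := le_kappaOf hd hb hγ hε
    have h2 : ε * d / (1 - M.γ) ^ 2 ≤ kappaOf d b M.γ ε := by
      refine le_trans ?_ h1
      gcongr
      linarith
    have h3 : 32 * ε ≤ 32 * ε * d := le_mul_of_one_le_right (by linarith) (Nat.one_le_cast.2 hd)
    have h4 : ε ≤ kappaOf d b M.γ ε * (1 - M.γ) ^ 2 / 32 := by
      rw [div_le_iff₀ (by positivity)] at h1
      linarith
    have h5 : ε ≤ kappaOf d b M.γ ε := by
      refine le_trans ?_ h2
      rw [le_div_iff₀ (by positivity)]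
      calc ε * (1 - M.γ) ^ 2 ≤ ε * 1 := by
            gcongr
            exact pow_le_one₀ h0.le (by linarith [M.γ_nonneg])
        _ ≤ ε * d := by
            gcongr
            exact Nat.one_le_cast.2 hd
    have h6 := localAccess_and_sure_confidentMCLSPI (G := G) hφ hbd hd hb hε h5 hδ0 hδ ρ a₀ N hN
      (one_add_le_of_misspecified hd hγ hε h2)
    refine ⟨h6.1, h6.2, ?_⟩
    refine prob_isOptimalUpTo hφ hbd hd hb (hε.trans_le h5) hδ0 hδ ρ a₀ N hN
      hε.le hreal h4 ?_ (sqrt_mul_misspecification_le hd hb hγ hε)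
    -- The claimed loss is `2κ`; the argument above even gives `κ`.
    rw [show 64 * ε * d / (1 - M.γ) ^ 2 * Real.sqrt (1 + Real.log (1 + b ^ 2 / (ε ^ 2 * d))) =
      2 * kappaOf d b M.γ ε by rw [kappaOf]; ring]
    linarith
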